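/- **Setting.** A channel with input alphabet $[0,1]$ and measurable output space $\mathcal Y$ is given by a Markov kernel $W=p_{Y|X}$. Fix $c_{\max}>0$. The admissible inputs are the probability densities $p$ on $[0,1]$ that are piecewise continuous (continuous off a finite set, with finite one-sided limits) and satisfy $p\le c_{\max}$. Write $I_p(X;Y)$ for the mutual information when $X\sim p$ and $Y$ is the output of $W$, and assume that $C_{\max}:=\sup_p I_p(X;Y)<\infty$. For a function $b$ on $[0,1]$ let $$C_b(B)=\sup\{I_p(X;Y): p \text{ admissible},\ \mathbb E_p[b(X)]\ge B\}\quad(\sup\emptyset=0),\qquad B_{\max}(b)=\sup_{p}\mathbb E_p[b(X)].$$ Let $\beta:[0,1]\to[0,\infty)$ (the harvesting function) have total variation at most $K$, and put $B_{\max}=B_{\max}(\beta)$. **Samples and reconstruction.** Let $m=2^J$, $J\ge 0$, and let $Y_i=\beta(x_i)+Z_i$, $0\le i<m$, where $Z_0,\dots,Z_{m-1}$ are i.i.d. $\mathcal N(0,\sigma^2)$ with known $\sigma>0$ and $x_i\in[\frac im,\frac{i+1}m]$ (this includes the regular grids $x_i=\frac im$ and, for $m\ge 2$, $x_i=\frac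 i{m-1}$). Let $\phi,\psi$ be a compactly supported scaling function and mother wavelet of an orthonormal multiresolution analysis of $L_2(\mathbb R)$, with $\int\psi=0$. On $[0,1]$ use the periodized functions $\phi^{\circ}(x)=\sum_{l\in\mathbb Z}\phi(x+l)$ and $\psi_{j,k}^{\circ}(x)=\sum_{l\in\mathbb Z}2^{j/2}\psi(2^j(x+l)-k)$; for the Haar wavelet periodization changes nothing almost everywhere on $[0,1]$. Let $f_Y$ be the step function equal to $Y_i$ on $[\frac im,\frac{i+1}m)$. The reconstruction is $$\widehat\beta_m^{\,\mathsf{wv}}=s(\langle f_Y,\phi^{\circ}\rangle)\,\phi^{\circ}+\sum_{j=0}^{J-1}\sum_{k=0}^{2^j-1}s(\langle f_Y,\psi^{\circ}_{j,k}\rangle)\,\psi^{\circ}_{j,k},$$ with inner products in $L_2[0,1]$ and the soft threshold $s(y)=\operatorname{sign}(y)\max(|y|-\lambda,0)$, $\lambda=\sqrt{2\tfrac{\sigma^2}{m}\log m}$. **Statement.** Let $\alpha>0$ and suppose that $C_\beta$ is $\alpha$-Hölder continuous, i.e. for some constant $c$, $$|C_\beta(B_1)-C_\beta(B_2)|\le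 c|B_1-B_2|^{\alpha}\qquad\text{for all }B_1,B_2\in(0,B_{\max}).$$ Then for every $B\in[0,B_{\max})$ the information loss $|C_\beta(B)-C_{\widehat\beta_m^{\,\mathsf{wv}}}(B)|$ is integrable with respect to the noise for every $m=2^J$, and, as $m=2^J\to\infty$, $$\mathbb E\left[\,|C_\beta(B)-C_{\widehat\beta_m^{\,\mathsf{wv}}}(B)|\,\right]=\mathcal O\!\left(m^{-\frac{\alpha}{3(\alpha+1)}}(\log m)^{\frac{\alpha}{2(\alpha+1)}}\right).$$ In particular, in the Lipschitz case $\alpha=1$ the expected information loss is $\mathcal O(m^{-1/6}(\log m)^{1/4})=\widetilde{\mathcal O}(m^{-1/6})$. -/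

import Mathlib

open Set Filter Topology MeasureTheory ProbabilityTheory
open scoped NNReal ENNReal

namespace SIET

noncomputable section

/-! ### Harvesting functions of bounded variation on `[0,1]` -/

/-- The class of real functions whose total variation on `[0,1]` is at most `K`.
Functions are written on `ℝ`, but only their values on `[0,1]` are ever used. -/
def BV (K : ℝ) : Set (ℝ → ℝ) :=
  {f | eVariationOn f (Icc 0 1) ≤ ENNReal.ofReal K}

/-! ### Input distributions, mutual information, capacity-energy function -/

/-- `p` is piecewise continuous on `[0,1]`: continuous off a finite set, with finite one-sided
limits everywhere. -/
def PiecewiseContinuous (p : ℝ → ℝ) : Prop :=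
  (∃ S : Finset ℝ, ContinuousOn p (Icc 0 1 \ (S : Set ℝ))) ∧
  (∀ x ∈ Ico (0 : ℝ) 1, ∃ l, Tendsto p (𝓝[>] x) (𝓝 l)) ∧
  (∀ x ∈ Ioc (0 : ℝ) 1, ∃ l, Tendsto p (𝓝[<] x) (𝓝 l))

/-- Admissible input densities: piecewise continuous probability densities on `[0,1]` that are
bounded by `cmax`. -/
structure Admissible (cmax : ℝ) (p : ℝ → ℝ) : Prop where
  piecewiseContinuous : PiecewiseContinuous p
  nonneg : ∀ x ∈ Icc (0 : ℝ) 1, 0 ≤ p x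
  le_cmax : ∀ x ∈ Icc (0 : ℝ) 1, p x ≤ cmax
  integral_eq_one : ∫ x in (0 : ℝ)..1, p x = 1

/-- The law on `[0,1]` of an input `X` with density `p`. -/
def inputLaw (p : ℝ → ℝ) : Measure unitInterval :=
  (volume : Measure unitInterval).withDensity fun x => ENNReal.ofReal (p x)

/-- The mutual information `I(X;Y)` (in nats) when `X` has density `p` and `Y` is the output of the
channel `W`: the Kullback-Leibler divergence of the joint law from the product of the marginals. -/
def mutualInfo {𝒴 : Type*} [MeasurableSpace 𝒴] (W : Kernel unitInterval 𝒴) (p : ℝ → ℝ) : ℝ≥0∞ :=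
  InformationTheory.klDiv (inputLaw p ⊗ₘ W) ((inputLaw p).prod (W ∘ₘ inputLaw p))

/-- The expected energy `𝔼[β(X)]` when `X` has density `p`. -/
def energy (β p : ℝ → ℝ) : ℝ := ∫ x in (0 : ℝ)..1, p x * β x

/-- The unconstrained capacity. -/
def maxCapacity {𝒴 : Type*} [MeasurableSpace 𝒴] (W : Kernel unitInterval 𝒴) (cmax : ℝ) : ℝ≥0∞ :=
  ⨆ (p : ℝ → ℝ) (_ : Admissible cmax p), mutualInfo W p

/-- The capacity-energy function `C_β(B)`; it is `0` if no admissible input delivers energy `B`. -/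
def capacityEnergy {𝒴 : Type*} [MeasurableSpace 𝒴] (W : Kernel unitInterval 𝒴) (cmax : ℝ)
    (β : ℝ → ℝ) (B : ℝ) : ℝ≥0∞ :=
  ⨆ (p : ℝ → ℝ) (_ : Admissible cmax p) (_ : B ≤ energy β p), mutualInfo W p

/-- The capacity-energy function as a real number (used when the capacity is finite). -/
def capacityEnergyReal {𝒴 : Type*} [MeasurableSpace 𝒴] (W : Kernel unitInterval 𝒴) (cmax : ℝ)
    (β : ℝ → ℝ) (B : ℝ) : ℝ :=
  (capacityEnergy W cmax β B).toReal

/-- The largest deliverable energy. -/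
def maxEnergy (cmax : ℝ) (β : ℝ → ℝ) : ℝ :=
  sSup {e : ℝ | ∃ p : ℝ → ℝ, Admissible cmax p ∧ e = energy β p}

/-! ### Wavelets -/

/-- The dilated translate `x ↦ 2^{j/2} f(2^j x - k)`. -/
def dilate (f : ℝ → ℝ) (j k : ℤ) (x : ℝ) : ℝ :=
  (2 : ℝ) ^ ((j : ℝ) / 2) * f ((2 : ℝ) ^ j * x - k)

/-- The closed subspace of `L²(ℝ)` spanned by the functions `x ↦ 2^{j/2} f(2^j x - k)`, `k ∈ ℤ`. -/
def scaleSpace (f : ℝ → ℝ) (j : ℤ) : Submodule ℝ (Lp ℝ 2 (volume : Measure ℝ)) :=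
  (Submodule.span ℝ {g : Lp ℝ 2 (volume : Measure ℝ) |
    ∃ k : ℤ, (g : ℝ → ℝ) =ᵐ[volume] dilate f j k}).topologicalClosure

/-- `φ` and `ψ` are the scaling function and the mother wavelet of an orthonormal multiresolution
analysis of `L²(ℝ)`, both compactly supported, and `ψ` has a vanishing moment. -/
structure IsCompactWavelet (φ ψ : ℝ → ℝ) : Prop where
  memLp_scaling : MemLp φ 2 volume
  memLp_mother : MemLp ψ 2 volume
  hasCompactSupport_scaling : HasCompactSupport φ
  hasCompactSupport_mother : HasCompactSupport ψ
  /-- the integer translates of the scaling function are orthonormal -/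
  orthonormal_scaling : ∀ k l : ℤ, ∫ x, φ (x - k) * φ (x - l) = if k = l then 1 else 0
  nested : ∀ j : ℤ, scaleSpace φ j ≤ scaleSpace φ (j + 1)
  iInf_eq_bot : ⨅ j : ℤ, scaleSpace φ j = ⊥
  dense : (⨆ j : ℤ, scaleSpace φ j).topologicalClosure = ⊤
  /-- the integer translates of the mother wavelet are orthonormal and span the orthogonal
  complement of `V_0` in `V_1` -/
  orthonormal_mother : ∀ k l : ℤ, ∫ x, ψ (x - k) * ψ (x - l) = if k = l then 1 else 0
  scaleSpace_mother : scaleSpace ψ 0 = scaleSpace φ 1 ⊓ (scaleSpace φ 0)ᗮ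
  vanishing_moment : ∫ x, ψ x = 0

/-- The 1-periodization `x ↦ ∑_{l ∈ ℤ} f(x + l)` (a finite sum if `f` has compact support). It turns
the wavelets on the line into wavelets on `[0,1]`; it changes nothing (almost everywhere on `[0,1]`)
if `f` is supported in `[0,1]`, as for the Haar system. -/
def periodize (f : ℝ → ℝ) (x : ℝ) : ℝ := ∑' l : ℤ, f (x + l)

/-! ### Soft-thresholded wavelet reconstruction from `m = 2^J` samples -/

/-- The piecewise constant function with value `y i` on `[i/m, (i+1)/m)`, `m = 2^J`. -/
def stepFunction (J : ℕ) (y : Fin (2 ^ J) → ℝ) (t : ℝ) : ℝ :=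
  ∑ i : Fin (2 ^ J),
    (Ico ((i.val : ℝ) / 2 ^ J) (((i.val : ℝ) + 1) / 2 ^ J)).indicator (fun _ => y i) t

/-- The soft-thresholding map `y ↦ sign(y) max(|y| - t, 0)`. -/
def softThreshold (t y : ℝ) : ℝ := Real.sign y * max (|y| - t) 0

/-- The threshold `√(2 (σ²/m) log m)`, `m = 2^J`, where `σ²/m` is the noise level of the empirical
coefficients. -/
def threshold (σ : ℝ) (J : ℕ) : ℝ :=
  Real.sqrt (2 * (σ ^ 2 / 2 ^ J) * Real.log (2 ^ J))

/-- The empirical coefficient of the samples `y` with respect to `g`. -/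
def empiricalCoeff (J : ℕ) (y : Fin (2 ^ J) → ℝ) (g : ℝ → ℝ) : ℝ :=
  ∫ t in (0 : ℝ)..1, stepFunction J y t * g t

/-- The wavelet reconstruction at scale `J` from the `m = 2^J` samples `y`: the `m` empirical
coefficients with respect to the (periodized) scaling function and wavelets `ψ_{j,k}`,
`0 ≤ j < J`, `0 ≤ k < 2^j`, are soft-thresholded. -/
def waveletReconstruction (φ ψ : ℝ → ℝ) (σ : ℝ) (J : ℕ) (y : Fin (2 ^ J) → ℝ) (t : ℝ) : ℝ :=
  softThreshold (threshold σ J) (empiricalCoeff J y (periodize φ)) * periodize φ t +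
  ∑ j ∈ Finset.range J, ∑ k ∈ Finset.range (2 ^ j),
    softThreshold (threshold σ J) (empiricalCoeff J y (periodize (dilate ψ j k))) *
      periodize (dilate ψ j k) t

/-- The law of `m = 2^J` i.i.d. Gaussian variables with mean zero and variance `σ²`. -/
def noiseLaw (σ : ℝ≥0) (J : ℕ) : Measure (Fin (2 ^ J) → ℝ) :=
  Measure.pi fun _ => gaussianReal 0 (σ ^ 2)

/-- The information loss `|C_β(B) - C_{β̂}(B)|` as a function of the noise `z`, where `β̂` is
reconstructed from the noisy samples `β(x_i) + z_i` taken at the points `x_i`. -/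
def infoLoss {𝒴 : Type*} [MeasurableSpace 𝒴] (W : Kernel unitInterval 𝒴) (cmax : ℝ)
    (φ ψ : ℝ → ℝ) (σ : ℝ≥0) (β : ℝ → ℝ) (J : ℕ) (x : Fin (2 ^ J) → ℝ) (B : ℝ)
    (z : Fin (2 ^ J) → ℝ) : ℝ :=
  |capacityEnergyReal W cmax β B -
    capacityEnergyReal W cmax (waveletReconstruction φ ψ σ J fun i => β (x i) + z i) B|

/-- The expected information loss from `m = 2^J` noisy samples taken at the points `x_i`. -/
def expectedInfoLoss {𝒴 : Type*} [MeasurableSpace 𝒴] (W : Kernel unitInterval 𝒴) (cmax : ℝ)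
    (φ ψ : ℝ → ℝ) (σ : ℝ≥0) (β : ℝ → ℝ) (J : ℕ) (x : Fin (2 ^ J) → ℝ) (B : ℝ) : ℝ :=
  ∫ z, infoLoss W cmax φ ψ σ β J x B z ∂(noiseLaw σ J)

end

end SIET

/-! The argument has an analytic half and a statistical half, joined by a Markov-type estimate.

Analytic half. Admissible densities are bounded by `cmax`, so an `L¹[0,1]` error of the harvesting
function shifts every deliverable energy by at most `cmax` times that error. A uniform energy error
`ε` sandwiches the perturbed capacity between `C_β(B + ε)` and `C_β(B - ε)`, and the Hölder
condition gives a loss of order `ε^α` (`exists_forall_abs_capacityEnergyReal_sub_le`). At `B = 0`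
the Hölder condition says nothing. There the lower bound uses that mixing a small weight `t` of an
input with positive energy into `p` keeps at least the fraction `1 - t` of the mutual information
(`smul_klDiv_le_of_smul_le`).

Statistical half. The noiseless step function has bounded variation on the circle, so its wavelet
coefficients at level `j` have `ℓ¹` norm `O(2^{-j/2})` (`sum_abs_coeff_le`), while each periodized
wavelet has `L¹` norm `O(2^{-j/2})`. With `λ` the threshold, the risk of one thresholded coefficient
`θ` is at most `5λ` and at most `2|θ| + 2λ/m` (`risk_softThreshold`). Level `j` therefore
contributes `O(λ 2^{j/2})` by the first bound and `O(2^{-j})`, up to a small remainder, by the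
second. Since `λ` is about `m^{-1/2} (log m)^{1/2}`, the two balance at `j = J/3`, and the expected
`L¹` error is `O(δ)` with `δ = m^{-1/3} (log m)^{1/2}` (`exists_error_majorant`). Discretization and
the levels from `J` on cost only `O(1/m)`.

Joining them. If the energy error is at most `ε` the loss is `O(ε^α)`. Otherwise it is at most the
unconstrained capacity, and this event has probability `O(δ/ε)`. The choice `ε = δ^{1/(α+1)}`
equates the two and gives `δ^{α/(α+1)}`.

Integrability needs measurability of the loss in the noise. On each sign pattern of the thresholded
coefficients the sublevel sets of the capacity are traces of convex sets, which are Lebesgue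
null-measurable, and the noise law is absolutely continuous. -/

namespace SIET

open InformationTheory

/-! ### Mutual information along a component of a mixture. -/

section MutualInformation

variable {𝒳 𝒴 : Type*} [MeasurableSpace 𝒳] [MeasurableSpace 𝒴]

/-- Replacing the output law by any other law can only increase the divergence. -/
theorem klDiv_prod_comp_le [StandardBorelSpace 𝒳] [Nonempty 𝒳] (W : Kernel 𝒳 𝒴) [IsMarkovKernel W]
    (P : Measure 𝒳) [IsProbabilityMeasure P] (Q : Measure 𝒴) [IsProbabilityMeasure Q] :
    klDiv (P ⊗ₘ W) (P.prod (W ∘ₘ P)) ≤ klDiv (P ⊗ₘ W) (P.prod Q) := by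
  -- Disintegrating over the output, with the posterior as kernel, lets the chain rule split off the
  -- divergence of the output law from `Q`, which is nonnegative and can be dropped.
  have h1 : P ⊗ₘ W = ((W ∘ₘ P) ⊗ₘ (W†P)).map Prod.swap := by
    rw [compProd_posterior_eq_map_swap, Measure.map_map measurable_swap measurable_swap]
    simp
  have h2 : ∀ Q : Measure 𝒴, [IsProbabilityMeasure Q] →
      P.prod Q = (Q ⊗ₘ Kernel.const 𝒴 P).map Prod.swap := by
    intro Q _
    rw [Measure.compProd_const, Measure.prod_swap]
  calc klDiv (P ⊗ₘ W) (P.prod (W ∘ₘ P))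
      = klDiv (((W ∘ₘ P) ⊗ₘ (W†P)).map Prod.swap)
          (((W ∘ₘ P) ⊗ₘ Kernel.const 𝒴 P).map Prod.swap) := by rw [← h1, ← h2]
    _ ≤ klDiv ((W ∘ₘ P) ⊗ₘ (W†P)) ((W ∘ₘ P) ⊗ₘ Kernel.const 𝒴 P) :=
        klDiv_map_le _ _ measurable_swap
    _ ≤ klDiv ((W ∘ₘ P) ⊗ₘ (W†P)) (Q ⊗ₘ Kernel.const 𝒴 P) := by
        rw [klDiv_compProd_eq_add (W ∘ₘ P) Q]
        exact le_add_self
    _ = klDiv ((P ⊗ₘ W).map Prod.swap) ((P.prod Q).map Prod.swap) := by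
        rw [compProd_posterior_eq_map_swap, Measure.compProd_const, Measure.prod_swap]
    _ ≤ _ := klDiv_map_le _ _ measurable_swap

theorem compProd_withDensity_left (W : Kernel 𝒳 𝒴) [IsMarkovKernel W] (R : Measure 𝒳)
    [IsFiniteMeasure R] {g : 𝒳 → ℝ≥0∞} (hg : Measurable g) [SFinite (R.withDensity g)] :
    (R.withDensity g) ⊗ₘ W = (R ⊗ₘ W).withDensity (fun z => g z.1) := by
  ext s hs
  rw [Measure.compProd_apply hs, withDensity_apply _ hs, ← lintegral_indicator hs,
    Measure.lintegral_compProd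
      ((show Measurable fun z : 𝒳 × 𝒴 => g z.1 from hg.comp measurable_fst).indicator hs),
    lintegral_withDensity_eq_lintegral_mul _ hg (Kernel.measurable_kernel_prodMk_left hs)]
  refine lintegral_congr fun x => ?_
  have : ∀ y, s.indicator (fun z : 𝒳 × 𝒴 => g z.1) (x, y)
      = (Prod.mk x ⁻¹' s).indicator (fun _ => g x) y := fun y => by
      by_cases h : (x, y) ∈ s <;> simp [h]
  simp only [Pi.mul_apply]
  rw [lintegral_congr this, lintegral_indicator_const (measurable_prodMk_left hs)]

/-- The mutual information is bounded below along a component of a mixture. -/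
theorem smul_klDiv_le_of_smul_le [StandardBorelSpace 𝒳] [Nonempty 𝒳]
    (W : Kernel 𝒳 𝒴) [IsMarkovKernel W]
    (P R : Measure 𝒳) [IsProbabilityMeasure P] [IsProbabilityMeasure R] {a : ℝ≥0∞} (ha : a ≠ 0)
    (hPR : a • P ≤ R) :
    a * klDiv (P ⊗ₘ W) (P.prod (W ∘ₘ P)) ≤ klDiv (R ⊗ₘ W) (R.prod (W ∘ₘ R)) := by
  by_cases hac : R ⊗ₘ W ≪ R.prod (W ∘ₘ R)
  swap
  · rw [klDiv_of_not_ac hac]; exact le_top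
  set Q := W ∘ₘ R
  set f := (R ⊗ₘ W).rnDeriv (R.prod Q) with hf
  have hfm : Measurable f := Measure.measurable_rnDeriv _ _
  have hP : P ≪ R :=
    (Measure.absolutelyContinuous_smul ha).trans (Measure.absolutelyContinuous_of_le hPR)
  set g := P.rnDeriv R
  have hgm : Measurable g := Measure.measurable_rnDeriv _ _
  have hPg : R.withDensity g = P := Measure.withDensity_rnDeriv_eq P R hP
  -- Passing from `R` to `P` multiplies both the joint law and the product law by the same function
  -- `g` of the input, so the density `f` does not change.
  have hdens : P ⊗ₘ W = (P.prod Q).withDensity f := by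
    have e1 : P ⊗ₘ W = (R ⊗ₘ W).withDensity (fun z => g z.1) := by
      conv_lhs => rw [← hPg]
      have : IsProbabilityMeasure (R.withDensity g) := by rw [hPg]; infer_instance
      exact compProd_withDensity_left W R hgm
    have e2 : P.prod Q = (R.prod Q).withDensity (fun z => g z.1) := by
      conv_lhs => rw [← hPg]
      exact prod_withDensity_left hgm
    have hg1 : Measurable fun z : 𝒳 × 𝒴 => g z.1 := hgm.comp measurable_fst
    rw [e1, e2, ← Measure.withDensity_rnDeriv_eq _ _ hac, ← withDensity_mul _ hfm hg1,
      ← withDensity_mul _ hg1 hfm, mul_comm]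
  have hac' : P ⊗ₘ W ≪ P.prod Q := by
    rw [hdens]; exact withDensity_absolutelyContinuous _ _
  have hderiv : (P ⊗ₘ W).rnDeriv (P.prod Q) =ᵐ[P.prod Q] f := by
    rw [hdens]; exact Measure.rnDeriv_withDensity _ hfm
  have hle : a • P.prod Q ≤ R.prod Q := by
    rw [← Measure.prod_smul_left]
    exact Measure.prod_mono hPR le_rfl
  -- With the output law `Q` of `R` as reference, both divergences integrate the same nonnegative
  -- function `klFun ∘ f`, so the domination `a • P ≤ R` is enough.
  calc a * klDiv (P ⊗ₘ W) (P.prod (W ∘ₘ P)) ≤ a * klDiv (P ⊗ₘ W) (P.prod Q) := by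
        gcongr; exact klDiv_prod_comp_le W P Q
    _ = a * ∫⁻ z, ENNReal.ofReal (klFun (f z).toReal) ∂(P.prod Q) := by
        rw [klDiv_eq_lintegral_klFun_of_ac hac']
        congr 1
        refine lintegral_congr_ae ?_
        filter_upwards [hderiv] with z hz
        rw [hz]
    _ = ∫⁻ z, ENNReal.ofReal (klFun (f z).toReal) ∂(a • P.prod Q) := by
        rw [lintegral_smul_measure, smul_eq_mul]
    _ ≤ ∫⁻ z, ENNReal.ofReal (klFun (f z).toReal) ∂(R.prod Q) := lintegral_mono' hle le_rfl
    _ = klDiv (R ⊗ₘ W) (R.prod Q) := (klDiv_eq_lintegral_klFun_of_ac hac).symm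

end MutualInformation

end SIET

namespace SIET

/-! ### Admissible inputs: convexity and energies. -/

section Admissible

variable {cmax : ℝ} {p q β : ℝ → ℝ}

theorem PiecewiseContinuous.aestronglyMeasurable (hp : PiecewiseContinuous p) :
    AEStronglyMeasurable p (volume.restrict (Icc 0 1)) := by
  obtain ⟨S, hS⟩ := hp.1
  have h := hS.aestronglyMeasurable (μ := volume)
    (measurableSet_Icc.diff S.finite_toSet.measurableSet)
  rwa [Measure.restrict_congr_set (sdiff_null_ae_eq_self (S.finite_toSet.measure_zero _))] at h

theorem Admissible.integrable_mul (hp : Admissible cmax p) (hβ : IntegrableOn β (Icc 0 1)) :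
    IntegrableOn (fun x => p x * β x) (Icc 0 1) := by
  refine Integrable.bdd_mul (c := cmax) hβ hp.piecewiseContinuous.aestronglyMeasurable ?_
  refine (ae_restrict_iff' measurableSet_Icc).2 (Eventually.of_forall fun x hx => ?_)
  rw [Real.norm_eq_abs, abs_of_nonneg (hp.nonneg x hx)]
  exact hp.le_cmax x hx

theorem Admissible.integrable (hp : Admissible cmax p) : IntegrableOn p (Icc 0 1) := by
  simpa using hp.integrable_mul (β := fun _ => 1) (by simp)

theorem energy_eq (β p : ℝ → ℝ) : energy β p = ∫ x in Icc 0 1, p x * β x := by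
  rw [energy, intervalIntegral.integral_of_le zero_le_one, integral_Icc_eq_integral_Ioc]

theorem Admissible.isProbabilityMeasure (hp : Admissible cmax p) :
    IsProbabilityMeasure (inputLaw p) := by
  refine ⟨?_⟩
  have h := hp.integral_eq_one
  rw [intervalIntegral.integral_of_le zero_le_one, ← integral_Icc_eq_integral_Ioc] at h
  rw [inputLaw, withDensity_apply _ MeasurableSet.univ, Measure.restrict_univ]
  have h2 := lintegral_subtype_comap (μ := (volume : Measure ℝ)) (measurableSet_Icc (a := (0:ℝ)) (b := 1))
    (fun x => ENNReal.ofReal (p x))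
  rw [show (volume : Measure unitInterval) = Measure.comap Subtype.val volume from rfl]
  refine h2.trans ?_
  rw [← ofReal_integral_eq_lintegral_ofReal hp.integrable
    ((ae_restrict_iff' measurableSet_Icc).2 (Eventually.of_forall hp.nonneg)), h,
    ENNReal.ofReal_one]

theorem Admissible.mix (hp : Admissible cmax p) (hq : Admissible cmax q) {t : ℝ} (ht0 : 0 ≤ t)
    (ht1 : t ≤ 1) : Admissible cmax (fun x => (1 - t) * p x + t * q x) := by
  have ht : 0 ≤ 1 - t := by linarith
  refine ⟨⟨?_, ?_, ?_⟩, ?_, ?_, ?_⟩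
  · obtain ⟨S, hS⟩ := hp.1.1
    obtain ⟨T, hT⟩ := hq.1.1
    refine ⟨S ∪ T, ?_⟩
    have h1 : ContinuousOn p (Icc 0 1 \ ((S ∪ T : Finset ℝ) : Set ℝ)) :=
      hS.mono (sdiff_subset_sdiff_right (by simp))
    have h2 : ContinuousOn q (Icc 0 1 \ ((S ∪ T : Finset ℝ) : Set ℝ)) :=
      hT.mono (sdiff_subset_sdiff_right (by simp))
    exact (continuousOn_const.mul h1).add (continuousOn_const.mul h2)
  · intro x hx
    obtain ⟨l, hl⟩ := hp.1.2.1 x hx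
    obtain ⟨l', hl'⟩ := hq.1.2.1 x hx
    exact ⟨_, (hl.const_mul _).add (hl'.const_mul _)⟩
  · intro x hx
    obtain ⟨l, hl⟩ := hp.1.2.2 x hx
    obtain ⟨l', hl'⟩ := hq.1.2.2 x hx
    exact ⟨_, (hl.const_mul _).add (hl'.const_mul _)⟩
  · intro x hx
    exact add_nonneg (mul_nonneg ht (hp.nonneg x hx)) (mul_nonneg ht0 (hq.nonneg x hx))
  · intro x hx
    nlinarith [hp.le_cmax x hx, hq.le_cmax x hx]
  · have h1 := hp.integral_eq_one
    have h2 := hq.integral_eq_one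
    have i1 : IntervalIntegrable p volume 0 1 :=
      (intervalIntegrable_iff_integrableOn_Icc_of_le zero_le_one).2 hp.integrable
    have i2 : IntervalIntegrable q volume 0 1 :=
      (intervalIntegrable_iff_integrableOn_Icc_of_le zero_le_one).2 hq.integrable
    rw [intervalIntegral.integral_add (i1.const_mul _) (i2.const_mul _),
      intervalIntegral.integral_const_mul, intervalIntegral.integral_const_mul, h1, h2]
    ring

theorem Admissible.energy_mix (hp : Admissible cmax p) (hq : Admissible cmax q)
    (hβ : IntegrableOn β (Icc 0 1)) (t : ℝ) :
    energy β (fun x => (1 - t) * p x + t * q x) = (1 - t) * energy β p + t * energy β q := by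
  simp only [energy_eq]
  rw [← integral_const_mul, ← integral_const_mul, ← integral_add
    ((hp.integrable_mul hβ).const_mul _) ((hq.integrable_mul hβ).const_mul _)]
  congr 1
  ext x
  ring

theorem Admissible.energy_nonneg (hp : Admissible cmax p) (hβ0 : ∀ t ∈ Icc (0 : ℝ) 1, 0 ≤ β t) :
    0 ≤ energy β p := by
  rw [energy_eq]
  exact setIntegral_nonneg measurableSet_Icc fun x hx => mul_nonneg (hp.nonneg x hx) (hβ0 x hx)

/-- The bound is uniform in `p`; this is where the cap `cmax` on the densities turns an `L¹` error
into an energy error. -/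
theorem Admissible.abs_energy_sub_le {β' : ℝ → ℝ} (hp : Admissible cmax p)
    (hβ : IntegrableOn β (Icc 0 1)) (hβ' : IntegrableOn β' (Icc 0 1)) :
    |energy β p - energy β' p| ≤ cmax * ∫ x in Icc 0 1, |β x - β' x| := by
  rw [energy_eq, energy_eq, ← integral_sub (hp.integrable_mul hβ) (hp.integrable_mul hβ'),
    ← integral_const_mul]
  refine (abs_integral_le_integral_abs).trans ?_
  refine setIntegral_mono_on ((hp.integrable_mul hβ).sub (hp.integrable_mul hβ')).abs
    ((hβ.sub hβ').abs.const_mul _) measurableSet_Icc fun x hx => ?_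
  rw [← mul_sub, abs_mul, abs_of_nonneg (hp.nonneg x hx)]
  exact mul_le_mul_of_nonneg_right (hp.le_cmax x hx) (abs_nonneg _)

theorem smul_inputLaw_le {t : ℝ} (ht : 0 ≤ t) (ht1 : t ≤ 1) (hq : Admissible cmax q) :
    ENNReal.ofReal (1 - t) • inputLaw p ≤ inputLaw (fun x => (1 - t) * p x + t * q x) := by
  rw [inputLaw, inputLaw, ← withDensity_smul' _ _ ENNReal.ofReal_ne_top]
  refine withDensity_mono (Eventually.of_forall fun x => ?_)
  simp only [Pi.smul_apply, smul_eq_mul]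
  rw [← ENNReal.ofReal_mul (by linarith)]
  exact ENNReal.ofReal_le_ofReal (le_add_of_nonneg_right (mul_nonneg ht (hq.nonneg x x.2)))

theorem Admissible.mul_mutualInfo_le {𝒴 : Type*} [MeasurableSpace 𝒴] (W : Kernel unitInterval 𝒴)
    [IsMarkovKernel W] (hp : Admissible cmax p) (hq : Admissible cmax q) {t : ℝ} (ht : 0 ≤ t)
    (ht1 : t < 1) :
    ENNReal.ofReal (1 - t) * mutualInfo W p ≤
      mutualInfo W (fun x => (1 - t) * p x + t * q x) := by
  have := hp.isProbabilityMeasure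
  have := (hp.mix hq ht ht1.le).isProbabilityMeasure
  exact smul_klDiv_le_of_smul_le W _ _ (by simpa using ht1) (smul_inputLaw_le ht ht1.le hq)

end Admissible

/-! ### Stability of the capacity-energy function under energy errors. -/

section Capacity

variable {𝒴 : Type*} [MeasurableSpace 𝒴] {W : Kernel unitInterval 𝒴} {cmax : ℝ}
  {β β' : ℝ → ℝ}

theorem capacityEnergy_le_maxCapacity (β : ℝ → ℝ) (B : ℝ) :
    capacityEnergy W cmax β B ≤ maxCapacity W cmax :=
  iSup₂_le fun p hp => iSup_le fun _ => le_iSup₂_of_le p hp le_rfl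

theorem capacityEnergy_ne_top (h : maxCapacity W cmax ≠ ⊤) (β : ℝ → ℝ) (B : ℝ) :
    capacityEnergy W cmax β B ≠ ⊤ :=
  ne_top_of_le_ne_top h (capacityEnergy_le_maxCapacity β B)

theorem capacityEnergyReal_le_maxCapacity (h : maxCapacity W cmax ≠ ⊤) (β : ℝ → ℝ) (B : ℝ) :
    capacityEnergyReal W cmax β B ≤ (maxCapacity W cmax).toReal :=
  ENNReal.toReal_mono h (capacityEnergy_le_maxCapacity β B)

theorem abs_capacityEnergyReal_sub_le (h : maxCapacity W cmax ≠ ⊤) (β β' : ℝ → ℝ) (B : ℝ) :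
    |capacityEnergyReal W cmax β B - capacityEnergyReal W cmax β' B| ≤
      (maxCapacity W cmax).toReal := by
  have h1 := capacityEnergyReal_le_maxCapacity h β B
  have h2 := capacityEnergyReal_le_maxCapacity h β' B
  have h3 : 0 ≤ capacityEnergyReal W cmax β B := ENNReal.toReal_nonneg
  have h4 : 0 ≤ capacityEnergyReal W cmax β' B := ENNReal.toReal_nonneg
  exact abs_le.2 ⟨by linarith, by linarith⟩

theorem capacityEnergyReal_le_of_energy_le (h : maxCapacity W cmax ≠ ⊤) {B B' : ℝ}
    (hE : ∀ p, Admissible cmax p → B ≤ energy β p → B' ≤ energy β' p) :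
    capacityEnergyReal W cmax β B ≤ capacityEnergyReal W cmax β' B' :=
  ENNReal.toReal_mono (capacityEnergy_ne_top h β' B') <|
    iSup₂_le fun p hp => iSup_le fun hB =>
      le_iSup₂_of_le p hp (le_iSup_of_le (hE p hp hB) le_rfl)

/-- The capacity-energy function of a nonnegative harvesting function is lower semicontinuous from
the right at `0`, since a small admixture of an input with positive energy costs little
information. -/
theorem exists_forall_lt_capacityEnergyReal [IsMarkovKernel W] (h : maxCapacity W cmax ≠ ⊤)
    (hβ : IntegrableOn β (Icc 0 1)) (hβ0 : ∀ t ∈ Icc (0 : ℝ) 1, 0 ≤ β t)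
    (hpos : 0 < maxEnergy cmax β) {η : ℝ} (hη : 0 < η) :
    ∃ s₀ > 0, ∀ s ≤ s₀, capacityEnergyReal W cmax β 0 - η ≤ capacityEnergyReal W cmax β s := by
  obtain ⟨q, hq, hqE⟩ : ∃ q, Admissible cmax q ∧ 0 < energy β q := by
    by_contra! hcon
    refine hpos.not_ge (Real.sSup_nonpos ?_)
    rintro e ⟨p, hp, rfl⟩
    exact hcon p hp
  by_cases hC : capacityEnergyReal W cmax β 0 - η ≤ 0
  · exact ⟨1, one_pos, fun s _ => hC.trans ENNReal.toReal_nonneg⟩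
  push Not at hC
  set C := capacityEnergyReal W cmax β 0 with hCdef
  obtain ⟨p, hp, hpI⟩ : ∃ p, Admissible cmax p ∧ ENNReal.ofReal (C - η / 2) < mutualInfo W p := by
    by_contra! hcon
    have : capacityEnergy W cmax β 0 ≤ ENNReal.ofReal (C - η / 2) :=
      iSup₂_le fun p hp => iSup_le fun _ => hcon p hp
    have h2 := ENNReal.toReal_mono ENNReal.ofReal_ne_top this
    rw [ENNReal.toReal_ofReal (by linarith)] at h2
    change C ≤ _ at h2
    linarith
  have hCpos : 0 < C := by linarith
  -- The weight of the admixture is such that `(1 - t) * (C - η / 2) ≥ C - η`.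
  set t := min (1 / 2) (η / (2 * C)) with ht
  have ht0 : 0 < t := by positivity
  have ht1 : t < 1 := (min_le_left _ _).trans_lt (by norm_num)
  have htC : t * C ≤ η / 2 := by
    have : t ≤ η / (2 * C) := min_le_right _ _
    calc t * C ≤ η / (2 * C) * C := by gcongr
      _ = η / 2 := by field_simp
  refine ⟨t * energy β q, by positivity, fun s hs => ?_⟩
  have hmix := hp.mix hq ht0.le ht1.le
  have hE : s ≤ energy β (fun x => (1 - t) * p x + t * q x) := by
    rw [hp.energy_mix hq hβ]
    have := hp.energy_nonneg hβ0
    nlinarith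
  have key : ENNReal.ofReal ((1 - t) * (C - η / 2)) ≤ capacityEnergy W cmax β s := by
    calc ENNReal.ofReal ((1 - t) * (C - η / 2))
        = ENNReal.ofReal (1 - t) * ENNReal.ofReal (C - η / 2) :=
          ENNReal.ofReal_mul (by linarith)
      _ ≤ ENNReal.ofReal (1 - t) * mutualInfo W p := by gcongr
      _ ≤ mutualInfo W (fun x => (1 - t) * p x + t * q x) := hp.mul_mutualInfo_le W hq ht0.le ht1
      _ ≤ _ := le_iSup₂_of_le _ hmix (le_iSup (fun _ => mutualInfo W _) hE)
  have := ENNReal.toReal_mono (capacityEnergy_ne_top h β s) key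
  rw [ENNReal.toReal_ofReal (mul_nonneg (by linarith) (by linarith))] at this
  change _ ≤ capacityEnergyReal W cmax β s at this
  nlinarith

/-- A small error of the delivered energies costs at most the modulus of continuity of the
capacity-energy function. -/
theorem exists_forall_abs_capacityEnergyReal_sub_le [IsMarkovKernel W]
    (h : maxCapacity W cmax ≠ ⊤)
    (hβ : IntegrableOn β (Icc 0 1)) (hβ0 : ∀ t ∈ Icc (0 : ℝ) 1, 0 ≤ β t) {α c : ℝ}
    (hHolder : ∀ B₁ ∈ Ioo 0 (maxEnergy cmax β), ∀ B₂ ∈ Ioo 0 (maxEnergy cmax β),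
      |capacityEnergyReal W cmax β B₁ - capacityEnergyReal W cmax β B₂| ≤ c * |B₁ - B₂| ^ α)
    (hα : 0 < α) {B : ℝ} (hB : B ∈ Ico 0 (maxEnergy cmax β)) :
    ∃ ε₀ > 0, ∀ ε, 0 < ε → ε < ε₀ → ∀ β' : ℝ → ℝ,
      (∀ p, Admissible cmax p → |energy β p - energy β' p| ≤ ε) →
        |capacityEnergyReal W cmax β B - capacityEnergyReal W cmax β' B| ≤ c * ε ^ α := by
  have hpos : 0 < maxEnergy cmax β := hB.1.trans_lt hB.2
  have anti : ∀ {s t : ℝ}, s ≤ t → capacityEnergyReal W cmax β t ≤ capacityEnergyReal W cmax β s :=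
    fun hst => capacityEnergyReal_le_of_energy_le h fun p _ hE => hst.trans hE
  have upper : ∀ ε, ∀ β' : ℝ → ℝ, (∀ p, Admissible cmax p → |energy β p - energy β' p| ≤ ε) →
      capacityEnergyReal W cmax β' B ≤ capacityEnergyReal W cmax β (B - ε) := fun ε β' hE =>
    capacityEnergyReal_le_of_energy_le h fun p hp hpE => by linarith [(abs_le.1 (hE p hp)).1]
  have lower : ∀ ε, ∀ β' : ℝ → ℝ, (∀ p, Admissible cmax p → |energy β p - energy β' p| ≤ ε) →
      capacityEnergyReal W cmax β (B + ε) ≤ capacityEnergyReal W cmax β' B := fun ε β' hE =>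
    capacityEnergyReal_le_of_energy_le h fun p hp hpE => by linarith [(abs_le.1 (hE p hp)).2]
  -- `B = 0` lies outside the open interval of the Hölder condition and `B - ε` would be negative,
  -- so it is treated apart.
  rcases hB.1.eq_or_lt with h0 | h0
  · subst h0
    refine ⟨maxEnergy cmax β, hpos, fun ε hε hεB β' hE => ?_⟩
    have hlow := lower ε β' hE
    -- Every admissible input has nonnegative `β`-energy, so at `B = 0` the constraint for `β` is
    -- void and its capacity is the largest possible.
    have hup : capacityEnergyReal W cmax β' 0 ≤ capacityEnergyReal W cmax β 0 :=
      capacityEnergyReal_le_of_energy_le h fun p hp _ => hp.energy_nonneg hβ0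
    rw [zero_add] at hlow
    have hc : 0 ≤ c := by
      have := hHolder ε ⟨hε, hεB⟩ (ε / 2) ⟨by positivity, by linarith⟩
      have h2 : 0 < |ε - ε / 2| ^ α := Real.rpow_pos_of_pos (abs_pos.2 (by linarith)) _
      exact nonneg_of_mul_nonneg_left ((abs_nonneg _).trans this) h2
    -- The Hölder bound is applied between a small `s > 0` and `ε`; right lower semicontinuity at
    -- `0` then replaces `s` by `0`.
    have hlim : capacityEnergyReal W cmax β 0 - capacityEnergyReal W cmax β ε ≤ c * ε ^ α := by
      refine le_of_forall_pos_le_add fun η hη => ?_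
      obtain ⟨s₀, hs₀, hs⟩ := exists_forall_lt_capacityEnergyReal (W := W) h hβ hβ0 hpos hη
      set s := min s₀ (ε / 2)
      have hs1 : 0 < s := by positivity
      have hs2 : s ≤ ε / 2 := min_le_right _ _
      have h1 := hs s (min_le_left _ _)
      have h2 := (le_abs_self _).trans
        (hHolder s ⟨hs1, by linarith⟩ ε ⟨hε, hεB⟩)
      have h3 : |s - ε| ^ α ≤ ε ^ α := by
        refine Real.rpow_le_rpow (abs_nonneg _) ?_ hα.le
        rw [abs_le]; constructor <;> linarith
      have h4 := mul_le_mul_of_nonneg_left h3 hc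
      linarith
    rw [abs_of_nonneg (by linarith)]
    linarith
  · refine ⟨min B (maxEnergy cmax β - B), lt_min h0 (by linarith [hB.2]),
      fun ε hε hεB β' hE => ?_⟩
    have hε1 : ε < B := hεB.trans_le (min_le_left _ _)
    have hε2 : ε < maxEnergy cmax β - B := hεB.trans_le (min_le_right _ _)
    have hlow := lower ε β' hE
    have hup := upper ε β' hE
    have hm : B ∈ Ioo 0 (maxEnergy cmax β) := ⟨h0, hB.2⟩
    have h1 := (le_abs_self _).trans (hHolder B hm (B + ε) ⟨by linarith, by linarith⟩)
    have h2 := (le_abs_self _).trans (hHolder (B - ε) ⟨by linarith, by linarith⟩ B hm)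
    rw [show |B - (B + ε)| = ε by rw [sub_add_cancel_left, abs_neg, abs_of_pos hε]] at h1
    rw [show |B - ε - B| = ε by rw [sub_sub_cancel_left, abs_neg, abs_of_pos hε]] at h2
    rw [abs_le]; constructor <;> linarith

end Capacity

end SIET

/-! ### Wavelet expansions on the line and orthogonal projections. -/

namespace SIET

open scoped InnerProductSpace

/-- The coefficient of `h` with respect to `x ↦ 2^{j/2} u(2^j x - k)` on the line. -/
noncomputable def lineCoeff (u h : ℝ → ℝ) (j k : ℤ) : ℝ := ∫ x, h x * dilate u j k x

/-- The part of the expansion of `h` on the line at resolution `j`. -/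
noncomputable def levelSum (u h : ℝ → ℝ) (j : ℤ) (x : ℝ) : ℝ :=
  ∑' k : ℤ, lineCoeff u h j k * dilate u j k x

section Dilate

variable {u : ℝ → ℝ} {A : ℝ}

theorem two_rpow_half_mul_self (j : ℤ) :
    (2 : ℝ) ^ ((j : ℝ) / 2) * (2 : ℝ) ^ ((j : ℝ) / 2) = (2 : ℝ) ^ j := by
  rw [← Real.rpow_add two_pos, add_halves, Real.rpow_intCast]

theorem integral_eq_of_eq_const_mul_comp {F : ℝ → ℝ} (g : ℝ → ℝ) {C : ℝ} {j : ℤ}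
    (h : ∀ x, F x = C * g ((2 : ℝ) ^ j * x)) :
    ∫ x, F x = C * ((2 : ℝ) ^ j)⁻¹ * ∫ x, g x := by
  simp_rw [h]
  rw [integral_const_mul, Measure.integral_comp_mul_left, smul_eq_mul, ← mul_assoc,
    abs_of_pos (by positivity)]

theorem dilate_eq_zero (hA : ∀ x, A < |x| → u x = 0) {j k : ℤ} {x : ℝ}
    (h : A < |(2 : ℝ) ^ j * x - k|) : dilate u j k x = 0 := by
  rw [dilate, hA _ h, mul_zero]

theorem abs_le_of_dilate_ne_zero (hA : ∀ x, A < |x| → u x = 0) {j k : ℤ} {x : ℝ}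
    (h : dilate u j k x ≠ 0) : |(2 : ℝ) ^ j * x - k| ≤ A := by
  by_contra! hlt
  exact h (dilate_eq_zero hA hlt)

theorem dilate_add_level (u : ℝ → ℝ) (j i k : ℤ) (x : ℝ) :
    dilate u (j + i) k x = (2 : ℝ) ^ ((j : ℝ) / 2) * dilate u i k ((2 : ℝ) ^ j * x) := by
  rw [dilate, dilate, ← mul_assoc, ← Real.rpow_add two_pos, zpow_add₀ two_ne_zero]
  push_cast
  ring_nf

theorem memLp_comp_affine {p : ℝ≥0∞} (hu : MemLp u p volume) {a : ℝ} (ha : a ≠ 0) (b : ℝ) :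
    MemLp (fun x => u (a * x - b)) p volume := by
  have h1 : MemLp (fun x => u (x - b)) p volume :=
    hu.comp_measurePreserving (measurePreserving_sub_right volume b)
  have h2 : MemLp (fun x => u (x - b)) p (volume.map (a * ·)) := by
    rw [Real.map_volume_mul_left ha]
    exact h1.smul_measure ENNReal.ofReal_ne_top
  exact h2.comp_of_map (measurable_const_mul a).aemeasurable

theorem memLp_dilate {p : ℝ≥0∞} (hu : MemLp u p volume) (j k : ℤ) :
    MemLp (dilate u j k) p volume :=
  (memLp_comp_affine hu (zpow_ne_zero j two_ne_zero) k).const_mul _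

theorem integral_dilate_mul_dilate_add (u : ℝ → ℝ) (j k l : ℤ) :
    ∫ x, dilate u j k x * dilate u j l x = ∫ x, u (x - k) * u (x - l) := by
  rw [integral_eq_of_eq_const_mul_comp (fun y => u (y - k) * u (y - l)) (C := (2 : ℝ) ^ j) (j := j)]
  · rw [mul_inv_cancel₀ (by positivity), one_mul]
  · intro x
    simp only [dilate]
    linear_combination u ((2 : ℝ) ^ j * x - k) * u ((2 : ℝ) ^ j * x - l) * two_rpow_half_mul_self j

theorem integral_abs_dilate (u : ℝ → ℝ) (j k : ℤ) :
    ∫ x, |dilate u j k x| = (2 : ℝ) ^ (-((j : ℝ) / 2)) * ∫ x, |u x| := by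
  have h : ∀ x, |dilate u j k x| =
      (2 : ℝ) ^ ((j : ℝ) / 2) * (fun y => |u (y - k)|) ((2 : ℝ) ^ j * x) := by
    intro x
    rw [dilate, abs_mul, abs_of_pos (by positivity)]
  rw [integral_eq_of_eq_const_mul_comp (fun y => |u (y - k)|) h,
    integral_sub_right_eq_self (fun y => |u y|)]
  congr 1
  rw [← two_rpow_half_mul_self, Real.rpow_neg two_pos.le]
  field_simp

theorem integral_dilate (u : ℝ → ℝ) (hu : ∫ x, u x = 0) (j k : ℤ) :
    ∫ x, dilate u j k x = 0 := by
  have h : ∀ x, dilate u j k x =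
      (2 : ℝ) ^ ((j : ℝ) / 2) * (fun y => u (y - k)) ((2 : ℝ) ^ j * x) := fun x => rfl
  rw [integral_eq_of_eq_const_mul_comp (fun y => u (y - k)) h, integral_sub_right_eq_self, hu, mul_zero]

end Dilate

section LevelSum

variable {u h : ℝ → ℝ} {A R : ℝ}

theorem lineCoeff_eq_zero (hA : ∀ x, A < |x| → u x = 0) (hR : ∀ x, R < |x| → h x = 0) {j k : ℤ}
    (hk : (2 : ℝ) ^ j * R + A < |(k : ℝ)|) : lineCoeff u h j k = 0 := by
  rw [lineCoeff, ← integral_zero ℝ ℝ (μ := volume)]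
  congr 1
  ext x
  by_cases hx : R < |x|
  · rw [hR x hx, zero_mul]
  · rw [dilate_eq_zero hA, mul_zero]
    have h1 : |(2 : ℝ) ^ j * x| ≤ (2 : ℝ) ^ j * R := by
      rw [abs_mul, abs_of_pos (by positivity)]
      exact mul_le_mul_of_nonneg_left (not_lt.1 hx) (by positivity)
    have h2 := abs_sub_abs_le_abs_sub (k : ℝ) ((2 : ℝ) ^ j * x)
    rw [abs_sub_comm] at h2
    linarith

theorem exists_levelSum_eq_sum (hA : ∀ x, A < |x| → u x = 0) (hR : ∀ x, R < |x| → h x = 0)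
    (j : ℤ) : ∃ F : Finset ℤ, (∀ k ∉ F, lineCoeff u h j k = 0) ∧
      ∀ x, levelSum u h j x = ∑ k ∈ F, lineCoeff u h j k * dilate u j k x := by
  set N := ⌈(2 : ℝ) ^ j * R + A⌉
  have hF : ∀ k ∉ Finset.Icc (-N) N, lineCoeff u h j k = 0 := by
    intro k hk
    refine lineCoeff_eq_zero hA hR ((Int.le_ceil _).trans_lt ?_)
    rw [Finset.mem_Icc, not_and_or, not_le, not_le] at hk
    rw [← Int.cast_abs, Int.cast_lt, lt_abs]
    rcases hk with hk | hk
    · right; linarith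
    · left; exact hk
  exact ⟨_, hF, fun x => tsum_eq_sum fun k hk => by rw [hF k hk, zero_mul]⟩

/-- Dilation covariance. It carries identities between levels `0` and `1`, where `IsCompactWavelet`
relates `ψ` to `φ`, to all levels. -/
theorem levelSum_add_level (u h : ℝ → ℝ) (j i : ℤ) (x : ℝ) :
    levelSum u h (j + i) x = levelSum u (fun y => h ((2 : ℝ) ^ (-j) * y)) i ((2 : ℝ) ^ j * x) := by
  refine tsum_congr fun k => ?_
  have h1 : lineCoeff u h (j + i) k =
      (2 : ℝ) ^ ((j : ℝ) / 2) * ((2 : ℝ) ^ j)⁻¹ *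
        lineCoeff u (fun y => h ((2 : ℝ) ^ (-j) * y)) i k := by
    have h2 : ∀ y, h y * dilate u (j + i) k y = (2 : ℝ) ^ ((j : ℝ) / 2) *
        (fun w => h ((2 : ℝ) ^ (-j) * w) * dilate u i k w) ((2 : ℝ) ^ j * y) := by
      intro y
      have : (2 : ℝ) ^ (-j) * ((2 : ℝ) ^ j * y) = y := by
        rw [zpow_neg, inv_mul_cancel_left₀ (by positivity)]
      simp only [this, dilate_add_level]
      ring
    exact integral_eq_of_eq_const_mul_comp _ h2
  rw [h1, dilate_add_level, ← two_rpow_half_mul_self]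
  field_simp

end LevelSum

section Projection

variable {u h : ℝ → ℝ} {A R : ℝ}

instance hasOrthogonalProjection_scaleSpace (u : ℝ → ℝ) (j : ℤ) :
    (scaleSpace u j).HasOrthogonalProjection := by
  unfold scaleSpace
  infer_instance

theorem toLp_dilate_mem_scaleSpace (hu : MemLp u 2 volume) (j k : ℤ) :
    (memLp_dilate hu j k).toLp ∈ scaleSpace u j :=
  Submodule.le_topologicalClosure _ (Submodule.subset_span ⟨k, MemLp.coeFn_toLp _⟩)

theorem mem_scaleSpace_orthogonal_iff (hu : MemLp u 2 volume) (j : ℤ)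
    (g : Lp ℝ 2 (volume : Measure ℝ)) :
    g ∈ (scaleSpace u j)ᗮ ↔ ∀ k, ⟪(memLp_dilate hu j k).toLp, g⟫_ℝ = 0 := by
  constructor
  · intro hg k
    exact (Submodule.mem_orthogonal _ _).1 hg _ (toLp_dilate_mem_scaleSpace hu j k)
  · intro hg
    rw [scaleSpace, Submodule.orthogonal_closure, Submodule.mem_orthogonal]
    intro w hw
    induction hw using Submodule.span_induction with
    | mem w hw =>
      obtain ⟨k, hk⟩ := hw
      rw [← hg k]
      congr 1
      exact Lp.ext (hk.trans (MemLp.coeFn_toLp _).symm)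
    | zero => simp
    | add a b _ _ ha hb => rw [inner_add_left, ha, hb, add_zero]
    | smul c a _ ha => rw [inner_smul_left, ha, mul_zero]

theorem inner_toLp_toLp {f g : ℝ → ℝ} (hf : MemLp f 2 volume) (hg : MemLp g 2 volume) :
    ⟪hf.toLp, hg.toLp⟫_ℝ = ∫ x, g x * f x := by
  rw [L2.inner_def]
  refine integral_congr_ae ?_
  filter_upwards [hf.coeFn_toLp, hg.coeFn_toLp] with x h1 h2
  rw [h1, h2]
  rfl

/-- The orthogonal projection onto `V_j` of a compactly supported function. -/
theorem starProjection_scaleSpace (hu : MemLp u 2 volume) (hA : ∀ x, A < |x| → u x = 0)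
    (horth : ∀ k l : ℤ, ∫ x, u (x - k) * u (x - l) = if k = l then 1 else 0)
    (hh : MemLp h 2 volume) (hR : ∀ x, R < |x| → h x = 0) (j : ℤ) :
    ((scaleSpace u j).starProjection hh.toLp : ℝ → ℝ) =ᵐ[volume] levelSum u h j := by
  obtain ⟨F, hF, hsum⟩ := exists_levelSum_eq_sum hA hR j
  set e : ℤ → Lp ℝ 2 (volume : Measure ℝ) := fun k => (memLp_dilate hu j k).toLp
  set v := ∑ k ∈ F, lineCoeff u h j k • e k with hv
  have hvm : v ∈ scaleSpace u j :=
    Submodule.sum_mem _ fun k _ => Submodule.smul_mem _ _ (toLp_dilate_mem_scaleSpace hu j k)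
  have hproj : v = (scaleSpace u j).starProjection hh.toLp := by
    refine (Submodule.eq_starProjection_of_mem_orthogonal hvm ?_).symm
    rw [mem_scaleSpace_orthogonal_iff hu]
    intro k
    have hee : ∀ l, ⟪e k, e l⟫_ℝ = if l = k then 1 else 0 := fun l => by
      rw [inner_toLp_toLp, integral_dilate_mul_dilate_add, horth]
    change ⟪e k, hh.toLp - v⟫_ℝ = 0
    rw [inner_sub_right, inner_toLp_toLp, hv, inner_sum]
    simp_rw [inner_smul_right, hee]
    simp only [mul_ite, mul_one, mul_zero, Finset.sum_ite_eq']
    change lineCoeff u h j k - _ = 0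
    split_ifs with hk
    · exact sub_self _
    · rw [hF k hk, sub_zero]
  rw [← hproj, hv]
  have h1 : ∀ᵐ x, ∀ k ∈ F, (lineCoeff u h j k • e k : Lp ℝ 2 volume) x =
      lineCoeff u h j k * dilate u j k x := by
    refine (Finset.eventually_all F).2 fun k _ => ?_
    filter_upwards [Lp.coeFn_smul (lineCoeff u h j k) (e k),
      (memLp_dilate hu j k).coeFn_toLp] with x hx1 hx2
    rw [hx1, Pi.smul_apply, hx2, smul_eq_mul]
  have h2 := Lp.coeFn_finsetSum F fun k => lineCoeff u h j k • e k
  filter_upwards [h1, h2] with x hx1 hx2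
  rw [hx2, hsum, Finset.sum_apply]
  exact Finset.sum_congr rfl hx1

end Projection

/-! ### The two-scale decomposition and convergence of the projections. -/

section Multiresolution

variable {φ ψ h : ℝ → ℝ} {A R : ℝ}

/-- `V_1` is the orthogonal sum of `V_0` and `W_0 = V_1 ⊓ V_0ᗮ`; the residual is tested against the
two components of a vector of `V_1` separately. -/
theorem IsCompactWavelet.starProjection_one (hw : IsCompactWavelet φ ψ)
    (g : Lp ℝ 2 (volume : Measure ℝ)) :
    (scaleSpace φ 1).starProjection g =
      (scaleSpace φ 0).starProjection g + (scaleSpace ψ 0).starProjection g := by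
  have h01 : scaleSpace φ 0 ≤ scaleSpace φ 1 := hw.nested 0
  have hψ := hw.scaleSpace_mother
  set a := (scaleSpace φ 0).starProjection g
  set b := (scaleSpace ψ 0).starProjection g
  have ha : a ∈ scaleSpace φ 0 := Submodule.starProjection_apply_mem _ _
  have hb : b ∈ scaleSpace ψ 0 := Submodule.starProjection_apply_mem _ _
  have hb2 : b ∈ scaleSpace φ 1 ∧ b ∈ (scaleSpace φ 0)ᗮ := by
    rw [hψ] at hb; exact hb
  have hga : g - a ∈ (scaleSpace φ 0)ᗮ := Submodule.sub_starProjection_mem_orthogonal _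
  have hgb : g - b ∈ (scaleSpace ψ 0)ᗮ := Submodule.sub_starProjection_mem_orthogonal _
  refine Submodule.eq_starProjection_of_mem_orthogonal
    (Submodule.add_mem _ (h01 ha) hb2.1) ?_
  rw [Submodule.mem_orthogonal]
  intro v hv
  set v₀ := (scaleSpace φ 0).starProjection v
  have hv₀ : v₀ ∈ scaleSpace φ 0 := Submodule.starProjection_apply_mem _ _
  have hv₁' : v - v₀ ∈ (scaleSpace φ 0)ᗮ := Submodule.sub_starProjection_mem_orthogonal _
  have hv₁ : v - v₀ ∈ scaleSpace ψ 0 := by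
    rw [hψ]; exact ⟨Submodule.sub_mem _ hv (h01 hv₀), hv₁'⟩
  have e1 : ⟪v₀, g - a⟫_ℝ = 0 := (Submodule.mem_orthogonal _ _).1 hga _ hv₀
  have e2 : ⟪v₀, b⟫_ℝ = 0 := (Submodule.mem_orthogonal _ _).1 hb2.2 _ hv₀
  have e3 : ⟪v - v₀, g - b⟫_ℝ = 0 := (Submodule.mem_orthogonal _ _).1 hgb _ hv₁
  have e4 : ⟪v - v₀, a⟫_ℝ = 0 := (Submodule.mem_orthogonal' _ _).1 hv₁' _ ha
  have : ⟪v, g - (a + b)⟫_ℝ = (⟪v₀, g - a⟫_ℝ - ⟪v₀, b⟫_ℝ) + (⟪v - v₀, g - b⟫_ℝ - ⟪v - v₀, a⟫_ℝ) := by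
    simp only [inner_sub_left, inner_sub_right, inner_add_right]
    ring
  rw [this, e1, e2, e3, e4]
  simp

/-- The function `h` is rescaled so that level `j` becomes level `0`, where the decomposition of the
projection applies. -/
theorem IsCompactWavelet.levelSum_succ (hw : IsCompactWavelet φ ψ)
    (hφA : ∀ x, A < |x| → φ x = 0) (hψA : ∀ x, A < |x| → ψ x = 0)
    (hh : MemLp h 2 volume) (hR : ∀ x, R < |x| → h x = 0) (j : ℤ) :
    levelSum φ h (j + 1) =ᵐ[volume] fun x => levelSum φ h j x + levelSum ψ h j x := by
  set h' : ℝ → ℝ := fun y => h ((2 : ℝ) ^ (-j) * y) with hh'def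
  have hj : (2 : ℝ) ^ (-j) ≠ 0 := zpow_ne_zero _ two_ne_zero
  have hh' : MemLp h' 2 volume := by
    simpa only [sub_zero] using memLp_comp_affine hh hj 0
  have hR' : ∀ x, (2 : ℝ) ^ j * R < |x| → h' x = 0 := by
    intro x hx
    refine hR _ ?_
    rw [abs_mul, abs_of_pos (by positivity), zpow_neg, inv_mul_eq_div, lt_div_iff₀ (by positivity)]
    linarith
  have base : ∀ᵐ x, levelSum φ h' 1 x = levelSum φ h' 0 x + levelSum ψ h' 0 x := by
    have hsum := hw.starProjection_one hh'.toLp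
    have e1 := starProjection_scaleSpace hw.memLp_scaling hφA hw.orthonormal_scaling hh' hR' 1
    have e2 := starProjection_scaleSpace hw.memLp_scaling hφA hw.orthonormal_scaling hh' hR' 0
    have e3 := starProjection_scaleSpace hw.memLp_mother hψA hw.orthonormal_mother hh' hR' 0
    rw [hsum] at e1
    filter_upwards [e1, e2, e3, Lp.coeFn_add ((scaleSpace φ 0).starProjection hh'.toLp)
      ((scaleSpace ψ 0).starProjection hh'.toLp)] with x h1 h2 h3 h4
    rw [← h1, h4, Pi.add_apply, h2, h3]
  have hq : Measure.QuasiMeasurePreserving (fun x : ℝ => (2 : ℝ) ^ j * x) volume volume := by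
    refine ⟨measurable_const_mul _, ?_⟩
    rw [Real.map_volume_mul_left (by positivity)]
    exact Measure.smul_absolutelyContinuous
  filter_upwards [hq.ae base] with x hx
  have h0 := levelSum_add_level φ h j 0 x
  have h1 := levelSum_add_level ψ h j 0 x
  rw [add_zero] at h0 h1
  rw [levelSum_add_level, h0, h1]
  exact hx

theorem IsCompactWavelet.tendsto_starProjection (hw : IsCompactWavelet φ ψ)
    (g : Lp ℝ 2 (volume : Measure ℝ)) :
    Tendsto (fun n : ℕ => (scaleSpace φ n).starProjection g) atTop (𝓝 g) := by
  have hmono : Monotone (scaleSpace φ) := monotone_int_of_le_succ hw.nested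
  have h := Submodule.starProjection_tendsto_self (scaleSpace φ) hmono g hw.dense.ge
  exact h.comp tendsto_natCast_atTop_atTop

end Multiresolution

end SIET

namespace SIET

/-! ### Local expansions of bounded functions and their truncation error on `[0,1]`. -/

section Truncation

variable {u f : ℝ → ℝ} {A : ℝ}

/-- For `j ≥ 0` a wavelet that meets `[0,1]` is supported within distance `2A` of it. A bounded
periodic function, which need not be in `L²(ℝ)`, may thus be cut off before projecting. -/
theorem levelSum_indicator (hA : ∀ x, A < |x| → u x = 0) (f : ℝ → ℝ) (j : ℕ) {x : ℝ}
    (hx : x ∈ Icc (0 : ℝ) 1) :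
    levelSum u ((Icc (-(2 * A + 1)) (2 * A + 1)).indicator f) j x = levelSum u f j x := by
  refine tsum_congr fun k => ?_
  by_cases hd : dilate u j k x = 0
  · rw [hd, mul_zero, mul_zero]
  congr 1
  refine integral_congr_ae (.of_forall fun y => ?_)
  simp only
  by_cases hdy : dilate u j k y = 0
  · rw [hdy, mul_zero, mul_zero]
  rw [indicator_of_mem]
  have h1 := abs_le.1 (abs_le_of_dilate_ne_zero hA hd)
  have h2 := abs_le.1 (abs_le_of_dilate_ne_zero hA hdy)
  rw [zpow_natCast] at h1 h2
  have hj : (1 : ℝ) ≤ 2 ^ j := one_le_pow₀ one_le_two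
  have hA0 : 0 ≤ A := by linarith
  have h3 : y - x ≤ 2 * A := by
    by_contra! hlt
    nlinarith
  have h4 : x - y ≤ 2 * A := by
    by_contra! hlt
    nlinarith
  constructor <;> linarith [hx.1, hx.2]

theorem integral_Icc_abs_le_eLpNorm {F : ℝ → ℝ} (hF : MemLp F 2 volume) :
    ∫ x in Icc (0 : ℝ) 1, |F x| ≤ (eLpNorm F 2 volume).toReal := by
  have hprob : IsProbabilityMeasure (volume.restrict (Icc (0 : ℝ) 1)) := ⟨by simp⟩
  have h1 : ∫ x in Icc (0 : ℝ) 1, |F x| = (eLpNorm F 1 (volume.restrict (Icc 0 1))).toReal := by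
    have := integral_norm_eq_lintegral_enorm (hF.1.restrict (s := Icc 0 1))
    rw [eLpNorm_one_eq_lintegral_enorm, ← this]
    rfl
  rw [h1]
  refine ENNReal.toReal_mono hF.2.ne ?_
  exact (eLpNorm_le_eLpNorm_of_exponent_le (by norm_num) hF.1.restrict).trans
    (eLpNorm_mono_measure _ Measure.restrict_le_self)

end Truncation

section Expansion

variable {φ ψ f : ℝ → ℝ} {A M : ℝ}

theorem indicator_Icc_eq_zero (f : ℝ → ℝ) {R x : ℝ} (hx : R < |x|) :
    (Icc (-R) R).indicator f x = 0 :=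
  indicator_of_notMem (fun hmem : x ∈ Icc (-R) R => hx.not_ge (abs_le.2 hmem)) _

theorem memLp_indicator_Icc (hf : Measurable f) (hM : ∀ x, |f x| ≤ M) (a b : ℝ) :
    MemLp ((Icc a b).indicator f) 2 volume := by
  rw [memLp_indicator_iff_restrict measurableSet_Icc]
  exact MemLp.of_bound hf.aestronglyMeasurable M (.of_forall hM)

theorem memLp_levelSum {u h : ℝ → ℝ} {R : ℝ} (hu : MemLp u 2 volume)
    (hA : ∀ x, A < |x| → u x = 0) (hR : ∀ x, R < |x| → h x = 0) (j : ℤ) :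
    MemLp (levelSum u h j) 2 volume := by
  obtain ⟨F, -, hF⟩ := exists_levelSum_eq_sum hA hR j
  rw [show levelSum u h j = fun x => _ from funext hF]
  exact memLp_finsetSum _ fun k _ => (memLp_dilate hu j k).const_mul _

/-- The expansion of a locally bounded function up to resolution `J` telescopes. -/
theorem IsCompactWavelet.levelSum_eq_sum (hw : IsCompactWavelet φ ψ)
    (hφA : ∀ x, A < |x| → φ x = 0) (hψA : ∀ x, A < |x| → ψ x = 0)
    (hf : Measurable f) (hM : ∀ x, |f x| ≤ M) (J : ℕ) :
    ∀ᵐ x ∂(volume.restrict (Icc (0 : ℝ) 1)),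
      levelSum φ f J x = levelSum φ f 0 x + ∑ j ∈ Finset.range J, levelSum ψ f j x := by
  set R := 2 * A + 1
  have hR : ∀ x, R < |x| → (Icc (-R) R).indicator f x = 0 := fun x => indicator_Icc_eq_zero f
  have key : ∀ n : ℕ, ∀ᵐ x ∂(volume.restrict (Icc (0 : ℝ) 1)),
      levelSum φ f (n + 1 : ℕ) x = levelSum φ f n x + levelSum ψ f n x := by
    intro n
    refine (ae_restrict_iff' measurableSet_Icc).2 ?_
    filter_upwards [hw.levelSum_succ hφA hψA (memLp_indicator_Icc hf hM (-R) R) hR n] with x hx hmem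
    rw [levelSum_indicator hφA f n hmem, levelSum_indicator hψA f n hmem] at hx
    rw [← hx, ← levelSum_indicator hφA f (n + 1) hmem]
    rfl
  filter_upwards [ae_all_iff.2 key] with x hx
  induction J with
  | zero => simp
  | succ n ih => rw [hx n, ih, Finset.sum_range_succ, add_assoc]

theorem IsCompactWavelet.tendsto_integral_abs_sub_levelSum (hw : IsCompactWavelet φ ψ)
    (hφA : ∀ x, A < |x| → φ x = 0) (hf : Measurable f) (hM : ∀ x, |f x| ≤ M) (hA : 0 ≤ A) :
    Tendsto (fun n : ℕ => ∫ x in Icc (0 : ℝ) 1, |levelSum φ f n x - f x|) atTop (𝓝 0) := by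
  set R := 2 * A + 1
  have hR : ∀ x, R < |x| → (Icc (-R) R).indicator f x = 0 := fun x => indicator_Icc_eq_zero f
  set h := (Icc (-R) R).indicator f with hh
  have hhm : MemLp h 2 volume := memLp_indicator_Icc hf hM (-R) R
  have hlim := tendsto_iff_norm_sub_tendsto_zero.1 (hw.tendsto_starProjection hhm.toLp)
  refine squeeze_zero (fun n => integral_nonneg fun x => abs_nonneg _) (fun n => ?_) hlim
  have hd : MemLp (fun x => levelSum φ h n x - h x) 2 volume :=
    (memLp_levelSum hw.memLp_scaling hφA hR n).sub hhm
  calc ∫ x in Icc (0 : ℝ) 1, |levelSum φ f n x - f x|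
      = ∫ x in Icc (0 : ℝ) 1, |levelSum φ h n x - h x| := by
        refine setIntegral_congr_fun measurableSet_Icc fun x hx => ?_
        rw [levelSum_indicator hφA f n hx, hh, indicator_of_mem]
        constructor <;> linarith [hx.1, hx.2]
    _ ≤ (eLpNorm (fun x => levelSum φ h n x - h x) 2 volume).toReal :=
        integral_Icc_abs_le_eLpNorm hd
    _ = ‖(scaleSpace φ n).starProjection hhm.toLp - hhm.toLp‖ := by
        rw [Lp.norm_def]
        congr 1
        refine eLpNorm_congr_ae ?_
        filter_upwards [starProjection_scaleSpace hw.memLp_scaling hφA hw.orthonormal_scaling hhm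
          hR n, hhm.coeFn_toLp, Lp.coeFn_sub ((scaleSpace φ n).starProjection hhm.toLp) hhm.toLp]
          with x h1 h2 h3
        rw [h3, Pi.sub_apply, h1, h2]

theorem integrableOn_levelSum {u : ℝ → ℝ} (hu : MemLp u 2 volume) (hA : ∀ x, A < |x| → u x = 0)
    (f : ℝ → ℝ) (j : ℕ) : IntegrableOn (levelSum u f j) (Icc 0 1) := by
  set R := 2 * A + 1
  have hR : ∀ x, R < |x| → (Icc (-R) R).indicator f x = 0 := fun x => indicator_Icc_eq_zero f
  have h := (memLp_levelSum hu hA hR j).restrict (Icc 0 1)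
  have h2 : IntegrableOn (levelSum u ((Icc (-R) R).indicator f) j) (Icc 0 1) :=
    h.integrable (by norm_num)
  exact h2.congr_fun (fun x hx => levelSum_indicator hA f j hx) measurableSet_Icc

/-- Geometric decay of the detail parts controls the truncation error in `L¹[0,1]`. -/
theorem IsCompactWavelet.integral_abs_sub_levelSum_le (hw : IsCompactWavelet φ ψ)
    (hφA : ∀ x, A < |x| → φ x = 0) (hψA : ∀ x, A < |x| → ψ x = 0) (hA : 0 ≤ A)
    (hf : Measurable f) (hM : ∀ x, |f x| ≤ M) {D : ℝ}
    (hD : ∀ j : ℕ, ∫ x in Icc (0 : ℝ) 1, |levelSum ψ f j x| ≤ D * (1 / 2) ^ j) (J : ℕ) :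
    ∫ x in Icc (0 : ℝ) 1, |levelSum φ f J x - f x| ≤ 2 * D * (1 / 2) ^ J := by
  have hfi : IntegrableOn f (Icc 0 1) :=
    (MemLp.of_bound hf.aestronglyMeasurable M (.of_forall hM) :
      MemLp f 1 (volume.restrict (Icc 0 1))).integrable le_rfl
  have hφi := integrableOn_levelSum hw.memLp_scaling hφA f
  have hψi := integrableOn_levelSum hw.memLp_mother hψA f
  have hD0 : 0 ≤ D := by
    have := (integral_nonneg fun x => abs_nonneg _).trans (hD 0)
    simpa using this
  -- Telescoping from `J` to `J + n` bounds the error by a geometric sum plus the error at level `J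
  -- + n`, which vanishes as `n → ∞` by density of the multiresolution analysis.
  have step : ∀ n, ∫ x in Icc (0 : ℝ) 1, |levelSum φ f J x - f x| ≤
      2 * D * (1 / 2) ^ J + ∫ x in Icc (0 : ℝ) 1, |levelSum φ f (J + n : ℕ) x - f x| := by
    intro n
    have hdiff : ∀ᵐ x ∂(volume.restrict (Icc (0 : ℝ) 1)), |levelSum φ f J x - f x| ≤
        (∑ j ∈ Finset.range n, |levelSum ψ f (J + j : ℕ) x|) +
          |levelSum φ f (J + n : ℕ) x - f x| := by
      filter_upwards [hw.levelSum_eq_sum hφA hψA hf hM J, hw.levelSum_eq_sum hφA hψA hf hM (J + n)]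
        with x h1 h2
      rw [Finset.sum_range_add, ← add_assoc, ← h1] at h2
      have h3 := Finset.abs_sum_le_sum_abs (fun j => levelSum ψ f (J + j : ℕ) x) (Finset.range n)
      have h4 : levelSum φ f J x - f x = (levelSum φ f (J + n : ℕ) x - f x) -
          ∑ j ∈ Finset.range n, levelSum ψ f (J + j : ℕ) x := by rw [h2]; ring
      rw [h4]
      exact (abs_sub _ _).trans (by linarith)
    have i1 : Integrable (fun x => ∑ j ∈ Finset.range n, |levelSum ψ f (J + j : ℕ) x|)
        (volume.restrict (Icc (0 : ℝ) 1)) := integrable_finsetSum _ fun j _ => (hψi (J + j)).abs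
    have i2 : Integrable (fun x => |levelSum φ f (J + n : ℕ) x - f x|)
        (volume.restrict (Icc (0 : ℝ) 1)) := ((hφi (J + n)).sub hfi).abs
    refine (integral_mono_ae ((hφi J).sub hfi).abs (i1.add i2) hdiff).trans ?_
    rw [integral_add' i1 i2, integral_finsetSum _ fun j _ => (hψi (J + j)).abs]
    gcongr
    calc ∑ j ∈ Finset.range n, ∫ x in Icc (0 : ℝ) 1, |levelSum ψ f (J + j : ℕ) x|
        ≤ ∑ j ∈ Finset.range n, D * (1 / 2) ^ J * (1 / 2) ^ j :=
          Finset.sum_le_sum fun j _ => (hD (J + j)).trans_eq (by rw [pow_add, mul_assoc])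
      _ = D * (1 / 2) ^ J * ∑ j ∈ Finset.range n, (1 / 2 : ℝ) ^ j := by rw [Finset.mul_sum]
      _ ≤ D * (1 / 2) ^ J * 2 := by
          gcongr
          exact sum_geometric_two_le n
      _ = 2 * D * (1 / 2) ^ J := by ring
  have hlim := (hw.tendsto_integral_abs_sub_levelSum hφA hf hM hA).comp
    (tendsto_add_atTop_nat J) |>.const_add (2 * D * (1 / 2) ^ J)
  rw [add_zero] at hlim
  refine ge_of_tendsto' hlim fun n => ?_
  have := step n
  rw [add_comm J n] at this
  exact this

end Expansion

end SIET

namespace SIET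

/-! ### Periodization and unfolding. -/

section Periodize

variable {F f : ℝ → ℝ} {B : ℝ}

theorem periodize_add_int (F : ℝ → ℝ) (n : ℤ) (x : ℝ) :
    periodize F (x + n) = periodize F x := by
  rw [periodize, periodize, ← (Equiv.addLeft n).tsum_eq fun l : ℤ => F (x + l)]
  refine tsum_congr fun l => ?_
  rw [Equiv.coe_addLeft]
  push_cast
  rw [add_assoc]

theorem periodic_periodize (F : ℝ → ℝ) : Function.Periodic (periodize F) 1 := fun x => by
  simpa using periodize_add_int F 1 x

/-- On the unit interval the periodization is a finite sum. -/
theorem exists_periodize_eq_sum (hF : ∀ x, B < |x| → F x = 0) :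
    ∃ S : Finset ℤ, (∀ l ∉ S, ∀ x ∈ Icc (0 : ℝ) 1, F (x + l) = 0) ∧
      ∀ x ∈ Icc (0 : ℝ) 1, periodize F x = ∑ l ∈ S, F (x + l) := by
  set N := ⌈B⌉ + 1
  have h0 : ∀ l ∉ Finset.Icc (-N) N, ∀ x ∈ Icc (0 : ℝ) 1, F (x + l) = 0 := by
    intro l hl x hx
    refine hF _ ((Int.le_ceil B).trans_lt ?_)
    rw [Finset.mem_Icc, not_and_or, not_le, not_le] at hl
    rw [lt_abs]
    rcases hl with hl | hl
    · right
      have : (l : ℝ) + 1 ≤ -(⌈B⌉ + 1 : ℤ) := by exact_mod_cast hl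
      push_cast at this
      linarith [hx.2]
    · left
      have : ((⌈B⌉ + 1 : ℤ) : ℝ) < l := by exact_mod_cast hl
      push_cast at this
      linarith [hx.1]
  exact ⟨_, h0, fun x hx => tsum_eq_sum fun l hl => h0 l hl x hx⟩

theorem memLp_periodize (hF : ∀ x, B < |x| → F x = 0) {p : ℝ≥0∞} (hFp : MemLp F p volume) :
    MemLp (periodize F) p (volume.restrict (Icc 0 1)) := by
  obtain ⟨S, -, hS⟩ := exists_periodize_eq_sum hF
  have h : MemLp (fun x => ∑ l ∈ S, F (x + l)) p (volume.restrict (Icc 0 1)) :=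
    memLp_finsetSum _ fun l _ =>
      (hFp.comp_measurePreserving (measurePreserving_add_right volume (l : ℝ))).restrict _
  refine h.ae_eq ((ae_restrict_iff' measurableSet_Icc).2 (.of_forall fun x hx => (hS x hx).symm))

/-- Unfolding: integrating a periodic function against `F` over the line is integrating it against
the periodization of `F` over a period. -/
theorem integral_mul_eq_integral_periodize (hF : ∀ x, B < |x| → F x = 0)
    (hf : Function.Periodic f 1) (hint : Integrable fun x => f x * F x) :
    ∫ x, f x * F x = ∫ x in (0 : ℝ)..1, f x * periodize F x := by
  obtain ⟨S, h0, hS⟩ := exists_periodize_eq_sum hF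
  have hper : ∀ (x : ℝ) (l : ℤ), f (x + l) = f x := fun x l => by
    simpa using hf.int_mul l x
  have hsum := hint.hasSum_intervalIntegral_comp_add_int
  simp_rw [hper] at hsum
  rw [← hsum.tsum_eq, tsum_eq_sum (s := S), ← intervalIntegral.integral_finsetSum]
  · refine intervalIntegral.integral_congr fun x hx => ?_
    rw [uIcc_of_le zero_le_one] at hx
    rw [hS x hx, Finset.mul_sum]
  · intro l _
    have := (hint.comp_add_right (l : ℝ)).intervalIntegrable (a := 0) (b := 1)
    simpa only [hper] using this
  · intro l hl
    rw [intervalIntegral.integral_congr (g := fun _ => 0)]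
    · simp
    · intro x hx
      rw [uIcc_of_le zero_le_one] at hx
      simp only
      rw [h0 l hl x hx, mul_zero]

/-- The triangle inequality bounds the left side by the integral of the periodization of `|F|`,
which unfolds to the line. -/
theorem integral_abs_periodize_le (hF : ∀ x, B < |x| → F x = 0) (hint : Integrable F) :
    ∫ x in Icc (0 : ℝ) 1, |periodize F x| ≤ ∫ x, |F x| := by
  have hFa : ∀ x, B < |x| → |F x| = 0 := fun x hx => by rw [hF x hx, abs_zero]
  have h1 := integral_mul_eq_integral_periodize (F := fun x => |F x|) (f := fun _ => 1) hFa
    (fun _ => rfl) (by simpa using hint.abs)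
  simp only [one_mul] at h1
  rw [h1, intervalIntegral.integral_of_le zero_le_one, ← integral_Icc_eq_integral_Ioc]
  have m1 := memLp_periodize hF (memLp_one_iff_integrable.2 hint)
  have m2 := memLp_periodize hFa (memLp_one_iff_integrable.2 hint.abs)
  refine setIntegral_mono_on (m1.integrable le_rfl).abs (m2.integrable le_rfl) measurableSet_Icc
    fun x hx => ?_
  obtain ⟨S, h0, hS⟩ := exists_periodize_eq_sum hF
  rw [hS x hx, periodize, tsum_eq_sum fun l hl => by rw [h0 l hl x hx, abs_zero]]
  exact Finset.abs_sum_le_sum_abs _ _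

end Periodize

/-! ### Periodized wavelets on the unit interval. -/

section PeriodizedWavelets

variable {u f : ℝ → ℝ} {A M : ℝ}

/-- An integer shift of the argument moves the index by a multiple of `2^j`, so at level `j` only
the `2^j` residue classes survive periodization. -/
theorem dilate_sub_two_pow_mul (u : ℝ → ℝ) (j : ℕ) (k l : ℤ) (x : ℝ) :
    dilate u j (k - 2 ^ j * l) x = dilate u j k (x + l) := by
  simp only [dilate, zpow_natCast]
  push_cast
  ring_nf

theorem dilate_zero_zero (u : ℝ → ℝ) : dilate u 0 0 = u := by
  ext x
  simp [dilate]

theorem dilate_eq_zero_of_lt_abs (hA : ∀ x, A < |x| → u x = 0) (j : ℕ) (k : ℤ) {x : ℝ}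
    (hx : A + |(k : ℝ)| < |x|) : dilate u j k x = 0 := by
  refine dilate_eq_zero hA ?_
  rw [zpow_natCast]
  have h1 : |x| ≤ |2 ^ j * x| := by
    rw [abs_mul, abs_of_pos (by positivity : (0 : ℝ) < 2 ^ j)]
    exact le_mul_of_one_le_left (abs_nonneg _) (one_le_pow₀ one_le_two)
  have h2 := abs_sub_abs_le_abs_sub (2 ^ j * x) (k : ℝ)
  linarith

/-- The periodized dilated translates are normalized in `L²[0,1]`. -/
theorem integral_periodize_dilate_sq (hu : MemLp u 2 volume) (hA : ∀ x, A < |x| → u x = 0)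
    (horth : ∀ k l : ℤ, ∫ x, u (x - k) * u (x - l) = if k = l then 1 else 0) (j : ℕ) (k : ℤ) :
    ∫ x in (0 : ℝ)..1, periodize (dilate u j k) x * periodize (dilate u j k) x = 1 := by
  set F := dilate u j k with hFdef
  set B := A + |(k : ℝ)|
  have hF : ∀ x, B < |x| → F x = 0 := fun x hx => dilate_eq_zero_of_lt_abs hA j k hx
  have hFp : MemLp F 2 volume := memLp_dilate hu j k
  set N := max ⌈2 * B⌉ 0 with hN
  -- If `F x` and `F (x + l)` are both nonzero then `|l| ≤ 2B`, so one finite range of `l` serves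
  -- all `x`.
  have hfin : ∀ x, periodize F x * F x = ∑ l ∈ Finset.Icc (-N) N, F (x + l) * F x := by
    intro x
    by_cases hx : F x = 0
    · simp [hx]
    rw [← Finset.sum_mul]
    congr 1
    refine tsum_eq_sum fun l hl => hF _ ?_
    have hxB : |x| ≤ B := by
      by_contra! hlt
      exact hx (hF x hlt)
    have hlB : 2 * B < |(l : ℝ)| := by
      refine (Int.le_ceil _).trans_lt ?_
      rw [Finset.mem_Icc, not_and_or, not_le, not_le] at hl
      rw [← Int.cast_abs, Int.cast_lt, lt_abs]
      have := le_max_left ⌈2 * B⌉ 0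
      rcases hl with hl | hl
      · right; omega
      · left; omega
    have := abs_sub_abs_le_abs_sub (l : ℝ) (-x)
    rw [abs_neg, sub_neg_eq_add, add_comm (l : ℝ)] at this
    linarith
  have hint : ∀ l : ℤ, Integrable fun x => F (x + l) * F x := fun l =>
    (hFp.comp_measurePreserving (measurePreserving_add_right volume (l : ℝ))).integrable_mul hFp
  -- The shift by `l` is the translate with index `k - 2^j l`, orthogonal to the one with index `k`
  -- unless `l = 0`.
  have hval : ∀ l : ℤ, ∫ x, F (x + l) * F x = if l = 0 then 1 else 0 := by
    intro l
    have : ∀ x, F (x + l) * F x = dilate u j (k - 2 ^ j * l) x * dilate u j k x := fun x => by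
      rw [dilate_sub_two_pow_mul]
    simp_rw [this]
    rw [integral_dilate_mul_dilate_add, horth]
    have h2 : (2 : ℤ) ^ j ≠ 0 := by positivity
    by_cases hl : l = 0
    · simp [hl]
    · rw [if_neg, if_neg hl]
      simp [h2, hl]
  have hsumint : Integrable fun x => periodize F x * F x := by
    simp_rw [hfin]
    exact integrable_finsetSum _ fun l _ => hint l
  rw [← integral_mul_eq_integral_periodize hF (periodic_periodize F) hsumint]
  simp_rw [hfin]
  rw [integral_finsetSum _ fun l _ => hint l]
  simp_rw [hval]
  simp [hN]

/-- The part of the expansion of a periodic function at resolution `j` is a finite sum of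
periodized wavelets. -/
theorem levelSum_eq_sum_periodize (hu : Integrable u) (hA : ∀ x, A < |x| → u x = 0)
    (hf : Measurable f) (hM : ∀ x, |f x| ≤ M) (hper : Function.Periodic f 1) (j : ℕ) (x : ℝ) :
    levelSum u f j x = ∑ k ∈ Finset.range (2 ^ j),
      (∫ t in (0 : ℝ)..1, f t * periodize (dilate u j k) t) * periodize (dilate u j k) x := by
  have hper' : ∀ (x : ℝ) (l : ℤ), f (x + l) = f x := fun x l => by
    simpa using hper.int_mul l x
  have hshift : ∀ k l : ℤ, lineCoeff u f j (k - 2 ^ j * l) = lineCoeff u f j k := by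
    intro k l
    simp only [lineCoeff]
    rw [← integral_add_right_eq_self (fun x => f x * dilate u j k x) (l : ℝ)]
    simp_rw [hper', dilate_sub_two_pow_mul]
  have hcoeff : ∀ k : ℤ, lineCoeff u f j k =
      ∫ t in (0 : ℝ)..1, f t * periodize (dilate u j k) t := fun k => by
    refine integral_mul_eq_integral_periodize (B := A + |(k : ℝ)|)
      (fun x hx => dilate_eq_zero_of_lt_abs hA j k hx) hper ?_
    refine Integrable.bdd_mul (c := M) ?_ hf.aestronglyMeasurable (.of_forall hM)
    exact memLp_one_iff_integrable.1 (memLp_dilate (memLp_one_iff_integrable.2 hu) j k)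
  have hsupp : ∀ y : ℝ, (Function.support fun k : ℤ => dilate u j k y).Finite := by
    intro y
    refine (finite_Icc ⌊(2 : ℝ) ^ j * y - A⌋ ⌈(2 : ℝ) ^ j * y + A⌉).subset fun k hk => ?_
    have h := abs_le.1 (abs_le_of_dilate_ne_zero hA hk)
    rw [zpow_natCast] at h
    constructor
    · exact_mod_cast (Int.floor_le _).trans (by linarith : (2 : ℝ) ^ j * y - A ≤ k)
    · exact_mod_cast (by linarith : (k : ℝ) ≤ (2 : ℝ) ^ j * y + A).trans (Int.le_ceil _)
  set T : ℤ → ℝ := fun k => lineCoeff u f j k * dilate u j k x with hT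
  have hTs : Summable T := summable_of_hasFiniteSupport
    ((hsupp x).subset fun k hk => right_ne_zero_of_mul hk)
  have hne : NeZero (2 ^ j : ℕ) := ⟨by positivity⟩
  -- Division with remainder by `2^j`: the coefficient depends only on the remainder, and the sum
  -- over the quotients is the periodization, up to the sign of the quotient.
  set e := (Int.divModEquiv (2 ^ j)).trans (Equiv.prodComm ℤ (Fin (2 ^ j)))
  have hTe : Summable (T ∘ e.symm) := e.symm.summable_iff.2 hTs
  rw [show levelSum u f j x = ∑' p, (T ∘ e.symm) p from (e.symm.tsum_eq T).symm,
    Summable.tsum_prod hTe, tsum_fintype, Finset.sum_range]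
  refine Finset.sum_congr rfl fun k _ => ?_
  have hterm : ∀ l : ℤ, (T ∘ e.symm) (k, l) =
      lineCoeff u f j (k : ℕ) * dilate u j (k : ℕ) (x + (Equiv.neg ℤ l : ℤ)) := by
    intro l
    have he : e.symm (k, l) = ((k : ℕ) : ℤ) - 2 ^ j * (-l) := by
      simp [e, Int.divModEquiv]
      ring
    rw [Function.comp_apply, he, hT]
    simp only
    rw [ hshift, dilate_sub_two_pow_mul, Equiv.neg_apply]
  rw [tsum_congr hterm, (Equiv.neg ℤ).tsum_eq fun l : ℤ =>
    lineCoeff u f j (k : ℕ) * dilate u j (k : ℕ) (x + l), tsum_mul_left, hcoeff]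
  rfl

end PeriodizedWavelets

end SIET

namespace SIET

/-! ### Decay of wavelet coefficients under a monotone majorant. -/

section Coefficients

variable {u f H : ℝ → ℝ} {A : ℕ} {M L : ℝ}

/-- The vanishing moment allows subtracting the value of `f` at the left end `a` of the support;
what remains is at most the increment of `H` over the support. -/
theorem abs_lineCoeff_le (hu : Integrable u) (hA : ∀ x, (A : ℝ) < |x| → u x = 0)
    (hu0 : ∫ x, u x = 0) (hf : Measurable f) (hM : ∀ x, |f x| ≤ M) (hH : Monotone H)
    (hfH : ∀ s t, s ≤ t → |f t - f s| ≤ H t - H s) (j : ℕ) (k : ℤ) :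
    |lineCoeff u f j k| ≤ (H ((k + A) / 2 ^ j) - H ((k - A) / 2 ^ j)) *
      ((2 : ℝ) ^ (-((j : ℝ) / 2)) * ∫ x, |u x|) := by
  set a := ((k : ℝ) - A) / 2 ^ j
  set b := ((k : ℝ) + A) / 2 ^ j
  have hd : Integrable (dilate u j k) :=
    memLp_one_iff_integrable.1 (memLp_dilate (memLp_one_iff_integrable.2 hu) j k)
  have hfd : Integrable fun x => f x * dilate u j k x :=
    Integrable.bdd_mul (c := M) hd hf.aestronglyMeasurable (.of_forall hM)
  have h1 : lineCoeff u f j k = ∫ x, (f x - f a) * dilate u j k x := by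
    have : ∀ x, (f x - f a) * dilate u j k x = f x * dilate u j k x - f a * dilate u j k x :=
      fun x => by ring
    simp_rw [this]
    rw [integral_sub hfd (hd.const_mul _), integral_const_mul, integral_dilate u hu0, mul_zero,
      sub_zero, lineCoeff]
  rw [h1, ← Int.cast_natCast (R := ℝ) j, ← integral_abs_dilate u j k, ← integral_const_mul]
  refine abs_integral_le_integral_abs.trans (integral_mono_of_nonneg
    (.of_forall fun x => abs_nonneg _) (hd.abs.const_mul _) (.of_forall fun x => ?_))
  simp only
  rw [abs_mul]
  by_cases hx : dilate u j k x = 0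
  · simp [hx]
  have h := abs_le.1 (abs_le_of_dilate_ne_zero hA hx)
  rw [zpow_natCast] at h
  have hax : a ≤ x := by
    rw [div_le_iff₀ (by positivity)]; linarith
  have hxb : x ≤ b := by
    rw [le_div_iff₀ (by positivity)]; linarith
  gcongr
  exact (hfH a x hax).trans (sub_le_sub_right (hH hxb) _)

/-- Each interval consists of `2A` adjacent cells of length `1/n`. For a fixed position of the cell
in the interval, the sum over `k` telescopes over one full period and gives `L`. -/
theorem sum_sub_le_of_add_period (hHL : ∀ t, H (t + 1) = H t + L) {n : ℕ} (hn : 0 < n) (A : ℕ) :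
    ∑ k ∈ Finset.range n, (H ((k + A) / n) - H ((k - A) / n)) = 2 * A * L := by
  have hn' : (n : ℝ) ≠ 0 := by positivity
  have h1 : ∀ k : ℕ, H (((k : ℝ) + A) / n) - H (((k : ℝ) - A) / n) =
      ∑ i ∈ Finset.range (2 * A),
        (H ((((k + 1 : ℕ) : ℝ) + i - A) / n) - H (((k : ℝ) + i - A) / n)) := by
    intro k
    have := Finset.sum_range_sub (fun i : ℕ => H (((k : ℝ) + i - A) / n)) (2 * A)
    rw [show (k : ℝ) + ((2 * A : ℕ) : ℝ) - A = k + A by push_cast; ring,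
      show (k : ℝ) + ((0 : ℕ) : ℝ) - A = k - A by push_cast; ring] at this
    rw [← this]
    refine Finset.sum_congr rfl fun i _ => ?_
    congr 3
    push_cast; ring
  simp_rw [h1]
  rw [Finset.sum_comm]
  have h2 : ∀ i : ℕ, ∑ k ∈ Finset.range n,
      (H ((((k + 1 : ℕ) : ℝ) + i - A) / n) - H (((k : ℝ) + i - A) / n)) = L := by
    intro i
    rw [Finset.sum_range_sub (fun k : ℕ => H (((k : ℝ) + i - A) / n)) n]
    rw [show ((n : ℝ) + i - A) / n = (((0 : ℕ) : ℝ) + i - A) / n + 1 by field_simp; push_cast; ring,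
      hHL]
    ring
  rw [Finset.sum_congr rfl fun i _ => h2 i]
  simp

/-- The wavelet coefficients at resolution `j` of a periodic function of bounded variation have
`ℓ¹` norm `O(2^{-j/2})`. -/
theorem sum_abs_coeff_le (hu : Integrable u) (hA : ∀ x, (A : ℝ) < |x| → u x = 0)
    (hu0 : ∫ x, u x = 0) (hf : Measurable f) (hM : ∀ x, |f x| ≤ M)
    (hper : Function.Periodic f 1) (hH : Monotone H)
    (hfH : ∀ s t, s ≤ t → |f t - f s| ≤ H t - H s) (hHL : ∀ t, H (t + 1) = H t + L) (j : ℕ) :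
    ∑ k ∈ Finset.range (2 ^ j), |∫ t in (0 : ℝ)..1, f t * periodize (dilate u j k) t| ≤
      (2 * A * L * ∫ x, |u x|) * (2 : ℝ) ^ (-((j : ℝ) / 2)) := by
  have hcoeff : ∀ k : ℕ, ∫ t in (0 : ℝ)..1, f t * periodize (dilate u j k) t =
      lineCoeff u f j k := fun k => by
    refine (integral_mul_eq_integral_periodize (B := A + |((k : ℤ) : ℝ)|)
      (fun x hx => dilate_eq_zero_of_lt_abs hA j k hx) hper ?_).symm
    refine Integrable.bdd_mul (c := M) ?_ hf.aestronglyMeasurable (.of_forall hM)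
    exact memLp_one_iff_integrable.1 (memLp_dilate (memLp_one_iff_integrable.2 hu) j k)
  simp_rw [hcoeff]
  have hsum := sum_sub_le_of_add_period hHL (n := 2 ^ j) (by positivity) A
  push_cast at hsum
  calc ∑ k ∈ Finset.range (2 ^ j), |lineCoeff u f j (k : ℕ)|
      ≤ ∑ k ∈ Finset.range (2 ^ j), (H (((k : ℝ) + A) / 2 ^ j) - H (((k : ℝ) - A) / 2 ^ j)) *
          ((2 : ℝ) ^ (-((j : ℝ) / 2)) * ∫ x, |u x|) :=
        Finset.sum_le_sum fun k _ => abs_lineCoeff_le hu hA hu0 hf hM hH hfH j k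
    _ = _ := by rw [← Finset.sum_mul, hsum]; ring

end Coefficients

/-! ### Functions of bounded variation and their periodic extension. -/

section BoundedVariation

variable {β : ℝ → ℝ} {K : ℝ}

/-- The variation of `β` on `[0,t]`. -/
noncomputable def cumVariation (β : ℝ → ℝ) (t : ℝ) : ℝ := (eVariationOn β (Icc 0 t)).toReal

theorem eVariationOn_ne_top (hβ : β ∈ BV K) {t : ℝ} (ht : t ≤ 1) :
    eVariationOn β (Icc 0 t) ≠ ⊤ :=
  ne_top_of_le_ne_top ENNReal.ofReal_ne_top
    ((eVariationOn.mono β (Icc_subset_Icc_right ht)).trans hβ)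

theorem abs_sub_le_cumVariation (hβ : β ∈ BV K) {s t : ℝ} (hs : 0 ≤ s) (hst : s ≤ t) (ht : t ≤ 1) :
    |β t - β s| ≤ cumVariation β t - cumVariation β s := by
  have h1 := eVariationOn.Icc_add_Icc β (s := univ) hs hst (mem_univ _)
  simp only [univ_inter] at h1
  have h2 : eVariationOn β (Icc s t) ≠ ⊤ :=
    ne_top_of_le_ne_top (eVariationOn_ne_top hβ ht)
      (eVariationOn.mono β (Icc_subset_Icc_left hs))
  have h3 : edist (β t) (β s) ≤ eVariationOn β (Icc s t) :=
    eVariationOn.edist_le β (right_mem_Icc.2 hst) (left_mem_Icc.2 hst)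
  have h4 := ENNReal.toReal_mono h2 h3
  rw [edist_dist, ENNReal.toReal_ofReal dist_nonneg, Real.dist_eq] at h4
  rw [cumVariation, cumVariation, ← h1,
    ENNReal.toReal_add (eVariationOn_ne_top hβ (hst.trans ht)) h2]
  linarith

theorem cumVariation_mono (hβ : β ∈ BV K) {s t : ℝ} (hs : 0 ≤ s) (hst : s ≤ t) (ht : t ≤ 1) :
    cumVariation β s ≤ cumVariation β t := by
  linarith [abs_sub_le_cumVariation hβ hs hst ht, abs_nonneg (β t - β s)]

theorem cumVariation_nonneg (β : ℝ → ℝ) (t : ℝ) : 0 ≤ cumVariation β t := ENNReal.toReal_nonneg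

theorem abs_sub_le_cumVariation_one (hβ : β ∈ BV K) {s t : ℝ} (hs : s ∈ Icc (0 : ℝ) 1)
    (ht : t ∈ Icc (0 : ℝ) 1) : |β t - β s| ≤ cumVariation β 1 := by
  rcases le_total s t with h | h
  · linarith [abs_sub_le_cumVariation hβ hs.1 h ht.2, cumVariation_nonneg β s,
      cumVariation_mono hβ ht.1 ht.2 le_rfl]
  · rw [abs_sub_comm]
    linarith [abs_sub_le_cumVariation hβ ht.1 h hs.2, cumVariation_nonneg β t,
      cumVariation_mono hβ hs.1 hs.2 le_rfl]

/-- Jordan decomposition: `β` is the difference of two functions that are monotone on `[0,1]`. -/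
theorem integrableOn_of_mem_BV (hβ : β ∈ BV K) : IntegrableOn β (Icc 0 1) := by
  have h1 : MonotoneOn (cumVariation β) (Icc 0 1) := fun s hs t ht hst =>
    cumVariation_mono hβ hs.1 hst ht.2
  have h2 : MonotoneOn (fun t => cumVariation β t - β t) (Icc 0 1) := fun s hs t ht hst => by
    have := (le_abs_self _).trans (abs_sub_le_cumVariation hβ hs.1 hst ht.2)
    simp only
    linarith
  have h3 := (h1.integrableOn_isCompact (μ := volume) isCompact_Icc).sub
    (h2.integrableOn_isCompact (μ := volume) isCompact_Icc)
  refine h3.congr (.of_forall fun t => ?_)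
  simp

/-- A monotone majorant of the increments of the periodic extension of `β ∘ τ`. -/
noncomputable def periodicMajorant (β τ : ℝ → ℝ) (t : ℝ) : ℝ :=
  cumVariation β (τ (Int.fract t)) + 2 * cumVariation β 1 * ⌊t⌋

theorem periodicMajorant_add_one (β τ : ℝ → ℝ) (t : ℝ) :
    periodicMajorant β τ (t + 1) = periodicMajorant β τ t + 2 * cumVariation β 1 := by
  simp only [periodicMajorant, Int.fract_add_one, Int.floor_add_one]
  push_cast
  ring

variable {τ : ℝ → ℝ}

theorem abs_sub_le_periodicMajorant (hβ : β ∈ BV K) (hτ : MonotoneOn τ (Ico 0 1))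
    (hτ01 : ∀ t ∈ Ico (0 : ℝ) 1, τ t ∈ Icc (0 : ℝ) 1) {s t : ℝ} (hst : s ≤ t) :
    |β (τ (Int.fract t)) - β (τ (Int.fract s))| ≤
      periodicMajorant β τ t - periodicMajorant β τ s := by
  have hmem : ∀ r : ℝ, Int.fract r ∈ Ico (0 : ℝ) 1 := fun r =>
    ⟨Int.fract_nonneg r, Int.fract_lt_one r⟩
  have hs := hτ01 _ (hmem s)
  have ht := hτ01 _ (hmem t)
  simp only [periodicMajorant]
  rcases (Int.floor_mono hst).eq_or_lt with h | h
  · have hf : Int.fract s ≤ Int.fract t := by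
      rw [Int.fract, Int.fract, h]; linarith
    have := abs_sub_le_cumVariation hβ hs.1 (hτ (hmem s) (hmem t) hf) ht.2
    rw [h]
    linarith
  -- Across an integer the increment of `β ∘ τ` costs at most one total variation, and the reset of
  -- `cumVariation` may lose another; hence the factor `2` at the floor.
  · have h1 := abs_sub_le_cumVariation_one hβ hs ht
    have h2 : (⌊s⌋ : ℝ) + 1 ≤ ⌊t⌋ := by exact_mod_cast h
    have h3 := cumVariation_nonneg β 1
    have h4 := cumVariation_nonneg β (τ (Int.fract t))
    have h5 := cumVariation_mono hβ hs.1 hs.2 le_rfl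
    nlinarith

theorem monotone_periodicMajorant (hβ : β ∈ BV K) (hτ : MonotoneOn τ (Ico 0 1))
    (hτ01 : ∀ t ∈ Ico (0 : ℝ) 1, τ t ∈ Icc (0 : ℝ) 1) : Monotone (periodicMajorant β τ) :=
  fun _ _ hst => sub_nonneg.1 ((abs_nonneg _).trans (abs_sub_le_periodicMajorant hβ hτ hτ01 hst))

end BoundedVariation

/-! ### Step functions through the samples and the discretization error. -/

section Sampling

variable {J : ℕ} {x : Fin (2 ^ J) → ℝ} {y : Fin (2 ^ J) → ℝ}

/-- The sample point whose cell contains `t`. -/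
noncomputable def samplePoint (J : ℕ) (x : Fin (2 ^ J) → ℝ) (t : ℝ) : ℝ :=
  -- The default value `1` keeps the function in `[0,1]` for every `t`.
  if h : ⌊(2 : ℝ) ^ J * t⌋₊ < 2 ^ J then x ⟨⌊(2 : ℝ) ^ J * t⌋₊, h⟩ else 1

theorem floor_lt_of_mem_Ico {t : ℝ} (ht : t ∈ Ico (0 : ℝ) 1) : ⌊(2 : ℝ) ^ J * t⌋₊ < 2 ^ J := by
  rw [Nat.floor_lt (mul_nonneg (by positivity) ht.1)]
  push_cast
  exact mul_lt_of_lt_one_right (by positivity) ht.2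

theorem stepFunction_eq (y : Fin (2 ^ J) → ℝ) {t : ℝ} (ht : t ∈ Ico (0 : ℝ) 1) :
    stepFunction J y t = y ⟨⌊(2 : ℝ) ^ J * t⌋₊, floor_lt_of_mem_Ico ht⟩ := by
  have hnn : 0 ≤ (2 : ℝ) ^ J * t := mul_nonneg (by positivity) ht.1
  have hpos : (0 : ℝ) < 2 ^ J := by positivity
  rw [stepFunction, Finset.sum_eq_single ⟨⌊(2 : ℝ) ^ J * t⌋₊, floor_lt_of_mem_Ico ht⟩]
  · rw [indicator_of_mem]
    constructor
    · rw [div_le_iff₀ hpos, mul_comm t]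
      exact Nat.floor_le hnn
    · rw [lt_div_iff₀ hpos, mul_comm t]
      exact Nat.lt_floor_add_one _
  · intro i _ hi
    rw [indicator_of_notMem]
    intro hmem
    apply hi
    rw [Fin.ext_iff]
    simp only
    have h1 := hmem.1
    have h2 := hmem.2
    rw [div_le_iff₀ hpos, mul_comm t] at h1
    rw [lt_div_iff₀ hpos, mul_comm t] at h2
    exact ((Nat.floor_eq_iff hnn).2 ⟨h1, h2⟩).symm
  · simp

theorem stepFunction_comp_eq (β : ℝ → ℝ) {t : ℝ} (ht : t ∈ Ico (0 : ℝ) 1) :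
    stepFunction J (fun i => β (x i)) t = β (samplePoint J x t) := by
  rw [stepFunction_eq _ ht, samplePoint, dif_pos (floor_lt_of_mem_Ico ht)]

theorem samplePoint_mem (hx : ∀ i : Fin (2 ^ J),
      x i ∈ Icc ((i.val : ℝ) / 2 ^ J) (((i.val : ℝ) + 1) / 2 ^ J)) (t : ℝ) :
    samplePoint J x t ∈ Icc (0 : ℝ) 1 := by
  rw [samplePoint]
  split_ifs with h
  · have := hx ⟨_, h⟩
    refine ⟨(by positivity : (0 : ℝ) ≤ _).trans this.1, this.2.trans ?_⟩
    rw [div_le_one (by positivity)]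
    exact_mod_cast h
  · simp

theorem monotone_sample (hx : ∀ i : Fin (2 ^ J),
      x i ∈ Icc ((i.val : ℝ) / 2 ^ J) (((i.val : ℝ) + 1) / 2 ^ J)) : Monotone x := by
  intro i j hij
  rcases hij.eq_or_lt with h | h
  · rw [h]
  · refine (hx i).2.trans (le_trans ?_ (hx j).1)
    gcongr
    exact_mod_cast h

theorem monotoneOn_samplePoint (hx : ∀ i : Fin (2 ^ J),
      x i ∈ Icc ((i.val : ℝ) / 2 ^ J) (((i.val : ℝ) + 1) / 2 ^ J)) :
    MonotoneOn (samplePoint J x) (Ico 0 1) := by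
  intro s hs t ht hst
  rw [samplePoint, samplePoint, dif_pos (floor_lt_of_mem_Ico hs), dif_pos (floor_lt_of_mem_Ico ht)]
  refine monotone_sample hx ?_
  exact Nat.floor_mono (by gcongr)

theorem measurable_stepFunction (J : ℕ) (y : Fin (2 ^ J) → ℝ) : Measurable (stepFunction J y) := by
  unfold stepFunction
  exact Finset.measurable_fun_sum _ fun i _ => measurable_const.indicator measurableSet_Ico

/-- The discretization error in `L¹[0,1]`. -/
theorem integral_abs_sub_stepFunction_le {β : ℝ → ℝ} {K : ℝ} (hβ : β ∈ BV K)
    (hx : ∀ i : Fin (2 ^ J), x i ∈ Icc ((i.val : ℝ) / 2 ^ J) (((i.val : ℝ) + 1) / 2 ^ J)) :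
    ∫ t in Icc (0 : ℝ) 1, |β t - stepFunction J (fun i => β (x i)) t| ≤
      cumVariation β 1 * (1 / 2 ^ J) := by
  set g := stepFunction J (fun i => β (x i)) with hg
  set a : ℕ → ℝ := fun i => (i : ℝ) / 2 ^ J with ha
  have ha0 : ∀ i, 0 ≤ a i := fun i => by positivity
  have hamono : Monotone a := fun i k hik => by
    simp only [ha]
    gcongr
  have ha1 : a (2 ^ J) = 1 := by
    simp only [ha]
    push_cast
    exact div_self (by positivity)
  have hgi : IntegrableOn g (Icc 0 1) := by
    rw [hg]
    unfold stepFunction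
    exact integrable_finsetSum _ fun i _ => (integrable_const _).indicator measurableSet_Ico
  have hint : IntegrableOn (fun t => |β t - g t|) (Icc 0 1) :=
    ((integrableOn_of_mem_BV hβ).sub hgi).abs
  have hsub : ∀ i < 2 ^ J, uIcc (a i) (a (i + 1)) ⊆ Icc 0 1 := by
    intro i hi
    rw [uIcc_of_le (hamono i.le_succ)]
    refine Icc_subset_Icc (ha0 i) ?_
    rw [← ha1]
    exact hamono hi
  have hii : ∀ i < 2 ^ J, IntervalIntegrable (fun t => |β t - g t|) volume (a i) (a (i + 1)) :=
    fun i hi => (hint.mono_set (hsub i hi)).intervalIntegrable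
  have hcell : ∀ i ∈ Finset.range (2 ^ J), ∫ t in a i..a (i + 1), |β t - g t| ≤
      (cumVariation β (a (i + 1)) - cumVariation β (a i)) * (1 / 2 ^ J) := by
    intro i hi
    rw [Finset.mem_range] at hi
    have hlen : a (i + 1) - a i = 1 / 2 ^ J := by
      simp only [ha]
      push_cast
      ring
    rw [← hlen, mul_comm, ← smul_eq_mul, ← intervalIntegral.integral_const]
    refine intervalIntegral.integral_mono_on_of_le_Ioo (hamono i.le_succ) (hii i hi) (by simp)
      fun t ht => ?_
    have hi1 : a (i + 1) ≤ 1 := ha1 ▸ hamono hi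
    have hgt : g t = β (x ⟨i, hi⟩) := by
      rw [hg, stepFunction_eq _ ⟨(ha0 i).trans ht.1.le, ht.2.trans_le hi1⟩]
      have : ⌊(2 : ℝ) ^ J * t⌋₊ = i := by
        have h1 := ht.1.le
        have h2 := ht.2
        simp only [ha] at h1 h2
        rw [div_le_iff₀ (by positivity)] at h1
        rw [lt_div_iff₀ (by positivity)] at h2
        push_cast at h2
        refine (Nat.floor_eq_iff (mul_nonneg (by positivity) ((ha0 i).trans ht.1.le))).2 ⟨?_, ?_⟩ <;>
          linarith
      congr 3
    have hxi := hx ⟨i, hi⟩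
    have hxl : a i ≤ x ⟨i, hi⟩ := hxi.1
    have hxr : x ⟨i, hi⟩ ≤ a (i + 1) := by
      have := hxi.2
      simp only [ha]
      push_cast
      exact this
    rw [hgt]
    -- Both `t` and the sample point lie in the cell, so `|β t - g t|` is at most the variation of
    -- `β` over that cell, in whichever order they come.
    have hl := cumVariation_mono hβ (ha0 i) (le_min ht.1.le hxl)
      ((min_le_left _ _).trans (ht.2.le.trans hi1))
    have hr := cumVariation_mono hβ ((ha0 i).trans (ht.1.le.trans (le_max_left _ (x ⟨i, hi⟩))))
      (max_le ht.2.le hxr) hi1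
    rcases le_total t (x ⟨i, hi⟩) with h | h
    · have := abs_sub_le_cumVariation hβ ((ha0 i).trans ht.1.le) h (hxr.trans hi1)
      rw [abs_sub_comm]
      rw [min_eq_left h] at hl
      rw [max_eq_right h] at hr
      linarith
    · have := abs_sub_le_cumVariation hβ ((ha0 i).trans hxl) h (ht.2.le.trans hi1)
      rw [min_eq_right h] at hl
      rw [max_eq_left h] at hr
      linarith
  have hsum := intervalIntegral.sum_integral_adjacent_intervals hii
  rw [integral_Icc_eq_integral_Ioc, ← intervalIntegral.integral_of_le zero_le_one]
  rw [show a 0 = 0 by simp [ha], ha1] at hsum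
  rw [← hsum]
  refine (Finset.sum_le_sum hcell).trans ?_
  rw [← Finset.sum_mul, Finset.sum_range_sub (fun i => cumVariation β (a i)), ha1]
  gcongr
  linarith [cumVariation_nonneg β (a 0)]

end Sampling

end SIET

namespace SIET

/-! ### Empirical coefficients as linear forms in the data. -/

section EmpiricalCoefficients

variable {J : ℕ} {g : ℝ → ℝ}

/-- The `i`-th of the `2^J` cells of the unit interval. -/
def cell (J : ℕ) (i : Fin (2 ^ J)) : Set ℝ := Ico ((i.val : ℝ) / 2 ^ J) (((i.val : ℝ) + 1) / 2 ^ J)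

theorem measurableSet_cell (i : Fin (2 ^ J)) : MeasurableSet (cell J i) := measurableSet_Ico

theorem cell_subset_Ico (i : Fin (2 ^ J)) : cell J i ⊆ Ico 0 1 := by
  refine Ico_subset_Ico (by positivity) ?_
  rw [div_le_one (by positivity)]
  exact_mod_cast i.2

theorem volume_real_cell (i : Fin (2 ^ J)) : volume.real (cell J i) = 1 / 2 ^ J := by
  rw [cell, Real.volume_real_Ico_of_le (by gcongr; linarith)]
  ring

theorem stepFunction_eq_of_mem_cell (y : Fin (2 ^ J) → ℝ) {i : Fin (2 ^ J)} {t : ℝ}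
    (ht : t ∈ cell J i) : stepFunction J y t = y i := by
  have h01 := cell_subset_Ico i ht
  rw [stepFunction_eq y h01]
  congr 1
  rw [Fin.ext_iff]
  have h1 := ht.1
  have h2 := ht.2
  rw [div_le_iff₀ (by positivity)] at h1
  rw [lt_div_iff₀ (by positivity)] at h2
  exact (Nat.floor_eq_iff (mul_nonneg (by positivity) h01.1)).2 ⟨by linarith, by linarith⟩

/-- Linearity in the data yields the splitting into signal and noise, the exponential moments of the
noise part, and measurability. -/
theorem empiricalCoeff_eq_sum (y : Fin (2 ^ J) → ℝ) (hg : IntegrableOn g (Icc 0 1)) :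
    empiricalCoeff J y g = ∑ i, y i * ∫ t in cell J i, g t := by
  have h1 : ∀ t, stepFunction J y t * g t =
      ∑ i, (cell J i).indicator (fun t => y i * g t) t := by
    intro t
    rw [stepFunction, Finset.sum_mul]
    refine Finset.sum_congr rfl fun i _ => ?_
    change (cell J i).indicator (fun _ => y i) t * g t = _
    by_cases ht : t ∈ cell J i
    · rw [indicator_of_mem ht, indicator_of_mem ht]
    · rw [indicator_of_notMem ht, indicator_of_notMem ht, zero_mul]
  rw [empiricalCoeff, intervalIntegral.integral_of_le zero_le_one, ← integral_Icc_eq_integral_Ioc]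
  simp_rw [h1]
  rw [integral_finsetSum _ fun i _ => (hg.const_mul (y i)).indicator (measurableSet_cell i)]
  refine Finset.sum_congr rfl fun i _ => ?_
  rw [integral_indicator (measurableSet_cell i), Measure.restrict_restrict (measurableSet_cell i),
    inter_eq_left.2 ((cell_subset_Ico i).trans Ico_subset_Icc_self), integral_const_mul]

theorem integrableOn_stepFunction (y : Fin (2 ^ J) → ℝ) :
    IntegrableOn (stepFunction J y) (Icc 0 1) := by
  unfold stepFunction
  exact integrable_finsetSum _ fun i _ => (integrable_const _).indicator measurableSet_Ico

theorem memLp_stepFunction (y : Fin (2 ^ J) → ℝ) :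
    MemLp (stepFunction J y) 2 (volume.restrict (Icc 0 1)) := by
  unfold stepFunction
  exact memLp_finsetSum _ fun i _ => (memLp_const _).indicator measurableSet_Ico

/-- Bessel's inequality for the normalized indicators of the cells. -/
theorem sum_sq_integral_cell_le (hg : MemLp g 2 (volume.restrict (Icc 0 1))) :
    ∑ i, (∫ t in cell J i, g t) ^ 2 ≤ (1 / 2 ^ J) * ∫ t in (0 : ℝ)..1, g t * g t := by
  set b : Fin (2 ^ J) → ℝ := fun i => ∫ t in cell J i, g t with hb
  -- The values of `s` are the cell averages of `g`, so `s` is the projection of `g` onto step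
  -- functions; Bessel's inequality is `∫ (s - g)² ≥ 0` expanded.
  set s := stepFunction J (fun i => 2 ^ J * b i) with hs
  have hgi : IntegrableOn g (Icc 0 1) := hg.integrable (by norm_num)
  have hsL := memLp_stepFunction (J := J) (fun i => 2 ^ J * b i)
  have i1 := hg.integrable_mul hg
  have i2 := hsL.integrable_mul hg
  have i3 := hsL.integrable_mul hsL
  have e2 : ∫ t in Icc (0 : ℝ) 1, s t * g t = 2 ^ J * ∑ i, b i ^ 2 := by
    have := empiricalCoeff_eq_sum (J := J) (fun i => 2 ^ J * b i) hgi
    rw [empiricalCoeff, intervalIntegral.integral_of_le zero_le_one,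
      ← integral_Icc_eq_integral_Ioc] at this
    rw [this, Finset.mul_sum]
    exact Finset.sum_congr rfl fun i _ => by ring
  have e3 : ∫ t in Icc (0 : ℝ) 1, s t * s t = 2 ^ J * ∑ i, b i ^ 2 := by
    have := empiricalCoeff_eq_sum (J := J) (fun i => 2 ^ J * b i)
      (integrableOn_stepFunction (J := J) (fun i => 2 ^ J * b i))
    rw [empiricalCoeff, intervalIntegral.integral_of_le zero_le_one,
      ← integral_Icc_eq_integral_Ioc] at this
    rw [this, Finset.mul_sum]
    refine Finset.sum_congr rfl fun i _ => ?_
    rw [setIntegral_congr_fun (g := fun _ => 2 ^ J * b i) (measurableSet_cell i)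
      (fun t ht => stepFunction_eq_of_mem_cell _ ht), setIntegral_const, smul_eq_mul,
      volume_real_cell]
    field_simp
  have e1 : ∫ t in Icc (0 : ℝ) 1, g t * g t = ∫ t in (0 : ℝ)..1, g t * g t := by
    rw [intervalIntegral.integral_of_le zero_le_one, integral_Icc_eq_integral_Ioc]
  have h0 : 0 ≤ ∫ t in Icc (0 : ℝ) 1, (s t - g t) * (s t - g t) :=
    integral_nonneg fun t => mul_self_nonneg _
  have hexp : ∀ t, (s t - g t) * (s t - g t) = s t * s t - 2 * (s t * g t) + g t * g t :=
    fun t => by ring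
  simp_rw [hexp] at h0
  have i3' : Integrable (fun t => s t * s t) (volume.restrict (Icc 0 1)) := i3
  have i2' : Integrable (fun t => 2 * (s t * g t)) (volume.restrict (Icc 0 1)) := i2.const_mul 2
  have i1' : Integrable (fun t => g t * g t) (volume.restrict (Icc 0 1)) := i1
  have i32 : Integrable (fun t => s t * s t - 2 * (s t * g t)) (volume.restrict (Icc 0 1)) :=
    i3'.sub i2'
  rw [integral_add i32 i1', integral_sub i3' i2', integral_const_mul, e1, e2, e3] at h0
  rw [one_div, inv_mul_eq_div, le_div_iff₀ (by positivity)]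
  linarith

end EmpiricalCoefficients

/-! ### Exponential moments and tails of the noise coefficients. -/

section Noise

theorem integral_exp_mul_noise (σ : ℝ≥0) (J : ℕ) (b : Fin (2 ^ J) → ℝ) :
    Integrable (fun z => Real.exp (∑ i, z i * b i)) (noiseLaw σ J) ∧
    ∫ z, Real.exp (∑ i, z i * b i) ∂(noiseLaw σ J) = Real.exp (σ ^ 2 / 2 * ∑ i, b i ^ 2) := by
  have h : ∀ z : Fin (2 ^ J) → ℝ, Real.exp (∑ i, z i * b i) = ∏ i, Real.exp (b i * z i) := fun z => by
    rw [Real.exp_sum]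
    exact Finset.prod_congr rfl fun i _ => by rw [mul_comm]
  simp_rw [h]
  constructor
  · exact Integrable.fintype_prod fun i => integrable_exp_mul_gaussianReal (b i)
  · rw [noiseLaw, integral_fintype_prod_eq_prod (fun i (w : ℝ) => Real.exp (b i * w)),
      Finset.mul_sum, Real.exp_sum]
    refine Finset.prod_congr rfl fun i _ => ?_
    have := congrFun (mgf_fun_id_gaussianReal (μ := 0) (v := σ ^ 2)) (b i)
    rw [mgf] at this
    rw [this]
    push_cast
    ring_nf

/-- `Z` has sub-Gaussian exponential moments with variance proxy `s²`. -/
def SubGaussian {Ω : Type*} [MeasurableSpace Ω] (Z : Ω → ℝ) (s : ℝ) (μ : Measure Ω) : Prop :=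
  ∀ t, Integrable (fun ω => Real.exp (t * Z ω)) μ ∧
    ∫ ω, Real.exp (t * Z ω) ∂μ ≤ Real.exp (t ^ 2 * s ^ 2 / 2)

/-- The coefficient is a Gaussian linear form whose variance is `σ²` times a sum of squared cell
integrals, at most `σ²/m` by Bessel. Only these marginal bounds are needed, so orthogonality between
the periodized wavelets plays no role. -/
theorem subGaussian_empiricalCoeff (σ : ℝ≥0) (J : ℕ) {g : ℝ → ℝ}
    (hg : MemLp g 2 (volume.restrict (Icc 0 1))) (hg1 : ∫ t in (0 : ℝ)..1, g t * g t = 1) :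
    SubGaussian (fun z => empiricalCoeff J z g) (σ / √(2 ^ J)) (noiseLaw σ J) := by
  intro t
  have hgi : IntegrableOn g (Icc 0 1) := hg.integrable (by norm_num)
  have h : ∀ z : Fin (2 ^ J) → ℝ, t * empiricalCoeff J z g =
      ∑ i, z i * (t * ∫ r in cell J i, g r) := fun z => by
    rw [empiricalCoeff_eq_sum z hgi, Finset.mul_sum]
    exact Finset.sum_congr rfl fun i _ => by ring
  simp_rw [h]
  obtain ⟨h1, h2⟩ := integral_exp_mul_noise σ J fun i => t * ∫ r in cell J i, g r
  refine ⟨h1, h2.trans_le (Real.exp_le_exp.2 ?_)⟩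
  have h3 := sum_sq_integral_cell_le (J := J) hg
  rw [hg1, mul_one] at h3
  simp_rw [mul_pow]
  rw [← Finset.mul_sum, div_pow, Real.sq_sqrt (by positivity)]
  calc (σ : ℝ) ^ 2 / 2 * (t ^ 2 * ∑ i, (∫ r in cell J i, g r) ^ 2)
      ≤ (σ : ℝ) ^ 2 / 2 * (t ^ 2 * (1 / 2 ^ J)) := by gcongr
    _ = t ^ 2 * (σ ^ 2 / 2 ^ J) / 2 := by ring

variable {Ω : Type*} [MeasurableSpace Ω] {μ : Measure Ω} {Z : Ω → ℝ} {s : ℝ}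

/-- From `max x 0 ≤ e^{tx}/t` and `e^{t|Z|} ≤ e^{tZ} + e^{-tZ}`. The parameter `t` stays free, to be
chosen according to `l`. -/
theorem SubGaussian.integral_max_abs_sub_le (hZ : SubGaussian Z s μ) (hZm : AEMeasurable Z μ)
    (l : ℝ) {t : ℝ} (ht : 0 < t) :
    Integrable (fun ω => max (|Z ω| - l) 0) μ ∧
    ∫ ω, max (|Z ω| - l) 0 ∂μ ≤ 2 / t * Real.exp (t ^ 2 * s ^ 2 / 2 - t * l) := by
  have hbound : ∀ ω, max (|Z ω| - l) 0 ≤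
      t⁻¹ * Real.exp (-(t * l)) * (Real.exp (t * Z ω) + Real.exp (-t * Z ω)) := by
    intro ω
    have h1 : Real.exp (t * |Z ω|) ≤ Real.exp (t * Z ω) + Real.exp (-t * Z ω) := by
      rcases abs_cases (Z ω) with ⟨h, -⟩ | ⟨h, -⟩ <;> rw [h]
      · linarith [Real.exp_pos (-t * Z ω)]
      · rw [mul_neg, ← neg_mul]
        linarith [Real.exp_pos (t * Z ω)]
    have h2 : max (|Z ω| - l) 0 ≤ t⁻¹ * Real.exp (t * (|Z ω| - l)) := by
      refine max_le ?_ (by positivity)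
      rw [inv_mul_eq_div, le_div_iff₀ ht, mul_comm]
      linarith [Real.add_one_le_exp (t * (|Z ω| - l))]
    refine h2.trans ?_
    rw [mul_assoc]
    refine mul_le_mul_of_nonneg_left ?_ (by positivity)
    rw [mul_sub, sub_eq_neg_add, Real.exp_add]
    exact mul_le_mul_of_nonneg_left h1 (Real.exp_pos _).le
  have hint := (((hZ t).1.add (hZ (-t)).1).const_mul (t⁻¹ * Real.exp (-(t * l))))
  have hm : AEStronglyMeasurable (fun ω => max (|Z ω| - l) 0) μ := by
    have : AEMeasurable (fun ω => max (|Z ω| - l) 0) μ := by fun_prop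
    exact this.aestronglyMeasurable
  have hi : Integrable (fun ω => max (|Z ω| - l) 0) μ := by
    refine hint.mono' hm (.of_forall fun ω => ?_)
    rw [Real.norm_eq_abs, abs_of_nonneg (le_max_right _ _)]
    exact hbound ω
  refine ⟨hi, (integral_mono hi hint hbound).trans ?_⟩
  have e1 := (hZ t).2
  have e2 := (hZ (-t)).2
  rw [neg_sq] at e2
  rw [integral_const_mul]
  change _ * ∫ ω, (Real.exp (t * Z ω) + Real.exp (-t * Z ω)) ∂μ ≤ _
  rw [integral_add (hZ t).1 (hZ (-t)).1]
  calc t⁻¹ * Real.exp (-(t * l)) *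
        (∫ ω, Real.exp (t * Z ω) ∂μ + ∫ ω, Real.exp (-t * Z ω) ∂μ)
      ≤ t⁻¹ * Real.exp (-(t * l)) *
        (Real.exp (t ^ 2 * s ^ 2 / 2) + Real.exp (t ^ 2 * s ^ 2 / 2)) := by gcongr
    _ = 2 / t * Real.exp (t ^ 2 * s ^ 2 / 2 - t * l) := by
        rw [sub_eq_neg_add, Real.exp_add]
        ring

end Noise

/-! ### Deterministic bounds for the soft threshold. -/

section SoftThreshold

theorem abs_softThreshold {l : ℝ} (hl : 0 ≤ l) (y : ℝ) :
    |softThreshold l y| = max (|y| - l) 0 := by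
  rw [softThreshold, abs_mul, abs_of_nonneg (le_max_right (|y| - l) 0)]
  rcases eq_or_ne y 0 with rfl | hy
  · simp [hl]
  · rcases Real.sign_apply_eq_of_ne_zero y hy with h | h <;> simp [h]

theorem abs_softThreshold_sub_self_le {l : ℝ} (hl : 0 ≤ l) (y : ℝ) :
    |softThreshold l y - y| ≤ l := by
  rw [softThreshold]
  rcases lt_trichotomy y 0 with h | h | h
  · rw [Real.sign_of_neg h, abs_of_neg h, abs_le]
    rcases max_cases (-y - l) 0 with ⟨h1, h2⟩ | ⟨h1, h2⟩ <;> rw [h1] <;> constructor <;> linarith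
  · simp [h, hl]
  · rw [Real.sign_of_pos h, abs_of_pos h, abs_le]
    rcases max_cases (y - l) 0 with ⟨h1, h2⟩ | ⟨h1, h2⟩ <;> rw [h1] <;> constructor <;> linarith

/-- The bound for coarse levels: it does not depend on the size of `θ`. -/
theorem abs_softThreshold_add_sub_le {l : ℝ} (hl : 0 ≤ l) (θ z : ℝ) :
    |softThreshold l (θ + z) - θ| ≤ l + |z| := by
  have h1 := abs_softThreshold_sub_self_le hl (θ + z)
  calc |softThreshold l (θ + z) - θ| = |(softThreshold l (θ + z) - (θ + z)) + z| := by ring_nf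
    _ ≤ _ := (abs_add_le _ _).trans (by linarith)

/-- The bound for fine levels: noise enters only through its excess over the threshold, so small
coefficients cost little. -/
theorem abs_softThreshold_add_sub_le' {l : ℝ} (hl : 0 ≤ l) (θ z : ℝ) :
    |softThreshold l (θ + z) - θ| ≤ 2 * |θ| + max (|z| - l) 0 := by
  have h1 := abs_softThreshold hl (θ + z)
  have h2 := abs_add_le θ z
  have h3 : max (|θ + z| - l) 0 ≤ |θ| + max (|z| - l) 0 :=
    max_le (by linarith [le_max_left (|z| - l) 0])
      (add_nonneg (abs_nonneg _) (le_max_right _ _))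
  linarith [abs_sub (softThreshold l (θ + z)) θ]

theorem measurable_softThreshold (l : ℝ) : Measurable (softThreshold l) := by
  have h : Measurable Real.sign := by
    unfold Real.sign
    exact Measurable.ite measurableSet_Iio measurable_const
      (Measurable.ite measurableSet_Ioi measurable_const measurable_const)
  unfold softThreshold
  fun_prop

end SoftThreshold

end SIET

namespace SIET

/-! ### Absolute continuity of the noise law. -/

section AbsoluteContinuity

theorem pi_mono {ι : Type*} [Fintype ι] {X : ι → Type*} [∀ i, MeasurableSpace (X i)]
    {μ ν : ∀ i, Measure (X i)} [∀ i, SigmaFinite (μ i)] [∀ i, SigmaFinite (ν i)]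
    (h : ∀ i, μ i ≤ ν i) : Measure.pi μ ≤ Measure.pi ν := by
  have h1 : (Measure.pi μ).toOuterMeasure ≤ OuterMeasure.pi fun i => (ν i).toOuterMeasure := by
    rw [OuterMeasure.le_pi]
    intro s _
    change Measure.pi μ (univ.pi s) ≤ ∏ i, ν i (s i)
    rw [Measure.pi_pi]
    exact Finset.prod_le_prod' fun i _ => h i (s i)
  refine Measure.le_iff.2 fun s hs => (h1 s).trans_eq ?_
  rw [Measure.pi, toMeasure_apply _ _ hs]

theorem pi_smul_volume {ι : Type*} [Fintype ι] (C : ℝ≥0) :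
    (Measure.pi fun _ : ι => C • (volume : Measure ℝ)) =
      (C ^ Fintype.card ι : ℝ≥0) • (volume : Measure (ι → ℝ)) := by
  refine Measure.pi_eq fun s _ => ?_
  rw [Measure.smul_apply, volume_pi_pi]
  simp only [Measure.smul_apply, ENNReal.smul_def, smul_eq_mul]
  rw [Finset.prod_mul_distrib, Finset.prod_const, Finset.card_univ, ENNReal.coe_pow]

theorem gaussianReal_le_smul_volume {v : ℝ≥0} (hv : v ≠ 0) :
    gaussianReal 0 v ≤ (Real.toNNReal (√(2 * Real.pi * v))⁻¹) • (volume : Measure ℝ) := by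
  rw [gaussianReal_of_var_ne_zero 0 hv]
  refine (withDensity_mono (g := fun _ => ENNReal.ofReal (√(2 * Real.pi * v))⁻¹)
    (.of_forall fun x => ?_)).trans_eq ?_
  · refine ENNReal.ofReal_le_ofReal ?_
    rw [gaussianPDFReal]
    refine mul_le_of_le_one_right (by positivity) (Real.exp_le_one_iff.2 ?_)
    rw [neg_div]
    exact neg_nonpos.2 (by positivity)
  · rw [withDensity_const]
    rfl

/-- Gaussian densities are bounded, so the product law is dominated by a multiple of Lebesgue
measure. Null-measurability for Lebesgue measure then passes to the noise law. -/
theorem noiseLaw_absolutelyContinuous {σ : ℝ≥0} (hσ : 0 < σ) (J : ℕ) :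
    noiseLaw σ J ≪ volume := by
  set C := Real.toNNReal (√(2 * Real.pi * (σ ^ 2 : ℝ≥0)))⁻¹
  have h1 : noiseLaw σ J ≤ Measure.pi fun _ : Fin (2 ^ J) => C • (volume : Measure ℝ) :=
    pi_mono fun _ => gaussianReal_le_smul_volume (by positivity)
  rw [pi_smul_volume] at h1
  exact (Measure.absolutelyContinuous_of_le h1).trans Measure.smul_absolutelyContinuous

instance isProbabilityMeasure_noiseLaw (σ : ℝ≥0) (J : ℕ) : IsProbabilityMeasure (noiseLaw σ J) := by
  unfold noiseLaw
  infer_instance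

end AbsoluteContinuity

/-! ### Measurability of the perturbed capacity and integrability of the loss. -/

section Measurability

variable {𝒴 : Type*} [MeasurableSpace 𝒴] {ι E : Type*} [Fintype ι]

/-- The affine branch of the soft threshold on the region where the sign of its value is `s`. -/
def softBranch (s : SignType) (l y : ℝ) : ℝ := s * (s * y - l)

/-- The sign of the soft-thresholded value. -/
noncomputable def softSign (l y : ℝ) : SignType := SignType.sign (softThreshold l y)

theorem softThreshold_eq_softBranch (l y : ℝ) :
    softThreshold l y = softBranch (softSign l y) l y := by
  rw [softSign, softBranch]
  rcases lt_trichotomy y 0 with h | h | h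
  · rw [softThreshold, Real.sign_of_neg h, abs_of_neg h]
    rcases le_or_gt (-y) l with h1 | h1
    · rw [max_eq_right (by linarith)]; simp
    · rw [max_eq_left (by linarith), sign_neg (by linarith)]; simp
  · subst h; simp [softThreshold]
  · rw [softThreshold, Real.sign_of_pos h, abs_of_pos h]
    rcases le_or_gt y l with h1 | h1
    · rw [max_eq_right (by linarith)]; simp
    · rw [max_eq_left (by linarith), sign_pos (by linarith)]; simp

theorem measurableSet_softSign_eq (l : ℝ) (s : SignType) :
    MeasurableSet {y | softSign l y = s} := by
  have h := measurable_softThreshold l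
  cases s
  · refine (congrArg MeasurableSet ?_).mp (h (measurableSet_singleton (0 : ℝ)))
    ext y
    exact sign_eq_zero_iff.symm
  · refine (congrArg MeasurableSet ?_).mp (h (measurableSet_Iio (a := (0 : ℝ))))
    ext y
    exact (sign_eq_neg_one_iff (a := softThreshold l y)).symm
  · refine (congrArg MeasurableSet ?_).mp (h (measurableSet_Ioi (a := (0 : ℝ))))
    ext y
    exact (sign_eq_one_iff (a := softThreshold l y)).symm

theorem energy_sum {cmax : ℝ} {p : ℝ → ℝ} (hp : Admissible cmax p) {e : ι → ℝ → ℝ}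
    (he : ∀ i, IntegrableOn (e i) (Icc 0 1)) (a : ι → ℝ) :
    energy (fun t => ∑ i, a i * e i t) p = ∑ i, a i * energy (e i) p := by
  simp only [energy_eq, Finset.mul_sum]
  rw [integral_finsetSum]
  · refine Finset.sum_congr rfl fun i _ => ?_
    rw [← integral_const_mul]
    congr 1
    ext x
    ring
  · intro i _
    have := (hp.integrable_mul (he i)).const_mul (a i)
    refine this.congr (.of_forall fun x => ?_)
    simp only
    ring

variable [NormedAddCommGroup E] [NormedSpace ℝ E] [FiniteDimensional ℝ E] [MeasurableSpace E]
  [BorelSpace E]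

/-- The capacity of a soft-thresholded expansion depends measurably on the data: on each of the
finitely many sign patterns of the thresholded coefficients its sublevel sets are convex. -/
theorem aemeasurable_capacityEnergy_softThreshold (W : Kernel unitInterval 𝒴) (cmax : ℝ)
    {e : ι → ℝ → ℝ} (he : ∀ i, IntegrableOn (e i) (Icc 0 1)) (l : ℝ)
    (c : ι → E → ℝ) (hc : ∀ i, Measurable (c i))
    (haff : ∀ i z w (a b : ℝ), a + b = 1 → c i (a • z + b • w) = a * c i z + b * c i w)
    (B : ℝ) (μ : Measure E) [μ.IsAddHaarMeasure] :
    AEMeasurable (fun z => capacityEnergy W cmax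
      (fun t => ∑ i, softThreshold l (c i z) * e i t) B) μ := by
  classical
  refine NullMeasurable.aemeasurable ?_
  refine @measurable_of_Iic ENNReal (NullMeasurableSpace E μ) _ _ _ _ _ _ _ _ fun r => ?_
  change NullMeasurableSet {z | _ ≤ r} μ
  -- The capacity is at most `r` exactly when every input with information above `r` misses the
  -- energy `B`. With the signs fixed the energy is affine in `z`, so `S π` is an intersection,
  -- possibly uncountable, of half-spaces or trivial sets: convex, though not evidently measurable.
  set S : (ι → SignType) → Set E := fun π => {z | ∀ p, Admissible cmax p → r < mutualInfo W p →
    ∑ i, softBranch (π i) l (c i z) * energy (e i) p < B}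
  have hS : ∀ π, Convex ℝ (S π) := by
    intro π z hz w hw a b ha hb hab p hp hpr
    have h1 := hz p hp hpr
    have h2 := hw p hp hpr
    have h3 : ∑ i, softBranch (π i) l (c i (a • z + b • w)) * energy (e i) p =
        a * ∑ i, softBranch (π i) l (c i z) * energy (e i) p +
          b * ∑ i, softBranch (π i) l (c i w) * energy (e i) p := by
      rw [Finset.mul_sum, Finset.mul_sum, ← Finset.sum_add_distrib]
      refine Finset.sum_congr rfl fun i _ => ?_
      rw [haff i z w a b hab, softBranch, softBranch, softBranch]
      linear_combination ((π i : ℝ) * l * energy (e i) p) * hab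
    rw [h3]
    have hBab : B = a * B + b * B := by rw [← add_mul, hab, one_mul]
    rcases ha.eq_or_lt with h0 | h0
    · have hb1 : b = 1 := by linarith
      rw [← h0, hb1]; linarith
    · have := mul_lt_mul_of_pos_left h1 h0
      have := mul_le_mul_of_nonneg_left h2.le hb
      linarith
  have hset : {z | capacityEnergy W cmax (fun t => ∑ i, softThreshold l (c i z) * e i t) B ≤ r} =
      ⋃ π : ι → SignType, {z | ∀ i, softSign l (c i z) = π i} ∩ S π := by
    ext z
    have hiff : capacityEnergy W cmax (fun t => ∑ i, softThreshold l (c i z) * e i t) B ≤ r ↔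
        z ∈ S fun i => softSign l (c i z) := by
      simp only [capacityEnergy, iSup_le_iff, S, mem_ofPred_eq]
      refine forall₂_congr fun p hp => ?_
      rw [energy_sum hp he]
      simp_rw [softThreshold_eq_softBranch]
      constructor
      · intro h hlt
        by_contra hcon
        exact hlt.not_ge (h (not_lt.1 hcon))
      · intro h hB
        by_contra hcon
        exact (h (not_le.1 hcon)).not_ge hB
    rw [mem_ofPred_eq, hiff, mem_iUnion]
    constructor
    · exact fun h => ⟨_, fun i => rfl, h⟩
    · rintro ⟨π, h1, h2⟩
      have : (fun i => softSign l (c i z)) = π := funext h1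
      rwa [this]
  rw [hset]
  -- Convex sets in finite dimension are null-measurable for Haar measure, and there are finitely
  -- many sign patterns.
  refine NullMeasurableSet.iUnion fun π => NullMeasurableSet.inter ?_ ((hS π).nullMeasurableSet μ)
  refine MeasurableSet.nullMeasurableSet ?_
  rw [ofPred_forall]
  exact MeasurableSet.iInter fun i =>
    hc i (measurableSet_softSign_eq l (π i))

end Measurability

section InfoLoss

variable {φ ψ : ℝ → ℝ} {A : ℝ}

/-- The indices `(j,k)`, `0 ≤ j < J`, `0 ≤ k < 2^j`, together with `none` for the scaling
function. -/
abbrev WaveletIndex (J : ℕ) : Type :=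
  Option ((Finset.range J).sigma fun j => Finset.range (2 ^ j))

/-- The periodized wavelet basis up to resolution `J`. -/
noncomputable def periodizedBasis (φ ψ : ℝ → ℝ) (J : ℕ) : WaveletIndex J → ℝ → ℝ
  | none => periodize φ
  | some p => periodize (dilate ψ p.1.1 p.1.2)

theorem waveletReconstruction_eq_sum (φ ψ : ℝ → ℝ) (σ : ℝ) (J : ℕ) (y : Fin (2 ^ J) → ℝ) (t : ℝ) :
    waveletReconstruction φ ψ σ J y t = ∑ i : WaveletIndex J,
      softThreshold (threshold σ J) (empiricalCoeff J y (periodizedBasis φ ψ J i)) *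
        periodizedBasis φ ψ J i t := by
  rw [waveletReconstruction, Fintype.sum_option, Finset.sum_sigma', ← Finset.sum_coe_sort]
  rfl

theorem memLp_periodizedBasis (hw : IsCompactWavelet φ ψ) (hφA : ∀ x, A < |x| → φ x = 0)
    (hψA : ∀ x, A < |x| → ψ x = 0) (J : ℕ) (i : WaveletIndex J) :
    MemLp (periodizedBasis φ ψ J i) 2 (volume.restrict (Icc 0 1)) := by
  cases i with
  | none => exact memLp_periodize hφA hw.memLp_scaling
  | some p =>
    exact memLp_periodize (fun x hx => dilate_eq_zero_of_lt_abs hψA p.1.1 p.1.2 hx)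
      (memLp_dilate hw.memLp_mother _ _)

theorem integrableOn_waveletReconstruction (hw : IsCompactWavelet φ ψ)
    (hφA : ∀ x, A < |x| → φ x = 0) (hψA : ∀ x, A < |x| → ψ x = 0) (σ : ℝ) (J : ℕ)
    (y : Fin (2 ^ J) → ℝ) : IntegrableOn (waveletReconstruction φ ψ σ J y) (Icc 0 1) := by
  rw [show waveletReconstruction φ ψ σ J y = fun t => _ from
    funext (waveletReconstruction_eq_sum φ ψ σ J y)]
  exact integrable_finsetSum _ fun i _ =>
    ((memLp_periodizedBasis hw hφA hψA J i).integrable (by norm_num)).const_mul _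

theorem empiricalCoeff_add {J : ℕ} {g : ℝ → ℝ} (hg : IntegrableOn g (Icc 0 1))
    (y z : Fin (2 ^ J) → ℝ) :
    empiricalCoeff J (fun i => y i + z i) g = empiricalCoeff J y g + empiricalCoeff J z g := by
  rw [empiricalCoeff_eq_sum _ hg, empiricalCoeff_eq_sum _ hg, empiricalCoeff_eq_sum _ hg,
    ← Finset.sum_add_distrib]
  exact Finset.sum_congr rfl fun i _ => add_mul _ _ _

theorem measurable_empiricalCoeff {J : ℕ} {g : ℝ → ℝ} (hg : IntegrableOn g (Icc 0 1)) :
    Measurable fun z => empiricalCoeff J z g := by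
  simp_rw [empiricalCoeff_eq_sum _ hg]
  fun_prop

theorem integrable_infoLoss {𝒴 : Type*} [MeasurableSpace 𝒴] {W : Kernel unitInterval 𝒴} {cmax : ℝ}
    (hcap : maxCapacity W cmax ≠ ⊤) (hw : IsCompactWavelet φ ψ)
    (hφA : ∀ x, A < |x| → φ x = 0) (hψA : ∀ x, A < |x| → ψ x = 0) {σ : ℝ≥0} (hσ : 0 < σ)
    (β : ℝ → ℝ) (J : ℕ) (x : Fin (2 ^ J) → ℝ) (B : ℝ) :
    Integrable (infoLoss W cmax φ ψ σ β J x B) (noiseLaw σ J) := by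
  have hg : ∀ i, IntegrableOn (periodizedBasis φ ψ J i) (Icc 0 1) := fun i =>
    (memLp_periodizedBasis hw hφA hψA J i).integrable (by norm_num)
  have h := aemeasurable_capacityEnergy_softThreshold W cmax hg (threshold σ J)
    (fun i z => empiricalCoeff J (fun k => β (x k) + z k) (periodizedBasis φ ψ J i))
    (fun i => by
      simp_rw [empiricalCoeff_add (hg i)]
      exact (measurable_empiricalCoeff (hg i)).const_add _)
    (fun i z w a b hab => by
      rw [empiricalCoeff_eq_sum _ (hg i), empiricalCoeff_eq_sum _ (hg i),
        empiricalCoeff_eq_sum _ (hg i), Finset.mul_sum, Finset.mul_sum, ← Finset.sum_add_distrib]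
      refine Finset.sum_congr rfl fun k _ => ?_
      simp only [Pi.add_apply, Pi.smul_apply, smul_eq_mul]
      linear_combination (β (x k) * ∫ t in cell J k, periodizedBasis φ ψ J i t) * -hab)
    B (volume : Measure (Fin (2 ^ J) → ℝ))
  have hm : AEMeasurable (infoLoss W cmax φ ψ σ β J x B) (noiseLaw σ J) := by
    have h1 : AEMeasurable (fun z : Fin (2 ^ J) → ℝ => capacityEnergy W cmax
        (waveletReconstruction φ ψ σ J fun i => β (x i) + z i) B) volume := by
      refine h.congr (.of_forall fun z => ?_)
      simp only
      congr 1
      ext t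
      exact (waveletReconstruction_eq_sum ..).symm
    have h2 := (h1.mono_ac (noiseLaw_absolutelyContinuous hσ J)).ennreal_toReal
    have h3 := (h2.const_sub (capacityEnergyReal W cmax β B)).norm
    exact h3
  refine (integrable_const (maxCapacity W cmax).toReal).mono' hm.aestronglyMeasurable
    (.of_forall fun z => ?_)
  rw [infoLoss, Real.norm_eq_abs, abs_abs]
  exact abs_capacityEnergyReal_sub_le hcap _ _ _

end InfoLoss

end SIET

namespace SIET

/-! ### The risk of one thresholded coefficient. -/

section Risk

variable {J : ℕ} {g : ℝ → ℝ} {σ : ℝ≥0}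

theorem threshold_nonneg (σ : ℝ) (J : ℕ) : 0 ≤ threshold σ J := Real.sqrt_nonneg _

/-- This amounts to `2 log (2^J) ≥ 1`, true from `J = 1` on; at `J = 0` the threshold vanishes. -/
theorem noiseLevel_le_threshold (σ : ℝ≥0) (hJ : 1 ≤ J) :
    (σ : ℝ) / √(2 ^ J) ≤ threshold σ J := by
  refine Real.le_sqrt_of_sq_le ?_
  rw [div_pow, Real.sq_sqrt (by positivity), Real.log_pow]
  have h1 : (1 : ℝ) ≤ J := by exact_mod_cast hJ
  have h2 : (1 : ℝ) ≤ 2 * (J * Real.log 2) := by nlinarith [Real.log_two_gt_d9]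
  have h3 : 0 ≤ (σ : ℝ) ^ 2 / 2 ^ J := by positivity
  nlinarith

/-- The `L¹` risk of a soft-thresholded coefficient. -/
theorem risk_softThreshold (hσ : 0 < σ) (hJ : 1 ≤ J) (hg : MemLp g 2 (volume.restrict (Icc 0 1)))
    (hg1 : ∫ t in (0 : ℝ)..1, g t * g t = 1) (θ : ℝ) :
    Integrable (fun z => |softThreshold (threshold σ J) (θ + empiricalCoeff J z g) - θ|)
      (noiseLaw σ J) ∧
    ∫ z, |softThreshold (threshold σ J) (θ + empiricalCoeff J z g) - θ| ∂(noiseLaw σ J) ≤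
      5 * threshold σ J ∧
    ∫ z, |softThreshold (threshold σ J) (θ + empiricalCoeff J z g) - θ| ∂(noiseLaw σ J) ≤
      2 * |θ| + 2 * threshold σ J / 2 ^ J := by
  set l := threshold σ J with hl
  set s := (σ : ℝ) / √(2 ^ J) with hs
  set Z := fun z : Fin (2 ^ J) → ℝ => empiricalCoeff J z g
  have hl0 : 0 ≤ l := threshold_nonneg _ _
  have hs0 : 0 < s := by positivity
  have hsl : s ≤ l := noiseLevel_le_threshold σ hJ
  have hZ : SubGaussian Z s (noiseLaw σ J) := subGaussian_empiricalCoeff σ J hg hg1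
  have hZm : Measurable Z := measurable_empiricalCoeff (hg.integrable (by norm_num))
  -- The choice `t = 1/s` gives `E|Z| ≤ 2 s e^{1/2} ≤ 4 s`, hence the constant `5` since `s ≤ l`.
  obtain ⟨i0, e0⟩ := hZ.integral_max_abs_sub_le hZm.aemeasurable 0 (inv_pos.2 hs0)
  -- The choice `t = l/s²` minimizes the exponent, whose value is then `-l²/(2s²) = -log m`: the
  -- threshold is calibrated to give the factor `1/m`.
  obtain ⟨i1, e1⟩ := hZ.integral_max_abs_sub_le hZm.aemeasurable l
    (t := l / s ^ 2) (div_pos (hs0.trans_le hsl) (by positivity))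
  have hmax : ∀ z, max (|Z z| - 0) 0 = |Z z| := fun z => by
    rw [sub_zero, max_eq_left (abs_nonneg _)]
  simp_rw [hmax] at i0 e0
  have i0' : Integrable (fun z => l + |Z z|) (noiseLaw σ J) := (integrable_const l).add i0
  have i1' : Integrable (fun z => 2 * |θ| + max (|Z z| - l) 0) (noiseLaw σ J) :=
    (integrable_const _).add i1
  have hint : Integrable (fun z => |softThreshold l (θ + Z z) - θ|) (noiseLaw σ J) := by
    refine i0'.mono' ?_ (.of_forall fun z => ?_)
    · exact ((((measurable_softThreshold l).comp (hZm.const_add θ)).sub_const θ).norm).aestronglyMeasurable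
    · rw [Real.norm_eq_abs, abs_abs]
      exact abs_softThreshold_add_sub_le hl0 θ (Z z)
  refine ⟨hint, ?_, ?_⟩
  · have h1 : ∫ z, |softThreshold l (θ + Z z) - θ| ∂(noiseLaw σ J) ≤
        ∫ z, (l + |Z z|) ∂(noiseLaw σ J) :=
      integral_mono hint i0' fun z => abs_softThreshold_add_sub_le hl0 θ (Z z)
    rw [integral_add (integrable_const l) i0, integral_const, probReal_univ, one_smul] at h1
    have h2 : s⁻¹ ^ 2 * s ^ 2 / 2 - s⁻¹ * 0 = 1 / 2 := by
      field_simp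
      ring
    have h3 : Real.exp (1 / 2) ≤ 2 := by
      have h4 : Real.exp (1 / 2) * Real.exp (1 / 2) = Real.exp 1 := by
        rw [← Real.exp_add]; norm_num
      nlinarith [Real.exp_one_lt_d9, Real.exp_pos (1 / 2 : ℝ)]
    rw [h2, div_inv_eq_mul] at e0
    have h5 : 2 * s * Real.exp (1 / 2) ≤ 2 * s * 2 := by gcongr
    linarith
  · have h1 : ∫ z, |softThreshold l (θ + Z z) - θ| ∂(noiseLaw σ J) ≤
        ∫ z, (2 * |θ| + max (|Z z| - l) 0) ∂(noiseLaw σ J) :=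
      integral_mono hint i1' fun z => abs_softThreshold_add_sub_le' hl0 θ (Z z)
    rw [integral_add (integrable_const _) i1, integral_const, probReal_univ, one_smul] at h1
    have hl2 : l ^ 2 = 2 * s ^ 2 * Real.log (2 ^ J) := by
      rw [hl, threshold, Real.sq_sqrt, hs, div_pow, Real.sq_sqrt (by positivity)]
      exact mul_nonneg (by positivity) (Real.log_nonneg (one_le_pow₀ one_le_two))
    have h2 : (l / s ^ 2) ^ 2 * s ^ 2 / 2 - l / s ^ 2 * l = -Real.log (2 ^ J) := by
      field_simp
      rw [hl2]
      ring
    rw [h2, Real.exp_neg, Real.exp_log (by positivity)] at e1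
    have h3 : 2 / (l / s ^ 2) ≤ 2 * l := by
      have hlp := hs0.trans_le hsl
      rw [div_div_eq_mul_div, div_le_iff₀ hlp]
      nlinarith
    have h4 : 2 / (l / s ^ 2) * ((2 : ℝ) ^ J)⁻¹ ≤ 2 * l / 2 ^ J := by
      rw [div_eq_mul_inv (2 * l)]
      gcongr
    linarith

end Risk

/-! ### Geometric sums over the levels and the rate. -/

section Rates

theorem sum_sqrt_two_pow_le (n : ℕ) :
    ∑ j ∈ Finset.range n, (2 : ℝ) ^ ((j : ℝ) / 2) ≤ 3 * (2 : ℝ) ^ ((n : ℝ) / 2) := by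
  induction n with
  | zero => simp
  | succ n ih =>
    rw [Finset.sum_range_succ]
    have h1 : (2 : ℝ) ^ (((n + 1 : ℕ) : ℝ) / 2) = (2 : ℝ) ^ ((n : ℝ) / 2) * √2 := by
      rw [Real.sqrt_eq_rpow, ← Real.rpow_add two_pos]
      push_cast
      ring_nf
    -- The induction with constant `3` needs `3 + 1 ≤ 3√2`.
    have h2 : (4 : ℝ) / 3 ≤ √2 := Real.le_sqrt_of_sq_le (by norm_num)
    have h3 : (0 : ℝ) < (2 : ℝ) ^ ((n : ℝ) / 2) := by positivity
    rw [h1]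
    nlinarith

/-- The sum over the resolutions of the smaller of an increasing and a decreasing geometric
bound. -/
theorem sum_le_of_le_of_le {ρ : ℕ → ℝ} {a b r : ℝ} (ha : 0 ≤ a) (hb : 0 ≤ b) (hr : 0 ≤ r) {J n : ℕ}
    (hn : n ≤ J) (h1 : ∀ j < J, ρ j ≤ a * (2 : ℝ) ^ ((j : ℝ) / 2))
    (h2 : ∀ j < J, ρ j ≤ b * (1 / 2) ^ j + r * (2 : ℝ) ^ ((j : ℝ) / 2)) :
    ∑ j ∈ Finset.range J, ρ j ≤ 3 * a * (2 : ℝ) ^ ((n : ℝ) / 2) + 2 * b * (1 / 2) ^ n +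
      3 * r * (2 : ℝ) ^ ((J : ℝ) / 2) := by
  obtain ⟨d, rfl⟩ := Nat.exists_eq_add_of_le hn
  rw [Finset.sum_range_add]
  have e1 : ∑ j ∈ Finset.range n, ρ j ≤ 3 * a * (2 : ℝ) ^ ((n : ℝ) / 2) := by
    calc ∑ j ∈ Finset.range n, ρ j ≤ ∑ j ∈ Finset.range n, a * (2 : ℝ) ^ ((j : ℝ) / 2) :=
          Finset.sum_le_sum fun j hj => h1 j (by rw [Finset.mem_range] at hj; omega)
      _ = a * ∑ j ∈ Finset.range n, (2 : ℝ) ^ ((j : ℝ) / 2) := by rw [Finset.mul_sum]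
      _ ≤ a * (3 * (2 : ℝ) ^ ((n : ℝ) / 2)) := by
          gcongr
          exact sum_sqrt_two_pow_le n
      _ = _ := by ring
  have e2 : ∑ j ∈ Finset.range d, ρ (n + j) ≤ 2 * b * (1 / 2) ^ n +
      3 * r * (2 : ℝ) ^ (((n + d : ℕ) : ℝ) / 2) := by
    calc ∑ j ∈ Finset.range d, ρ (n + j)
        ≤ ∑ j ∈ Finset.range d, (b * (1 / 2) ^ n * (1 / 2) ^ j +
            r * (2 : ℝ) ^ (((n + j : ℕ) : ℝ) / 2)) :=
          Finset.sum_le_sum fun j hj => (h2 (n + j) (by rw [Finset.mem_range] at hj; omega)).trans_eq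
            (by rw [pow_add, mul_assoc])
      _ = b * (1 / 2) ^ n * ∑ j ∈ Finset.range d, (1 / 2 : ℝ) ^ j +
            r * ∑ j ∈ Finset.range d, (2 : ℝ) ^ (((n + j : ℕ) : ℝ) / 2) := by
          rw [Finset.sum_add_distrib, Finset.mul_sum, Finset.mul_sum]
      _ ≤ b * (1 / 2) ^ n * 2 + r * (3 * (2 : ℝ) ^ (((n + d : ℕ) : ℝ) / 2)) := by
          have h3 := sum_sqrt_two_pow_le (n + d)
          rw [Finset.sum_range_add] at h3
          have h4 : 0 ≤ ∑ j ∈ Finset.range n, (2 : ℝ) ^ ((j : ℝ) / 2) :=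
            Finset.sum_nonneg fun j _ => by positivity
          gcongr
          · exact sum_geometric_two_le d
          · linarith
      _ = _ := by ring
  linarith

/-- The rate `m^{-1/3} (log m)^{1/2}`, `m = 2^J`. -/
noncomputable def rate (J : ℕ) : ℝ :=
  ((2 : ℝ) ^ J) ^ (-(1 / 3) : ℝ) * Real.log ((2 : ℝ) ^ J) ^ (1 / 2 : ℝ)

theorem log_two_pow_pos {J : ℕ} (hJ : 1 ≤ J) : 0 < Real.log ((2 : ℝ) ^ J) :=
  Real.log_pos (one_lt_pow₀ one_lt_two (by omega))

theorem rate_pos {J : ℕ} (hJ : 1 ≤ J) : 0 < rate J := by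
  have := log_two_pow_pos hJ
  unfold rate
  positivity

theorem rpow_neg_third_le_rate {J : ℕ} (hJ : 1 ≤ J) :
    ((2 : ℝ) ^ J) ^ (-(1 / 3) : ℝ) ≤ 2 * rate J := by
  have h1 : (1 : ℝ) ≤ J := by exact_mod_cast hJ
  have h2 : (1 / 4 : ℝ) ≤ Real.log ((2 : ℝ) ^ J) := by
    rw [Real.log_pow]
    have h3 := mul_le_mul_of_nonneg_right h1 (Real.log_nonneg one_le_two)
    linarith [Real.log_two_gt_d9]
  have h3 : (1 / 2 : ℝ) ≤ Real.log ((2 : ℝ) ^ J) ^ (1 / 2 : ℝ) := by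
    rw [← Real.sqrt_eq_rpow]
    exact Real.le_sqrt_of_sq_le (le_trans (by norm_num) h2)
  have h4 : (0 : ℝ) < ((2 : ℝ) ^ J) ^ (-(1 / 3) : ℝ) := by positivity
  unfold rate
  nlinarith

theorem inv_two_pow_le_rate {J : ℕ} (hJ : 1 ≤ J) : 1 / (2 : ℝ) ^ J ≤ 2 * rate J := by
  refine le_trans ?_ (rpow_neg_third_le_rate hJ)
  rw [one_div, ← Real.rpow_neg_one]
  exact Real.rpow_le_rpow_of_exponent_le (one_le_pow₀ one_le_two) (by norm_num)

theorem half_pow_le_rate {J : ℕ} (hJ : 1 ≤ J) : (1 / 2 : ℝ) ^ (J / 3) ≤ 4 * rate J := by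
  have h1 : (1 / 2 : ℝ) ^ (J / 3) ≤ 2 * ((2 : ℝ) ^ J) ^ (-(1 / 3) : ℝ) := by
    have h2 : (J : ℝ) ≤ 3 * ((J / 3 : ℕ) : ℝ) + 3 := by
      exact_mod_cast (by omega : J ≤ 3 * (J / 3) + 3)
    rw [one_div, inv_pow, ← Real.rpow_natCast, ← Real.rpow_neg two_pos.le, ← Real.rpow_natCast 2 J,
      ← Real.rpow_mul two_pos.le]
    calc (2 : ℝ) ^ (-((J / 3 : ℕ) : ℝ)) ≤ (2 : ℝ) ^ (1 + (J : ℝ) * -(1 / 3)) :=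
          Real.rpow_le_rpow_of_exponent_le one_le_two (by linarith)
      _ = _ := by rw [Real.rpow_add two_pos, Real.rpow_one]
  linarith [rpow_neg_third_le_rate hJ]

theorem threshold_eq (σ : ℝ≥0) {J : ℕ} :
    threshold σ J = σ * √2 * (((2 : ℝ) ^ J) ^ (-(1 / 2) : ℝ) *
      Real.log ((2 : ℝ) ^ J) ^ (1 / 2 : ℝ)) := by
  rw [threshold, Real.rpow_neg (by positivity), ← Real.sqrt_eq_rpow, ← Real.sqrt_eq_rpow,
    Real.sqrt_mul (by positivity), Real.sqrt_mul (by positivity), Real.sqrt_div (by positivity),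
    Real.sqrt_sq σ.coe_nonneg]
  field_simp

/-- The cost of the coarse levels: `m^{-1/2} · 2^{J/6} = m^{-1/3}`. Rounding `J/3` down helps here;
in `half_pow_le_rate` it costs a factor `2`. -/
theorem threshold_mul_le_rate (σ : ℝ≥0) (J : ℕ) :
    threshold σ J * (2 : ℝ) ^ (((J / 3 : ℕ) : ℝ) / 2) ≤ σ * √2 * rate J := by
  have h0 : 0 ≤ Real.log ((2 : ℝ) ^ J) ^ (1 / 2 : ℝ) :=
    Real.rpow_nonneg (Real.log_nonneg (one_le_pow₀ one_le_two)) _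
  have h1 : ((2 : ℝ) ^ J) ^ (-(1 / 2) : ℝ) * (2 : ℝ) ^ (((J / 3 : ℕ) : ℝ) / 2) ≤
      ((2 : ℝ) ^ J) ^ (-(1 / 3) : ℝ) := by
    have h2 : 3 * ((J / 3 : ℕ) : ℝ) ≤ J := by
      exact_mod_cast (by omega : 3 * (J / 3) ≤ J)
    rw [← Real.rpow_natCast 2 J, ← Real.rpow_mul two_pos.le, ← Real.rpow_mul two_pos.le,
      ← Real.rpow_add two_pos]
    exact Real.rpow_le_rpow_of_exponent_le one_le_two (by linarith)
  rw [threshold_eq, rate]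
  calc _ = σ * √2 * ((((2 : ℝ) ^ J) ^ (-(1 / 2) : ℝ) * (2 : ℝ) ^ (((J / 3 : ℕ) : ℝ) / 2)) *
        Real.log ((2 : ℝ) ^ J) ^ (1 / 2 : ℝ)) := by ring
    _ ≤ _ := by gcongr

theorem threshold_le_rate (σ : ℝ≥0) (J : ℕ) : threshold σ J ≤ σ * √2 * rate J := by
  refine le_trans ?_ (threshold_mul_le_rate σ J)
  exact le_mul_of_one_le_right (threshold_nonneg _ _)
    (Real.one_le_rpow one_le_two (by positivity))

theorem tendsto_rate : Tendsto rate atTop (𝓝 0) := by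
  have h1 : Tendsto (fun x : ℝ => x ^ (-(1 / 3) : ℝ) * Real.log x ^ (1 / 2 : ℝ)) atTop (𝓝 0) := by
    have h := (isLittleO_log_rpow_rpow_atTop (1 / 2 : ℝ)
      (by norm_num : (0 : ℝ) < 1 / 3)).tendsto_div_nhds_zero
    refine h.congr' ?_
    filter_upwards [eventually_gt_atTop 0] with x hx
    rw [Real.rpow_neg hx.le]
    field_simp
  exact h1.comp (tendsto_pow_atTop_atTop_of_one_lt one_lt_two)

end Rates

end SIET

namespace SIET

/-! ### The periodic extension of the step function. -/

section PeriodicExtension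

variable {J : ℕ} {x : Fin (2 ^ J) → ℝ} {β : ℝ → ℝ} {K : ℝ}

/-- The 1-periodic extension of the step function through the samples. -/
noncomputable def periodicStep (J : ℕ) (y : Fin (2 ^ J) → ℝ) (t : ℝ) : ℝ :=
  stepFunction J y (Int.fract t)

theorem periodic_periodicStep (y : Fin (2 ^ J) → ℝ) : Function.Periodic (periodicStep J y) 1 :=
  fun t => by rw [periodicStep, periodicStep, Int.fract_add_one]

theorem measurable_periodicStep (y : Fin (2 ^ J) → ℝ) : Measurable (periodicStep J y) :=
  (measurable_stepFunction J y).comp measurable_fract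

theorem periodicStep_eq (y : Fin (2 ^ J) → ℝ) {t : ℝ} (ht : t ∈ Ico (0 : ℝ) 1) :
    periodicStep J y t = stepFunction J y t := by
  rw [periodicStep, Int.fract_eq_self.2 ht]

theorem abs_periodicStep_le (y : Fin (2 ^ J) → ℝ) (t : ℝ) : |periodicStep J y t| ≤ ∑ i, |y i| := by
  rw [periodicStep, stepFunction_eq y ⟨Int.fract_nonneg t, Int.fract_lt_one t⟩]
  exact Finset.single_le_sum (f := fun i => |y i|) (fun i _ => abs_nonneg _) (Finset.mem_univ _)

theorem integral_periodicStep_mul (y : Fin (2 ^ J) → ℝ) (g : ℝ → ℝ) :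
    ∫ t in (0 : ℝ)..1, periodicStep J y t * g t = empiricalCoeff J y g := by
  rw [empiricalCoeff, intervalIntegral.integral_of_le zero_le_one,
    intervalIntegral.integral_of_le zero_le_one, integral_Ioc_eq_integral_Ioo,
    integral_Ioc_eq_integral_Ioo]
  refine setIntegral_congr_fun measurableSet_Ioo fun t ht => ?_
  rw [periodicStep_eq y ⟨ht.1.le, ht.2⟩]

theorem ae_periodicStep_eq (y : Fin (2 ^ J) → ℝ) :
    ∀ᵐ t ∂(volume.restrict (Icc (0 : ℝ) 1)), periodicStep J y t = stepFunction J y t := by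
  rw [← restrict_Ico_eq_restrict_Icc]
  exact (ae_restrict_iff' measurableSet_Ico).2 (.of_forall fun t ht => periodicStep_eq y ht)

theorem abs_periodicStep_sub_le (hβ : β ∈ BV K)
    (hx : ∀ i : Fin (2 ^ J), x i ∈ Icc ((i.val : ℝ) / 2 ^ J) (((i.val : ℝ) + 1) / 2 ^ J))
    {s t : ℝ} (hst : s ≤ t) :
    |periodicStep J (fun i => β (x i)) t - periodicStep J (fun i => β (x i)) s| ≤
      periodicMajorant β (samplePoint J x) t - periodicMajorant β (samplePoint J x) s := by
  have hmem : ∀ r : ℝ, Int.fract r ∈ Ico (0 : ℝ) 1 := fun r =>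
    ⟨Int.fract_nonneg r, Int.fract_lt_one r⟩
  rw [periodicStep, periodicStep, stepFunction_comp_eq β (hmem t), stepFunction_comp_eq β (hmem s)]
  exact abs_sub_le_periodicMajorant hβ (monotoneOn_samplePoint hx)
    (fun t _ => samplePoint_mem hx t) hst

end PeriodicExtension

/-! ### The `L¹` reconstruction error, pathwise. -/

section ErrorBound

variable {φ ψ u : ℝ → ℝ} {A : ℕ}

theorem integral_abs_periodize_dilate_le (hu : Integrable u) (hA : ∀ x, (A : ℝ) < |x| → u x = 0)
    (j k : ℕ) : ∫ t in Icc (0 : ℝ) 1, |periodize (dilate u j k) t| ≤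
      (2 : ℝ) ^ (-((j : ℝ) / 2)) * ∫ t, |u t| := by
  refine (integral_abs_periodize_le (fun x hx => dilate_eq_zero_of_lt_abs hA j k hx) ?_).trans_eq ?_
  · exact memLp_one_iff_integrable.1 (memLp_dilate (memLp_one_iff_integrable.2 hu) j k)
  · rw [integral_abs_dilate, Int.cast_natCast]

theorem integrableOn_periodize_dilate (hu : Integrable u) (hA : ∀ x, (A : ℝ) < |x| → u x = 0)
    (j k : ℕ) : IntegrableOn (periodize (dilate u j k)) (Icc 0 1) :=
  (memLp_periodize (fun _ hx => dilate_eq_zero_of_lt_abs hA j k hx)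
    (memLp_dilate (memLp_one_iff_integrable.2 hu) j k)).integrable le_rfl

theorem integral_abs_sum_periodize_le (hu : Integrable u) (hA : ∀ x, (A : ℝ) < |x| → u x = 0)
    (j : ℕ) (a : ℕ → ℝ) :
    ∫ t in Icc (0 : ℝ) 1, |∑ k ∈ Finset.range (2 ^ j), a k * periodize (dilate u j k) t| ≤
      (∑ k ∈ Finset.range (2 ^ j), |a k|) * ((2 : ℝ) ^ (-((j : ℝ) / 2)) * ∫ t, |u t|) := by
  have hi := integrableOn_periodize_dilate hu hA j
  calc _ ≤ ∫ t in Icc (0 : ℝ) 1, ∑ k ∈ Finset.range (2 ^ j),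
        |a k| * |periodize (dilate u j k) t| := by
        refine integral_mono (integrable_finsetSum _ fun k _ => (hi k).const_mul _).abs
          (integrable_finsetSum _ fun k _ => (hi k).abs.const_mul _) fun t => ?_
        refine (Finset.abs_sum_le_sum_abs _ _).trans_eq ?_
        exact Finset.sum_congr rfl fun k _ => abs_mul _ _
    _ = ∑ k ∈ Finset.range (2 ^ j), |a k| * ∫ t in Icc (0 : ℝ) 1, |periodize (dilate u j k) t| := by
        rw [integral_finsetSum _ fun k _ => (hi k).abs.const_mul _]
        simp_rw [integral_const_mul]
    _ ≤ ∑ k ∈ Finset.range (2 ^ j), |a k| * ((2 : ℝ) ^ (-((j : ℝ) / 2)) * ∫ t, |u t|) := by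
        gcongr with k hk
        exact integral_abs_periodize_dilate_le hu hA j k
    _ = _ := by rw [Finset.sum_mul]

theorem two_rpow_neg_half_mul_self (j : ℕ) :
    (2 : ℝ) ^ (-((j : ℝ) / 2)) * (2 : ℝ) ^ (-((j : ℝ) / 2)) = (1 / 2) ^ j := by
  rw [← Real.rpow_add two_pos, ← neg_add, add_halves, Real.rpow_neg two_pos.le, Real.rpow_natCast,
    one_div, inv_pow]

variable {σ : ℝ≥0} {K : ℝ} {β : ℝ → ℝ}

/-- The `L¹` reconstruction error is at most the coefficientwise thresholding errors plus
deterministic approximation errors. -/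
theorem integral_abs_sub_waveletReconstruction_le (hw : IsCompactWavelet φ ψ)
    (hφA : ∀ x, (A : ℝ) < |x| → φ x = 0) (hψA : ∀ x, (A : ℝ) < |x| → ψ x = 0)
    (hφ1 : Integrable φ) (hψ1 : Integrable ψ) (hβ : β ∈ BV K) {J : ℕ} {x : Fin (2 ^ J) → ℝ}
    (hx : ∀ i : Fin (2 ^ J), x i ∈ Icc ((i.val : ℝ) / 2 ^ J) (((i.val : ℝ) + 1) / 2 ^ J))
    {D : ℝ} (hD : ∀ j : ℕ, ∑ k ∈ Finset.range (2 ^ j),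
      |empiricalCoeff J (fun i => β (x i)) (periodize (dilate ψ j k))| ≤
        D * (2 : ℝ) ^ (-((j : ℝ) / 2))) (y : Fin (2 ^ J) → ℝ) :
    ∫ t in Icc (0 : ℝ) 1, |β t - waveletReconstruction φ ψ σ J y t| ≤
      (cumVariation β 1 + 2 * (D * ∫ t, |ψ t|)) * (1 / 2) ^ J +
      |softThreshold (threshold σ J) (empiricalCoeff J y (periodize φ)) -
        empiricalCoeff J (fun i => β (x i)) (periodize φ)| * (∫ t, |φ t|) +
      ∑ j ∈ Finset.range J, (∑ k ∈ Finset.range (2 ^ j),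
        |softThreshold (threshold σ J) (empiricalCoeff J y (periodize (dilate ψ j k))) -
          empiricalCoeff J (fun i => β (x i)) (periodize (dilate ψ j k))|) *
            ((2 : ℝ) ^ (-((j : ℝ) / 2)) * ∫ t, |ψ t|) := by
  set f := periodicStep J fun i => β (x i) with hfdef
  set g := stepFunction J fun i => β (x i)
  have hfm : Measurable f := measurable_periodicStep _
  have hfM := abs_periodicStep_le fun i => β (x i)
  have hfper : Function.Periodic f 1 := periodic_periodicStep _
  have hlevel : ∀ (j : ℕ) t, levelSum ψ f j t = ∑ k ∈ Finset.range (2 ^ j),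
      empiricalCoeff J (fun i => β (x i)) (periodize (dilate ψ j k)) *
        periodize (dilate ψ j k) t := fun j t => by
    rw [levelSum_eq_sum_periodize hψ1 hψA hfm hfM hfper j t]
    simp_rw [hfdef, integral_periodicStep_mul]
  have hlevel0 : ∀ t, levelSum φ f 0 t =
      empiricalCoeff J (fun i => β (x i)) (periodize φ) * periodize φ t := fun t => by
    have h := levelSum_eq_sum_periodize hφ1 hφA hfm hfM hfper 0 t
    simp only [pow_zero, Finset.range_one, Finset.sum_singleton, Nat.cast_zero, dilate_zero_zero,
      hfdef, integral_periodicStep_mul] at h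
    exact h
  -- One factor `2^{-j/2}` comes from the `ℓ¹` norm of the coefficients, the other from the `L¹`
  -- norm of the wavelets.
  have hdet : ∀ j : ℕ, ∫ t in Icc (0 : ℝ) 1, |levelSum ψ f j t| ≤
      (D * ∫ t, |ψ t|) * (1 / 2) ^ j := fun j => by
    simp_rw [hlevel]
    refine (integral_abs_sum_periodize_le hψ1 hψA j _).trans ?_
    have h0 : 0 ≤ ∫ t, |ψ t| := integral_nonneg fun t => abs_nonneg _
    calc _ ≤ D * (2 : ℝ) ^ (-((j : ℝ) / 2)) * ((2 : ℝ) ^ (-((j : ℝ) / 2)) * ∫ t, |ψ t|) := by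
          gcongr
          exact hD j
      _ = _ := by rw [← two_rpow_neg_half_mul_self]; ring
  have htail := hw.integral_abs_sub_levelSum_le hφA hψA (Nat.cast_nonneg A) hfm hfM hdet J
  have hdisc := integral_abs_sub_stepFunction_le hβ hx
  set a₀ := softThreshold (threshold σ J) (empiricalCoeff J y (periodize φ)) -
    empiricalCoeff J (fun i => β (x i)) (periodize φ) with ha₀
  set a : ℕ → ℕ → ℝ := fun j k =>
    softThreshold (threshold σ J) (empiricalCoeff J y (periodize (dilate ψ j k))) -
      empiricalCoeff J (fun i => β (x i)) (periodize (dilate ψ j k)) with ha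
  have hptw : ∀ᵐ t ∂(volume.restrict (Icc (0 : ℝ) 1)),
      |β t - waveletReconstruction φ ψ σ J y t| ≤ ((|β t - g t| + |levelSum φ f J t - f t|) +
        |a₀ * periodize φ t|) + ∑ j ∈ Finset.range J,
          |∑ k ∈ Finset.range (2 ^ j), a j k * periodize (dilate ψ j k) t| := by
    filter_upwards [hw.levelSum_eq_sum hφA hψA hfm hfM J, ae_periodicStep_eq fun i => β (x i)]
      with t h1 h2
    have h3 : waveletReconstruction φ ψ σ J y t - levelSum φ f J t = a₀ * periodize φ t +
        ∑ j ∈ Finset.range J, ∑ k ∈ Finset.range (2 ^ j), a j k * periodize (dilate ψ j k) t := by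
      rw [h1, hlevel0, waveletReconstruction, Finset.sum_congr rfl fun j _ => hlevel j t]
      simp only [ha₀, ha, sub_mul, Finset.sum_sub_distrib]
      ring
    have h4 := Finset.abs_sum_le_sum_abs (fun j => ∑ k ∈ Finset.range (2 ^ j),
      a j k * periodize (dilate ψ j k) t) (Finset.range J)
    -- The error splits into discretization, truncation at level `J`, and thresholding of the
    -- scaling and wavelet coefficients.
    have h5 : β t - waveletReconstruction φ ψ σ J y t = (β t - g t) - (levelSum φ f J t - f t) -
        a₀ * periodize φ t - ∑ j ∈ Finset.range J,
          ∑ k ∈ Finset.range (2 ^ j), a j k * periodize (dilate ψ j k) t := by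
      have : f t = g t := h2
      rw [this]
      linear_combination -h3
    rw [h5]
    refine (abs_sub _ _).trans (add_le_add ((abs_sub _ _).trans ?_) h4)
    gcongr
    exact abs_sub _ _
  have hβi := integrableOn_of_mem_BV hβ
  have hgi : IntegrableOn g (Icc 0 1) := integrableOn_stepFunction _
  have hfi : IntegrableOn f (Icc 0 1) :=
    (MemLp.of_bound hfm.aestronglyMeasurable _ (.of_forall hfM) :
      MemLp f 1 (volume.restrict (Icc 0 1))).integrable le_rfl
  have hφp : IntegrableOn (periodize φ) (Icc 0 1) :=
    (memLp_periodize hφA (memLp_one_iff_integrable.2 hφ1)).integrable le_rfl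
  have i1 : IntegrableOn (fun t => |β t - g t|) (Icc 0 1) := (hβi.sub hgi).abs
  have i2 : IntegrableOn (fun t => |levelSum φ f J t - f t|) (Icc 0 1) :=
    ((integrableOn_levelSum hw.memLp_scaling hφA f J).sub hfi).abs
  have i3 : IntegrableOn (fun t => |a₀ * periodize φ t|) (Icc 0 1) := (hφp.const_mul a₀).abs
  have i4 : ∀ j, IntegrableOn
      (fun t => |∑ k ∈ Finset.range (2 ^ j), a j k * periodize (dilate ψ j k) t|) (Icc 0 1) :=
    fun j => (integrable_finsetSum _ fun k _ =>
      (integrableOn_periodize_dilate hψ1 hψA j k).const_mul _).abs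
  have i5 : IntegrableOn (fun t => ∑ j ∈ Finset.range J,
      |∑ k ∈ Finset.range (2 ^ j), a j k * periodize (dilate ψ j k) t|) (Icc 0 1) :=
    integrable_finsetSum _ fun j _ => i4 j
  have i12 : IntegrableOn (fun t => |β t - g t| + |levelSum φ f J t - f t|) (Icc 0 1) := i1.add i2
  have i123 : IntegrableOn (fun t => (|β t - g t| + |levelSum φ f J t - f t|) +
    |a₀ * periodize φ t|) (Icc 0 1) := i12.add i3
  refine (integral_mono_ae (hβi.sub (integrableOn_waveletReconstruction hw hφA hψA σ J y)).abs
    (i123.add i5) hptw).trans ?_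
  rw [integral_add' i123 i5, integral_add i12 i3, integral_add i1 i2,
    integral_finsetSum _ fun j _ => i4 j]
  have e3 : ∫ t in Icc (0 : ℝ) 1, |a₀ * periodize φ t| ≤ |a₀| * ∫ t, |φ t| := by
    simp_rw [abs_mul]
    rw [integral_const_mul]
    exact mul_le_mul_of_nonneg_left (integral_abs_periodize_le hφA hφ1) (abs_nonneg _)
  have e4 : ∑ j ∈ Finset.range J, ∫ t in Icc (0 : ℝ) 1,
      |∑ k ∈ Finset.range (2 ^ j), a j k * periodize (dilate ψ j k) t| ≤
      ∑ j ∈ Finset.range J, (∑ k ∈ Finset.range (2 ^ j), |a j k|) *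
        ((2 : ℝ) ^ (-((j : ℝ) / 2)) * ∫ t, |ψ t|) :=
    Finset.sum_le_sum fun j _ => integral_abs_sum_periodize_le hψ1 hψA j (a j)
  rw [one_div_pow] at *
  linarith

end ErrorBound

end SIET

namespace SIET

/-! ### The expected `L¹` error. -/

section ExpectedError

variable {φ ψ : ℝ → ℝ} {A : ℕ} {σ : ℝ≥0} {K : ℝ} {β : ℝ → ℝ}

theorem exists_nat_support_bound {u : ℝ → ℝ} (hu : HasCompactSupport u) :
    ∃ A : ℕ, ∀ x, (A : ℝ) < |x| → u x = 0 := by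
  obtain ⟨R, hR⟩ := hu.isCompact.isBounded.exists_norm_le
  obtain ⟨A, hA⟩ := exists_nat_ge R
  refine ⟨A, fun x hx => ?_⟩
  by_contra hne
  have := hR x (subset_tsupport u hne)
  rw [Real.norm_eq_abs] at this
  linarith

theorem integrable_of_memLp_of_support {u : ℝ → ℝ} (hu : MemLp u 2 volume)
    (hA : ∀ x, (A : ℝ) < |x| → u x = 0) : Integrable u := by
  have h1 : (Icc (-(A : ℝ)) A).indicator u = u := by
    ext x
    by_cases hx : x ∈ Icc (-(A : ℝ)) A
    · rw [indicator_of_mem hx]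
    · rw [indicator_of_notMem hx, hA x (not_le.1 fun h => hx (abs_le.1 h))]
  have h2 : IntegrableOn u (Icc (-(A : ℝ)) A) := (hu.restrict _).integrable (by norm_num)
  rw [← h1]
  exact h2.integrable_indicator measurableSet_Icc

theorem periodize_dilate_normalized {u : ℝ → ℝ} (hu : MemLp u 2 volume)
    (hA : ∀ x, (A : ℝ) < |x| → u x = 0)
    (horth : ∀ k l : ℤ, ∫ x, u (x - k) * u (x - l) = if k = l then 1 else 0) (j k : ℕ) :
    MemLp (periodize (dilate u j k)) 2 (volume.restrict (Icc 0 1)) ∧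
      ∫ t in (0 : ℝ)..1, periodize (dilate u j k) t * periodize (dilate u j k) t = 1 :=
  ⟨memLp_periodize (fun _ hx => dilate_eq_zero_of_lt_abs hA j k hx) (memLp_dilate hu j k),
    integral_periodize_dilate_sq hu hA horth j k⟩

theorem two_pow_mul_two_rpow (j : ℕ) :
    (2 : ℝ) ^ j * (2 : ℝ) ^ (-((j : ℝ) / 2)) = (2 : ℝ) ^ ((j : ℝ) / 2) := by
  rw [← Real.rpow_natCast, ← Real.rpow_add two_pos]
  ring_nf

/-- The expected `L¹` error of the reconstruction is of the order `m^{-1/3} (log m)^{1/2}`. -/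
theorem exists_error_majorant (hw : IsCompactWavelet φ ψ) (hσ : 0 < σ) (hβ : β ∈ BV K)
    (x : (J : ℕ) → Fin (2 ^ J) → ℝ)
    (hx : ∀ (J : ℕ) (i : Fin (2 ^ J)),
      x J i ∈ Icc ((i.val : ℝ) / 2 ^ J) (((i.val : ℝ) + 1) / 2 ^ J)) :
    ∃ C, ∀ J, 1 ≤ J → ∃ Δ : (Fin (2 ^ J) → ℝ) → ℝ, Integrable Δ (noiseLaw σ J) ∧
      (∀ z, ∫ t in Icc (0 : ℝ) 1,
        |β t - waveletReconstruction φ ψ σ J (fun i => β (x J i) + z i) t| ≤ Δ z) ∧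
      ∫ z, Δ z ∂(noiseLaw σ J) ≤ C * rate J := by
  obtain ⟨A₁, hA₁⟩ := exists_nat_support_bound hw.hasCompactSupport_scaling
  obtain ⟨A₂, hA₂⟩ := exists_nat_support_bound hw.hasCompactSupport_mother
  set A := max A₁ A₂
  have hφA : ∀ x, (A : ℝ) < |x| → φ x = 0 := fun x hx =>
    hA₁ x ((Nat.cast_le.2 (le_max_left _ _)).trans_lt hx)
  have hψA : ∀ x, (A : ℝ) < |x| → ψ x = 0 := fun x hx =>
    hA₂ x ((Nat.cast_le.2 (le_max_right _ _)).trans_lt hx)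
  have hφ1 := integrable_of_memLp_of_support hw.memLp_scaling hφA
  have hψ1 := integrable_of_memLp_of_support hw.memLp_mother hψA
  set Nφ := ∫ t, |φ t|
  set Nψ := ∫ t, |ψ t|
  have hNφ : 0 ≤ Nφ := integral_nonneg fun t => abs_nonneg _
  have hNψ : 0 ≤ Nψ := integral_nonneg fun t => abs_nonneg _
  set v := cumVariation β 1
  have hv : 0 ≤ v := cumVariation_nonneg β 1
  -- The bound of `sum_abs_coeff_le` with `L = 2 * v`, the increment of `periodicMajorant` over a
  -- period. It does not depend on `J`.
  set D := 2 * A * (2 * v) * Nψ with hDdef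
  have hD0 : 0 ≤ D := by positivity
  set κ := v + 2 * (D * Nψ)
  have hκ : 0 ≤ κ := by positivity
  refine ⟨κ * 2 + 5 * Nφ * (σ * √2) + (15 * Nψ * (σ * √2) + 16 * D * Nψ + 6 * Nψ * (σ * √2)),
    fun J hJ => ?_⟩
  set θ₀ := empiricalCoeff J (fun i => β (x J i)) (periodize φ)
  set θ : ℕ → ℕ → ℝ := fun j k => empiricalCoeff J (fun i => β (x J i)) (periodize (dilate ψ j k))
  set l := threshold σ J with hl
  have hl0 : 0 ≤ l := threshold_nonneg _ _
  have hD : ∀ j : ℕ, ∑ k ∈ Finset.range (2 ^ j), |θ j k| ≤ D * (2 : ℝ) ^ (-((j : ℝ) / 2)) := by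
    intro j
    have h := sum_abs_coeff_le hψ1 hψA hw.vanishing_moment
      (measurable_periodicStep fun i => β (x J i)) (abs_periodicStep_le fun i => β (x J i))
      (periodic_periodicStep fun i => β (x J i))
      (monotone_periodicMajorant hβ (monotoneOn_samplePoint (hx J))
        fun t _ => samplePoint_mem (hx J) t)
      (fun s t hst => abs_periodicStep_sub_le hβ (hx J) hst)
      (periodicMajorant_add_one β (samplePoint J (x J))) j
    simp_rw [integral_periodicStep_mul] at h
    exact h
  have hφn := periodize_dilate_normalized hw.memLp_scaling hφA hw.orthonormal_scaling 0 0
  simp only [Nat.cast_zero, dilate_zero_zero] at hφn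
  have hψn := periodize_dilate_normalized hw.memLp_mother hψA hw.orthonormal_mother
  obtain ⟨i0, r0, -⟩ := risk_softThreshold hσ hJ hφn.1 hφn.2 θ₀
  have hrisk := fun j k => risk_softThreshold hσ hJ (hψn j k).1 (hψn j k).2 (θ j k)
  set w : ℕ → ℝ := fun j => (2 : ℝ) ^ (-((j : ℝ) / 2)) * Nψ with hwdef
  have hw0 : ∀ j, 0 ≤ w j := fun j => by positivity
  set δ : ℕ → ℕ → (Fin (2 ^ J) → ℝ) → ℝ := fun j k z =>
    |softThreshold l (θ j k + empiricalCoeff J z (periodize (dilate ψ j k))) - θ j k|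
  set R : ℕ → ℕ → ℝ := fun j k => ∫ z, δ j k z ∂(noiseLaw σ J)
  have i1 : Integrable (fun z => |softThreshold l (θ₀ + empiricalCoeff J z (periodize φ)) - θ₀| * Nφ)
    (noiseLaw σ J) := i0.mul_const _
  have i2 : ∀ j, Integrable (fun z => (∑ k ∈ Finset.range (2 ^ j), δ j k z) * w j)
    (noiseLaw σ J) := fun j => (integrable_finsetSum _ fun k _ => (hrisk j k).1).mul_const _
  have i3 : Integrable (fun z => ∑ j ∈ Finset.range J,
    (∑ k ∈ Finset.range (2 ^ j), δ j k z) * w j) (noiseLaw σ J) :=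
    integrable_finsetSum _ fun j _ => i2 j
  have i4 : Integrable (fun z => κ * (1 / 2) ^ J +
      |softThreshold l (θ₀ + empiricalCoeff J z (periodize φ)) - θ₀| * Nφ) (noiseLaw σ J) :=
    (integrable_const _).add i1
  refine ⟨fun z => κ * (1 / 2) ^ J +
    |softThreshold l (θ₀ + empiricalCoeff J z (periodize φ)) - θ₀| * Nφ +
    ∑ j ∈ Finset.range J, (∑ k ∈ Finset.range (2 ^ j), δ j k z) * w j, i4.add i3, fun z => ?_, ?_⟩
  · have h := integral_abs_sub_waveletReconstruction_le (σ := σ) hw hφA hψA hφ1 hψ1 hβ (hx J) hD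
      (fun i => β (x J i) + z i)
    rw [empiricalCoeff_add (hφn.1.integrable (by norm_num))] at h
    simp_rw [fun j k => empiricalCoeff_add (J := J) ((hψn j k).1.integrable (by norm_num))] at h
    exact h
  · rw [integral_add i4 i3, integral_add (integrable_const _) i1, integral_const, probReal_univ,
      one_smul, integral_mul_const, integral_finsetSum _ fun j _ => i2 j]
    have hlevel : ∀ j, ∫ z, (∑ k ∈ Finset.range (2 ^ j), δ j k z) * w j ∂(noiseLaw σ J) =
        (∑ k ∈ Finset.range (2 ^ j), R j k) * w j := fun j => by
      rw [integral_mul_const, integral_finsetSum _ fun k _ => (hrisk j k).1]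
    simp_rw [hlevel]
    have hpow : ∀ j : ℕ, (2 : ℝ) ^ j * w j = Nψ * (2 : ℝ) ^ ((j : ℝ) / 2) := fun j => by
      rw [hwdef, ← two_pow_mul_two_rpow]
      ring
    -- The split is at `n = J / 3`: the uniform risk bound is used below it, the sparse one above.
    have hsum := sum_le_of_le_of_le (ρ := fun j => (∑ k ∈ Finset.range (2 ^ j), R j k) * w j)
      (a := 5 * l * Nψ) (b := 2 * D * Nψ) (r := 2 * l / 2 ^ J * Nψ) (by positivity) (by positivity)
      (by positivity) (Nat.div_le_self J 3)
      (fun j _ => by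
        calc (∑ k ∈ Finset.range (2 ^ j), R j k) * w j
            ≤ (∑ k ∈ Finset.range (2 ^ j), 5 * l) * w j := by
              gcongr with k hk
              exact (hrisk j k).2.1
          _ = 5 * l * ((2 : ℝ) ^ j * w j) := by
              rw [Finset.sum_const, Finset.card_range, nsmul_eq_mul]
              push_cast
              ring
          _ = _ := by rw [hpow]; ring)
      (fun j _ => by
        calc (∑ k ∈ Finset.range (2 ^ j), R j k) * w j
            ≤ (∑ k ∈ Finset.range (2 ^ j), (2 * |θ j k| + 2 * l / 2 ^ J)) * w j := by
              gcongr with k hk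
              exact (hrisk j k).2.2
          _ = 2 * (∑ k ∈ Finset.range (2 ^ j), |θ j k|) * w j +
                2 * l / 2 ^ J * ((2 : ℝ) ^ j * w j) := by
              rw [Finset.sum_add_distrib, Finset.sum_const, Finset.card_range, nsmul_eq_mul,
                ← Finset.mul_sum]
              push_cast
              ring
          _ ≤ 2 * (D * (2 : ℝ) ^ (-((j : ℝ) / 2))) * w j +
                2 * l / 2 ^ J * ((2 : ℝ) ^ j * w j) := by
              gcongr
              exact hD j
          _ = _ := by
              rw [hpow, hwdef, ← two_rpow_neg_half_mul_self]
              ring)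
    -- The noise excess over all levels is of order `λ 2^{J/2}/m`; the crude bound `2^{J/2} ≤ m`
    -- already suffices.
    have hr : 2 * l / 2 ^ J * Nψ * (2 : ℝ) ^ ((J : ℝ) / 2) ≤ 2 * l * Nψ := by
      have : (2 : ℝ) ^ ((J : ℝ) / 2) ≤ 2 ^ J := by
        rw [← Real.rpow_natCast]
        exact Real.rpow_le_rpow_of_exponent_le one_le_two (half_le_self (Nat.cast_nonneg J))
      calc 2 * l / 2 ^ J * Nψ * (2 : ℝ) ^ ((J : ℝ) / 2) ≤ 2 * l / 2 ^ J * Nψ * 2 ^ J := by gcongr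
        _ = 2 * l * Nψ := by field_simp
    have b1 : κ * (1 / 2) ^ J ≤ κ * (2 * rate J) := by
      have := inv_two_pow_le_rate hJ
      rw [one_div_pow]
      gcongr
    have b2 : 5 * l * Nφ ≤ 5 * (σ * √2 * rate J) * Nφ := by
      have := threshold_le_rate σ J
      gcongr
    have b2' := mul_le_mul_of_nonneg_right r0 hNφ
    have b3 : l * (2 : ℝ) ^ (((J / 3 : ℕ) : ℝ) / 2) * (15 * Nψ) ≤ σ * √2 * rate J * (15 * Nψ) :=
      mul_le_mul_of_nonneg_right (threshold_mul_le_rate σ J) (by positivity)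
    have b4 : 4 * D * Nψ * (1 / 2) ^ (J / 3) ≤ 4 * D * Nψ * (4 * rate J) := by
      have := half_pow_le_rate hJ
      gcongr
    have b5 : 6 * Nψ * l ≤ 6 * Nψ * (σ * √2 * rate J) := by
      have := threshold_le_rate σ J
      gcongr
    linarith

end ExpectedError

/-! ### From the `L¹` error to the expected information loss. -/

section InformationLoss

variable {𝒴 : Type*} [MeasurableSpace 𝒴] {W : Kernel unitInterval 𝒴} {cmax : ℝ}

/-- The expected information loss in terms of the expected `L¹` reconstruction error. -/
theorem isBigO_expectedInfoLoss [IsMarkovKernel W] (hcap : maxCapacity W cmax ≠ ⊤) {φ ψ : ℝ → ℝ}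
    (hw : IsCompactWavelet φ ψ) {σ : ℝ≥0} (hσ : 0 < σ) {K : ℝ} {β : ℝ → ℝ} (hβ : β ∈ BV K)
    (hβ0 : ∀ t ∈ Icc (0 : ℝ) 1, 0 ≤ β t) (x : (J : ℕ) → Fin (2 ^ J) → ℝ)
    (hx : ∀ (J : ℕ) (i : Fin (2 ^ J)),
      x J i ∈ Icc ((i.val : ℝ) / 2 ^ J) (((i.val : ℝ) + 1) / 2 ^ J))
    {α c : ℝ} (hα : 0 < α)
    (hHolder : ∀ B₁ ∈ Ioo 0 (maxEnergy cmax β), ∀ B₂ ∈ Ioo 0 (maxEnergy cmax β),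
      |capacityEnergyReal W cmax β B₁ - capacityEnergyReal W cmax β B₂| ≤ c * |B₁ - B₂| ^ α)
    {B : ℝ} (hB : B ∈ Ico 0 (maxEnergy cmax β))
    (hint : ∀ J, Integrable (infoLoss W cmax φ ψ σ β J (x J) B) (noiseLaw σ J))
    (hrec : ∀ J y, IntegrableOn (waveletReconstruction φ ψ σ J y) (Icc 0 1)) :
    (fun J : ℕ => expectedInfoLoss W cmax φ ψ σ β J (x J) B) =O[atTop]
      fun J => rate J ^ (α / (α + 1)) := by
  have hβi := integrableOn_of_mem_BV hβ
  obtain ⟨ε₀, hε₀, hloss⟩ :=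
    exists_forall_abs_capacityEnergyReal_sub_le hcap hβi hβ0 hHolder hα hB
  obtain ⟨C, hC⟩ := exists_error_majorant hw hσ hβ x hx
  set Cm := (maxCapacity W cmax).toReal
  have hCm : 0 ≤ Cm := ENNReal.toReal_nonneg
  have hα1 : 0 < α + 1 := by linarith
  have hsmall : ∀ᶠ J in atTop, rate J ^ (1 / (α + 1)) < ε₀ := by
    have h : Tendsto (fun J => rate J ^ (1 / (α + 1))) atTop (𝓝 0) := by
      have := tendsto_rate.rpow_const (p := 1 / (α + 1)) (Or.inr (by positivity))
      rwa [Real.zero_rpow (by positivity)] at this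
    exact h.eventually_lt_const hε₀
  refine Asymptotics.IsBigO.of_bound (|c| + Cm * |cmax| * C) ?_
  filter_upwards [hsmall, eventually_ge_atTop 1] with J hJε hJ
  obtain ⟨Δ, hΔi, hΔ, hΔC⟩ := hC J hJ
  set δ := rate J
  have hδ : 0 < δ := rate_pos hJ
  -- This choice equates the Hölder term `ε^α` with the Markov term `δ/ε`.
  set ε := δ ^ (1 / (α + 1)) with hε
  have hε0 : 0 < ε := by positivity
  have hεα : ε ^ α = δ ^ (α / (α + 1)) := by
    rw [hε, ← Real.rpow_mul hδ.le]
    ring_nf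
  have hδε : δ / ε = δ ^ (α / (α + 1)) := by
    rw [hε, div_eq_iff (by positivity), ← Real.rpow_add hδ, ← add_div, div_self hα1.ne',
      Real.rpow_one]
  -- Markov's inequality in pointwise form: when the energy error may exceed `ε`, the loss is at
  -- most `Cm`, and the ratio multiplying `Cm` exceeds `1`.
  have hptw : ∀ z, infoLoss W cmax φ ψ σ β J (x J) B z ≤
      |c| * ε ^ α + Cm * (|cmax| * Δ z / ε) := by
    intro z
    have hΔ0 : 0 ≤ Δ z := (integral_nonneg fun t => abs_nonneg _).trans (hΔ z)
    have hq : 0 ≤ |cmax| * Δ z / ε := by positivity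
    rcases le_or_gt (|cmax| * Δ z) ε with h | h
    · have h1 := hloss ε hε0 hJε (waveletReconstruction φ ψ σ J fun i => β (x J i) + z i)
        fun p hp => (hp.abs_energy_sub_le hβi (hrec J _)).trans <| by
          refine le_trans ?_ h
          exact mul_le_mul (le_abs_self _) (hΔ z) (integral_nonneg fun t => abs_nonneg _)
            (abs_nonneg _)
      have h2 : c * ε ^ α ≤ |c| * ε ^ α :=
        mul_le_mul_of_nonneg_right (le_abs_self c) (by positivity)
      have h3 : 0 ≤ Cm * (|cmax| * Δ z / ε) := by positivity
      exact h1.trans (by linarith)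
    · have h1 : infoLoss W cmax φ ψ σ β J (x J) B z ≤ Cm :=
        abs_capacityEnergyReal_sub_le hcap _ _ _
      have h2 : Cm ≤ Cm * (|cmax| * Δ z / ε) :=
        le_mul_of_one_le_right hCm ((one_le_div hε0).2 h.le)
      have h3 : 0 ≤ |c| * ε ^ α := by positivity
      linarith
  have hi : Integrable (fun z => Cm * (|cmax| * Δ z / ε)) (noiseLaw σ J) :=
    ((hΔi.const_mul _).div_const _).const_mul _
  have hint2 : Integrable (fun z => |c| * ε ^ α + Cm * (|cmax| * Δ z / ε)) (noiseLaw σ J) :=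
    (integrable_const _).add hi
  have hmain := integral_mono (hint J) hint2 hptw
  rw [integral_add (integrable_const _) hi, integral_const, probReal_univ, one_smul,
    integral_const_mul, integral_div, integral_const_mul] at hmain
  have h0 : 0 ≤ expectedInfoLoss W cmax φ ψ σ β J (x J) B :=
    integral_nonneg fun z => abs_nonneg _
  rw [Real.norm_of_nonneg h0, Real.norm_of_nonneg (by positivity)]
  refine hmain.trans ?_
  calc |c| * ε ^ α + Cm * (|cmax| * (∫ z, Δ z ∂(noiseLaw σ J)) / ε)
      ≤ |c| * ε ^ α + Cm * (|cmax| * (C * δ) / ε) := by gcongr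
    _ = |c| * ε ^ α + Cm * |cmax| * C * (δ / ε) := by ring
    _ = _ := by rw [hεα, hδε]; ring

theorem rate_rpow (α : ℝ) (J : ℕ) :
    rate J ^ (α / (α + 1)) = ((2 : ℝ) ^ J) ^ (-(α / (3 * (α + 1)))) *
      Real.log ((2 : ℝ) ^ J) ^ (α / (2 * (α + 1))) := by
  have h0 : 0 ≤ Real.log ((2 : ℝ) ^ J) := Real.log_nonneg (one_le_pow₀ one_le_two)
  rw [rate, Real.mul_rpow (by positivity) (Real.rpow_nonneg h0 _), ← Real.rpow_mul (by positivity),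
    ← Real.rpow_mul h0]
  congr 2
  · rw [neg_mul, div_mul_div_comm, one_mul]
  · rw [div_mul_div_comm, one_mul]

end InformationLoss

end SIET

theorem corollary2 {𝒴 : Type*} [MeasurableSpace 𝒴]
    (W : Kernel unitInterval 𝒴) [IsMarkovKernel W]
    (cmax : ℝ) (hcap : SIET.maxCapacity W cmax ≠ ⊤)
    (φ ψ : ℝ → ℝ) (hwav : SIET.IsCompactWavelet φ ψ)
    (σ : ℝ≥0) (hσ : 0 < σ)
    (K : ℝ) (β : ℝ → ℝ) (hβ : β ∈ SIET.BV K) (hβ0 : ∀ t ∈ Icc (0 : ℝ) 1, 0 ≤ β t)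
    (x : (J : ℕ) → Fin (2 ^ J) → ℝ)
    (hx : ∀ (J : ℕ) (i : Fin (2 ^ J)),
      x J i ∈ Icc ((i.val : ℝ) / 2 ^ J) (((i.val : ℝ) + 1) / 2 ^ J))
    (α c : ℝ) (hα : 0 < α)
    (hHolder : ∀ B₁ ∈ Ioo 0 (SIET.maxEnergy cmax β), ∀ B₂ ∈ Ioo 0 (SIET.maxEnergy cmax β),
      |SIET.capacityEnergyReal W cmax β B₁ - SIET.capacityEnergyReal W cmax β B₂|
        ≤ c * |B₁ - B₂| ^ α)
    (B : ℝ) (hB : B ∈ Ico 0 (SIET.maxEnergy cmax β)) :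
    (∀ J, Integrable (SIET.infoLoss W cmax φ ψ σ β J (x J) B) (SIET.noiseLaw σ J)) ∧
    (fun J : ℕ => SIET.expectedInfoLoss W cmax φ ψ σ β J (x J) B) =O[atTop]
      (fun J : ℕ => ((2 : ℝ) ^ J) ^ (-(α / (3 * (α + 1)))) *
        (Real.log ((2 : ℝ) ^ J)) ^ (α / (2 * (α + 1)))) ∧
    (α = 1 →
      (fun J : ℕ => SIET.expectedInfoLoss W cmax φ ψ σ β J (x J) B) =O[atTop]
        (fun J : ℕ => ((2 : ℝ) ^ J) ^ (-(1 / 6) : ℝ) *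
          (Real.log ((2 : ℝ) ^ J)) ^ (1 / 4 : ℝ))) := by
  obtain ⟨A₁, hA₁⟩ := SIET.exists_nat_support_bound hwav.hasCompactSupport_scaling
  obtain ⟨A₂, hA₂⟩ := SIET.exists_nat_support_bound hwav.hasCompactSupport_mother
  have hφA : ∀ x, ((max A₁ A₂ : ℕ) : ℝ) < |x| → φ x = 0 := fun x hx =>
    hA₁ x ((Nat.cast_le.2 (le_max_left _ _)).trans_lt hx)
  have hψA : ∀ x, ((max A₁ A₂ : ℕ) : ℝ) < |x| → ψ x = 0 := fun x hx =>
    hA₂ x ((Nat.cast_le.2 (le_max_right _ _)).trans_lt hx)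
  have hint := fun J => SIET.integrable_infoLoss hcap hwav hφA hψA hσ β J (x J) B
  have hmain := SIET.isBigO_expectedInfoLoss hcap hwav hσ hβ hβ0 x hx hα hHolder hB hint
    fun J y => SIET.integrableOn_waveletReconstruction hwav hφA hψA σ J y
  simp_rw [SIET.rate_rpow] at hmain
  refine ⟨hint, hmain, fun h1 => ?_⟩
  subst h1
  convert! hmain using 5 <;> norm_num
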